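/- Let $(M,g)$ be a smooth Riemannian manifold, not assumed to be complete, with Riemannian volume measure $\mathrm{dv}$ and negative definite Laplace--Beltrami operator $\Delta$. Let $V\in L^\infty_{loc}(M)$ with $V>0$ almost everywhere, let $p\in(1,\infty)$ and put $p'=\frac{p}{p-1}$. For a real $q\geq 1$, one says that $M$ satisfies the $L^q$ positivity preserving property for $-\Delta+V$ if every real-valued $u\in L^q(M)$ with $(-\Delta+V)u\geq 0$ in the sense of distributions, that is, with $$\int_M u\,(-\Delta+V)\psi\,\mathrm{dv}\geq 0\qquad\text{for all } 0\leq\psi\in C_c^\infty(M),$$ satisfies $u\geq 0$ almost everywhere. Let $(-\Delta+V)_{p,max}$ be the operator in $L^p(M)$ (real- or complex-valued functions) with domain $$D=\{u\in L^p(M)\;:\;Vu\in L^1_{loc}(M),\ (-\Delta+V)u\in L^p(M)\},$$ where $(-\Delta+V)u$ is taken in the sense of distributions, acting by $u\mapsto(-\Delta+V)u$. If $M$ satisfies both the $L^p$ and the $L^{p'}$ positivity preserving property for $-\Delta+V$, then $C_c^\infty(M)$ is an operator core for $(-\Delta+V)_{p,max}$: one has $C_c^\infty(M)\subset D$, and the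 closure of the restriction of $(-\Delta+V)_{p,max}$ to $C_c^\infty(M)$ is $(-\Delta+V)_{p,max}$. -/

import Mathlib

open scoped Manifold ContDiff ENNReal
open MeasureTheory

namespace RiemannianSchrodinger

noncomputable section

/-! A Riemannian manifold of dimension `n` is a smooth boundaryless manifold `M` modelled on
`EuclideanSpace ℝ (Fin n)` together with a smooth Riemannian metric `g` on its tangent bundle. -/

/-- Smooth Riemannian metrics on the `n`-dimensional manifold `M`. -/
abbrev SmoothMetric (n : ℕ) (M : Type*) [TopologicalSpace M]
    [ChartedSpace (EuclideanSpace ℝ (Fin n)) M] [IsManifold (𝓡 n) ∞ M] :=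
  Bundle.ContMDiffRiemannianMetric (𝓡 n) ∞ (EuclideanSpace ℝ (Fin n))
    (fun x : M => TangentSpace (𝓡 n) x)

section Geometry

variable {n : ℕ} {M : Type*} [TopologicalSpace M] [ChartedSpace (EuclideanSpace ℝ (Fin n)) M]
  [IsManifold (𝓡 n) ∞ M]

/-- The `i`-th coordinate vector field `∂ᵢ` of the chart around `x`, at the point with
coordinates `y`: the image of the `i`-th basis vector under the derivative of the inverse chart. -/
def coordVector (n : ℕ) {M : Type*} [TopologicalSpace M]
    [ChartedSpace (EuclideanSpace ℝ (Fin n)) M] (x : M) (y : EuclideanSpace ℝ (Fin n))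
    (i : Fin n) : TangentSpace (𝓡 n) ((extChartAt (𝓡 n) x).symm y) :=
  mfderiv 𝓘(ℝ, EuclideanSpace ℝ (Fin n)) (𝓡 n) (extChartAt (𝓡 n) x).symm y
    (EuclideanSpace.single i (1 : ℝ) : EuclideanSpace ℝ (Fin n))

/-- The matrix `g_ij = g(∂ᵢ, ∂ⱼ)` of the metric in the chart around `x`, at coordinates `y`. -/
def metricMatrix (g : SmoothMetric n M) (x : M) (y : EuclideanSpace ℝ (Fin n)) :
    Matrix (Fin n) (Fin n) ℝ :=
  Matrix.of fun i j =>
    g.inner ((extChartAt (𝓡 n) x).symm y) (coordVector n x y i) (coordVector n x y j)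

/-- The Riemannian density `√(det g_ij)` in the chart around `x`. -/
def volDensity (g : SmoothMetric n M) (x : M) (y : EuclideanSpace ℝ (Fin n)) : ℝ :=
  √(metricMatrix g x y).det

/-- The Riemannian volume of the domain of the chart around `x`, extended by zero to `M`:
the image of `√(det g_ij) dy` under the inverse chart. -/
def chartVolume [MeasurableSpace M] (g : SmoothMetric n M) (x : M) : Measure M :=
  ((volume.restrict (extChartAt (𝓡 n) x).target).withDensity
    (fun y => ENNReal.ofReal (volDensity g x y))).map (extChartAt (𝓡 n) x).symm

/-- The Riemannian volume measure `dv`: the least measure on `M` that dominates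
`√(det g_ij) dy` in every chart. By the change of variables formula the measures
`chartVolume g x` agree on the overlaps of the charts, so that this measure restricts to
`√(det g_ij) dy` in each of them. -/
def vol [MeasurableSpace M] (g : SmoothMetric n M) : Measure M :=
  ⨆ x : M, chartVolume g x

/-- The (negative definite) Laplace-Beltrami operator, evaluated at `x` by the formula
`Δψ = |g|^(-1/2) ∑ᵢ ∂ᵢ (|g|^(1/2) ∑ⱼ gⁱʲ ∂ⱼψ)` in the chart around `x`. -/
def laplacian (g : SmoothMetric n M) (ψ : M → ℝ) (x : M) : ℝ :=
  (volDensity g x (extChartAt (𝓡 n) x x))⁻¹ *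
    ∑ i : Fin n, fderiv ℝ
      (fun y => volDensity g x y * ∑ j : Fin n, (metricMatrix g x y)⁻¹ i j *
        fderiv ℝ (fun z => ψ ((extChartAt (𝓡 n) x).symm z)) y (EuclideanSpace.single j 1))
      (extChartAt (𝓡 n) x x) (EuclideanSpace.single i 1)

/-- The differential expression `(-Δ + V) ψ`. -/
def schrodinger (g : SmoothMetric n M) (V : M → ℝ) (ψ : M → ℝ) (x : M) : ℝ :=
  -laplacian g ψ x + V x * ψ x

/-- `C_c^∞(M)` with values in the real or complex numbers. -/
def IsTestFunction (n : ℕ) {M : Type*} [TopologicalSpace M]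
    [ChartedSpace (EuclideanSpace ℝ (Fin n)) M] {𝕜 : Type*} [RCLike 𝕜] (φ : M → 𝕜) : Prop :=
  ContMDiff (𝓡 n) 𝓘(ℝ, 𝕜) ∞ φ ∧ HasCompactSupport φ

end Geometry

section Operators

variable {n : ℕ} {M : Type*} [TopologicalSpace M] [ChartedSpace (EuclideanSpace ℝ (Fin n)) M]
  [IsManifold (𝓡 n) ∞ M] [MeasurableSpace M]

/-- `V ∈ L^∞_loc(M)`. -/
def MemLinftyLoc (g : SmoothMetric n M) (V : M → ℝ) : Prop :=
  ∀ K : Set M, IsCompact K → MemLp V ∞ ((vol g).restrict K)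

/-- `(-Δ + V) u ≥ 0` in the sense of distributions. -/
def DistribNonneg (g : SmoothMetric n M) (V u : M → ℝ) : Prop :=
  ∀ ψ : M → ℝ, IsTestFunction n ψ → (∀ x, 0 ≤ ψ x) →
    Integrable (fun x => u x * schrodinger g V ψ x) (vol g) ∧
      0 ≤ ∫ x, u x * schrodinger g V ψ x ∂(vol g)

/-- The `S` positivity preserving property for `-Δ + V`, for a family `S` of functions. -/
def PositivityPreserving (g : SmoothMetric n M) (V : M → ℝ) (S : Set (M → ℝ)) : Prop :=
  ∀ u ∈ S, DistribNonneg g V u → ∀ᵐ x ∂(vol g), 0 ≤ u x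

/-- The `L^p` positivity preserving property for `-Δ + V`. -/
def LpPositivityPreserving (g : SmoothMetric n M) (V : M → ℝ) (p : ℝ≥0∞) : Prop :=
  PositivityPreserving g V {u | MemLp u p (vol g)}

/-- `u`, `V u` and `f` are locally integrable and `(-Δ + V) u = f` in the sense of
distributions. -/
structure DistribEq {𝕜 : Type*} [RCLike 𝕜] (g : SmoothMetric n M) (V : M → ℝ) (u f : M → 𝕜) :
    Prop where
  locallyIntegrable_left : LocallyIntegrable u (vol g)
  locallyIntegrable_potential : LocallyIntegrable (fun x => V x • u x) (vol g)
  locallyIntegrable_right : LocallyIntegrable f (vol g)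
  integrable : ∀ ψ : M → ℝ, IsTestFunction n ψ →
    Integrable (fun x => schrodinger g V ψ x • u x) (vol g)
  integral_eq : ∀ ψ : M → ℝ, IsTestFunction n ψ →
    ∫ x, schrodinger g V ψ x • u x ∂(vol g) = ∫ x, ψ x • f x ∂(vol g)

section DistribEq

variable {𝕜 : Type*} [RCLike 𝕜] {g : SmoothMetric n M} {V : M → ℝ} {u u' f f' : M → 𝕜}

theorem DistribEq.congr (h : DistribEq g V u f) (hu : u =ᵐ[vol g] u') (hf : f =ᵐ[vol g] f') :
    DistribEq g V u' f' where
  locallyIntegrable_left := h.locallyIntegrable_left.congr hu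
  locallyIntegrable_potential := h.locallyIntegrable_potential.congr
    (hu.mono fun x hx => by simp only [hx])
  locallyIntegrable_right := h.locallyIntegrable_right.congr hf
  integrable ψ hψ := (h.integrable ψ hψ).congr (hu.mono fun x hx => by simp only [hx])
  integral_eq ψ hψ := by
    have hu' : (fun x => schrodinger g V ψ x • u' x) =ᵐ[vol g]
        fun x => schrodinger g V ψ x • u x := hu.mono fun x hx => by simp only [hx]
    rw [integral_congr_ae hu', h.integral_eq ψ hψ]
    exact integral_congr_ae (hf.mono fun x hx => by simp only [hx])

theorem DistribEq.zero : DistribEq g V (0 : M → 𝕜) 0 where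
  locallyIntegrable_left := locallyIntegrable_zero
  locallyIntegrable_potential := by simpa using! (locallyIntegrable_zero (μ := vol g) (ε'' := 𝕜))
  locallyIntegrable_right := locallyIntegrable_zero
  integrable ψ hψ := by simp
  integral_eq ψ hψ := by simp

theorem DistribEq.smul (c : 𝕜) (h : DistribEq g V u f) : DistribEq g V (c • u) (c • f) where
  locallyIntegrable_left := h.locallyIntegrable_left.smul c
  locallyIntegrable_potential := by
    convert! h.locallyIntegrable_potential.smul c using 2 with x
    simp
  locallyIntegrable_right := h.locallyIntegrable_right.smul c
  integrable ψ hψ := by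
    convert! (h.integrable ψ hψ).smul c using 2 with x
    simp
  integral_eq ψ hψ := by
    simp only [Pi.smul_apply, smul_comm _ c, integral_smul, h.integral_eq ψ hψ]

variable [OpensMeasurableSpace M] [T2Space M]

theorem DistribEq.add (h : DistribEq g V u f) (h' : DistribEq g V u' f') :
    DistribEq g V (u + u') (f + f') where
  locallyIntegrable_left := h.locallyIntegrable_left.add h'.locallyIntegrable_left
  locallyIntegrable_potential := by
    convert! h.locallyIntegrable_potential.add h'.locallyIntegrable_potential using 2 with x
    simp [smul_add]
  locallyIntegrable_right := h.locallyIntegrable_right.add h'.locallyIntegrable_right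
  integrable ψ hψ := by
    convert! (h.integrable ψ hψ).add (h'.integrable ψ hψ) using 2 with x
    simp [smul_add]
  integral_eq ψ hψ := by
    simp only [Pi.add_apply, smul_add]
    rw [integral_add (h.integrable ψ hψ) (h'.integrable ψ hψ), integral_add,
      h.integral_eq ψ hψ, h'.integral_eq ψ hψ]
    · exact h.locallyIntegrable_right.integrable_smul_left_of_hasCompactSupport
        hψ.1.continuous hψ.2
    · exact h'.locallyIntegrable_right.integrable_smul_left_of_hasCompactSupport
        hψ.1.continuous hψ.2

end DistribEq

variable [BorelSpace M] [T2Space M]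

/-- The graph of `(-Δ + V)_{p,max}`: the pairs `(u, f)` in `L^p(M) × L^p(M)` such that
`V u ∈ L^1_loc(M)` and `(-Δ + V) u = f` in the sense of distributions. -/
def maxGraph (𝕜 : Type*) [RCLike 𝕜] (g : SmoothMetric n M) (V : M → ℝ) (p : ℝ≥0∞) :
    Submodule 𝕜 (Lp 𝕜 p (vol g) × Lp 𝕜 p (vol g)) where
  carrier := {w | DistribEq g V (w.1 : M → 𝕜) (w.2 : M → 𝕜)}
  zero_mem' := DistribEq.zero.congr (Lp.coeFn_zero 𝕜 p _).symm (Lp.coeFn_zero 𝕜 p _).symm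
  add_mem' := fun {a b} ha hb =>
    (DistribEq.add ha hb).congr (Lp.coeFn_add a.1 b.1).symm (Lp.coeFn_add a.2 b.2).symm
  smul_mem' := fun c a ha =>
    (DistribEq.smul c ha).congr (Lp.coeFn_smul c a.1).symm (Lp.coeFn_smul c a.2).symm

/-- The operator `(-Δ + V)_{p,max}` in `L^p(M)`: its domain consists of the `u ∈ L^p(M)` with
`V u ∈ L^1_loc(M)` and `(-Δ + V) u ∈ L^p(M)`, and it acts as `-Δ + V` in the sense of
distributions. -/
def schrodingerMax (𝕜 : Type*) [RCLike 𝕜] (g : SmoothMetric n M) (V : M → ℝ) (p : ℝ≥0∞) :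
    Lp 𝕜 p (vol g) →ₗ.[𝕜] Lp 𝕜 p (vol g) :=
  (maxGraph 𝕜 g V p).toLinearPMap

/-- `maxGraph` is indeed the graph of `schrodingerMax`, because `f` is determined by `u`. -/
theorem schrodingerMax_graph [SecondCountableTopology M] (𝕜 : Type*) [RCLike 𝕜]
    (g : SmoothMetric n M) (V : M → ℝ) (p : ℝ≥0∞) :
    (schrodingerMax 𝕜 g V p).graph = maxGraph 𝕜 g V p := by
  refine Submodule.toLinearPMap_graph_eq _ fun w hw hw0 => ?_
  have : LocallyCompactSpace M :=
    ChartedSpace.locallyCompactSpace (EuclideanSpace ℝ (Fin n)) M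
  have hw' : DistribEq g V (w.1 : M → 𝕜) (w.2 : M → 𝕜) := hw
  have h0 : DistribEq g V (0 : M → 𝕜) (w.2 : M → 𝕜) :=
    hw'.congr (by rw [hw0]; exact Lp.coeFn_zero 𝕜 p _) Filter.EventuallyEq.rfl
  refine (Lp.eq_zero_iff_ae_eq_zero).2 ?_
  refine ae_eq_zero_of_integral_contMDiff_smul_eq_zero (𝓡 n) h0.locallyIntegrable_right ?_
  intro ψ hψ hψ'
  rw [← h0.integral_eq ψ ⟨hψ, hψ'⟩]
  simp

/-- `C_c^∞(M)` as a subspace of `L^p(M)`. -/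
def testSubmodule (𝕜 : Type*) [RCLike 𝕜] (g : SmoothMetric n M) (p : ℝ≥0∞) :
    Submodule 𝕜 (Lp 𝕜 p (vol g)) where
  carrier := {u | ∃ φ : M → 𝕜, IsTestFunction n φ ∧ (u : M → 𝕜) =ᵐ[vol g] φ}
  zero_mem' := ⟨0, ⟨contMDiff_const, HasCompactSupport.zero⟩, Lp.coeFn_zero 𝕜 p _⟩
  add_mem' := by
    rintro u v ⟨φ, hφ, hu⟩ ⟨ψ, hψ, hv⟩
    exact ⟨φ + ψ, ⟨hφ.1.add hψ.1, hφ.2.add hψ.2⟩, (Lp.coeFn_add u v).trans (hu.add hv)⟩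
  smul_mem' := by
    rintro c u ⟨φ, hφ, hu⟩
    refine ⟨c • φ, ⟨?_, hφ.2.smul_left (f := fun _ => c)⟩,
      (Lp.coeFn_smul c u).trans (hu.const_smul c)⟩
    exact ((ContinuousLinearMap.mul ℝ 𝕜 c).contMDiff).comp hφ.1

end Operators

end

end RiemannianSchrodinger

/-!
Write `H = -Δ + V` with `V ≥ 0`. The maximal operator is closed, so its restriction to `C_c^∞(M)` is
closable, and it has to be shown that the closure is not smaller. This follows from properties of
`H + 1`, by the usual scheme for accretive operators.

* *Accretivity.* `‖φ‖_p ≤ ‖(H + 1) φ‖_p` for test functions `φ`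
  (`eLpNorm_le_eLpNorm_schrodinger_add`): multiply `(H + 1) φ` by a smooth regularization of
  `|φ|^(p-2) φ` and use Green's formula and convexity. Hence the range of `H + 1` on the closure is
  closed (`isClosed_map_of_le_norm`).
* *Density of the range.* A functional on `L^p` is given by some `h ∈ L^{p'}`
  (`exists_memLp_forall_apply_eq_integral`). If it vanishes on `(H + 1) C_c^∞(M)`, then
  `(H + 1) h = 0` in the sense of distributions.
* *Uniqueness.* If `h ∈ L^q` and `(H + 1) h = 0`, then `h = 0`, under the `L^q` positivity preserving
  property (`LpPositivityPreserving.ae_eq_zero`). This is used with `q = p'` for the density, and with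
  `q = p` to identify an element `w` of the maximal domain with the element `v` of the closure that
  satisfies `(H + 1) v = (H + 1) w` (`maxGraph_le_topologicalClosure_real`).

Uniqueness rests on Kato's inequality: `Δ h = (V + 1) h` implies `Δ|h| ≥ (V + 1) |h|`, so that
`H (-|h|) ≥ |h| ≥ 0`, and positivity preservation gives `-|h| ≥ 0` (`distribNonneg_neg_abs`).

Kato's inequality is needed for distributional solutions `h` that are only locally integrable. No
elliptic regularity is used. The statement is local, and in a chart the Laplacian is an operator
`ℒ = ∑ ∂ᵢ aᵢⱼ ∂ⱼ` in divergence form, which can be modified away from a compact set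
(`exists_ellipticData`). Let `G = a⁻¹`, `S(x, y) = ½ ⟨(G(x) + G(y)) (x - y), x - y⟩`,
`c = (det G)^(1/4)`, and mollify `h` with the symmetric kernel
`k(x, y) = ε⁻ⁿ c(x) c(y) φ(S(x, y) / ε²)`. The mollifications are smooth, and satisfy the equation up
to the integral operator with kernel `(ℒ_x - ℒ_y) k`. A general smooth mollifier makes this kernel of
size `ε⁻¹ ε⁻ⁿ`, which would need derivatives of `h`. The choice of `S` and `c` makes it of size
`ε ε⁻ⁿ` (`KernelData.exists_commutator_bound`), so that the error vanishes in the limit for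
`h ∈ L¹_loc`. The reason is that `S` and `c` are symmetric approximate solutions of the eikonal and
transport equations: the squared gradients of `S` in `x` and `y` differ by a term of fifth order in
`|x - y|` (`KernelData.isBigO_eikonal`), and the first order coefficients by a term of third order
(`KernelData.isBigO_transport`). What would be of lower order is in both cases an error of the
trapezoidal rule along the segment from `y` to `x`, which is of third order (`isBigO_trapezoidal`).

The chain rule for smooth convex functions of the mollifications, the limit `ε → 0`, where the
kernels form an approximate identity, and then the limit `√(h² + δ²) → |h|` give Kato's inequality for
`ℒ` (`EllipticData.WeakEq.le_integral_abs`, `le_integral_abs_mul_divForm`). It is carried over to the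
manifold with a partition of unity (`le_integral_abs_mul_laplacian`). This uses that the formulas for
the Laplacian and the volume hold in all charts (`laplacian_eq_divForm`, `vol_restrict_source`).
-/

/-! ### Duality of `L^p` spaces -/

namespace RiemannianSchrodinger

section LpDuality

open Filter Topology

variable {α : Type*} [MeasurableSpace α]

/-- The Radon–Nikodym density of the signed measure `A ↦ Λ 1_A`. -/
theorem exists_integrable_forall_apply_indicatorConstLp {μ : Measure α} [IsFiniteMeasure μ]
    {p : ℝ≥0∞} [Fact (1 ≤ p)] (hp : p ≠ ⊤) (Λ : Lp ℝ p μ →L[ℝ] ℝ) :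
    ∃ d : α → ℝ, Measurable d ∧ Integrable d μ ∧ ∀ (A : Set α) (hA : MeasurableSet A),
      Λ (indicatorConstLp p hA (measure_ne_top μ A) 1) = ∫ x in A, d x ∂μ := by
  classical
  have hp0 : p ≠ 0 := (zero_lt_one.trans_le (Fact.out : 1 ≤ p)).ne'
  let T : Set α → ℝ := fun A => if hA : MeasurableSet A then
    Λ (indicatorConstLp p hA (measure_ne_top μ A) 1) else 0
  have T_meas : ∀ {A} (hA : MeasurableSet A),
      T A = Λ (indicatorConstLp p hA (measure_ne_top μ A) 1) := fun hA => dif_pos hA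
  have T_union : ∀ {A B}, MeasurableSet A → MeasurableSet B → Disjoint A B →
      T (A ∪ B) = T A + T B := by
    intro A B hA hB hAB
    rw [T_meas hA, T_meas hB, T_meas (hA.union hB), ← map_add]
    congr 1
    exact indicatorConstLp_disjoint_union hA hB _ _ hAB _
  have T_empty : T ∅ = 0 := by
    rw [T_meas MeasurableSet.empty, indicatorConstLp_empty, map_zero]
  have T_sum : ∀ {f : ℕ → Set α}, (∀ i, MeasurableSet (f i)) → Pairwise (Function.onFun Disjoint f) →
      ∀ s : Finset ℕ, T (⋃ i ∈ s, f i) = ∑ i ∈ s, T (f i) := by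
    intro f hf hd s
    induction s using Finset.induction_on with
    | empty => simpa using T_empty
    | insert a s ha ih =>
      rw [Finset.sum_insert ha, Finset.set_biUnion_insert, T_union (hf a) _ _, ih]
      · exact Finset.measurableSet_biUnion _ fun i _ => hf i
      · rw [Set.disjoint_iUnion₂_right]
        intro i hi
        exact hd (fun h => ha (h ▸ hi))
  let s : SignedMeasure α :=
    { measureOf' := T
      empty' := T_empty
      not_measurable' := fun A hA => dif_neg hA
      m_iUnion' := by
        intro f hf hd
        have key : Tendsto (fun s : Finset ℕ => T (⋃ i ∈ s, f i)) atTop (𝓝 (T (⋃ i, f i))) := by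
          simp only [T_meas (MeasurableSet.iUnion hf),
            T_meas (Finset.measurableSet_biUnion _ fun i _ => hf i)]
          refine (Λ.continuous.tendsto _).comp (tendsto_indicatorConstLp_set hp ?_)
          have h1 : HasSum (fun i => μ.real (f i)) (μ.real (⋃ i, f i)) := by
            have := μ.toSignedMeasure.m_iUnion hf hd
            simpa [Measure.toSignedMeasure_apply, hf, MeasurableSet.iUnion hf] using this
          have h2 : ∀ s : Finset ℕ, μ (symmDiff (⋃ i ∈ s, f i) (⋃ i, f i)) =
              ENNReal.ofReal (μ.real (⋃ i, f i) - ∑ i ∈ s, μ.real (f i)) := by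
            intro s
            have hsub : (⋃ i ∈ s, f i) ⊆ ⋃ i, f i := Set.iUnion₂_subset_iUnion _ _
            rw [symmDiff_of_le hsub, ← ofReal_measureReal,
              measureReal_sdiff hsub (Finset.measurableSet_biUnion _ fun i _ => hf i),
              measureReal_biUnion_finset (fun i _ j _ hij => hd hij) fun i _ => hf i]
          simp only [h2]
          have h3 := (tendsto_const_nhds (x := μ.real (⋃ i, f i))).sub h1
          rw [sub_self] at h3
          simpa [Function.comp_def] using (ENNReal.continuous_ofReal.tendsto 0).comp h3
        refine key.congr fun s => T_sum hf hd s }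
  have s_apply : ∀ A, s A = T A := fun A => rfl
  have hs : s ≪ᵥ μ.toENNRealVectorMeasure := by
    refine VectorMeasure.AbsolutelyContinuous.mk fun A hA h0 => ?_
    rw [Measure.toENNRealVectorMeasure_apply_measurable hA] at h0
    rw [s_apply, T_meas hA]
    have : indicatorConstLp p hA (measure_ne_top μ A) (1 : ℝ) = 0 := by
      rw [← norm_eq_zero, norm_indicatorConstLp hp0 hp, measureReal_def, h0]
      have : 0 < p.toReal := ENNReal.toReal_pos hp0 hp
      simp [Real.zero_rpow, this.ne']
    rw [this, map_zero]
  refine ⟨s.rnDeriv μ, s.measurable_rnDeriv μ, s.integrable_rnDeriv μ, fun A hA => ?_⟩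
  rw [← withDensityᵥ_apply (s.integrable_rnDeriv μ) hA,
    (s.absolutelyContinuous_iff_withDensityᵥ_rnDeriv_eq μ).1 hs, s_apply, T_meas hA]

/-- Every continuous functional on `L^p` of a finite measure is given by an `L^{p'}` function. -/
theorem exists_memLp_forall_apply_eq_integral_of_isFiniteMeasure {μ : Measure α}
    [IsFiniteMeasure μ] {p q : ℝ} (hpq : p.HolderConjugate q) [Fact (1 ≤ ENNReal.ofReal p)]
    (Λ : Lp ℝ (ENNReal.ofReal p) μ →L[ℝ] ℝ) :
    ∃ d : α → ℝ, MemLp d (ENNReal.ofReal q) μ ∧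
      ∀ f : Lp ℝ (ENNReal.ofReal p) μ, Λ f = ∫ x, f x * d x ∂μ := by
  classical
  obtain ⟨d, d_meas, d_int, hd⟩ :=
    exists_integrable_forall_apply_indicatorConstLp ENNReal.ofReal_ne_top Λ
  have hp0 : 0 < p := hpq.pos
  have hq0 : 0 < q := hpq.symm.pos
  -- the representation on simple functions
  have simple : ∀ (φ : SimpleFunc α ℝ) (hφ : MemLp φ (ENNReal.ofReal p) μ),
      Λ (hφ.toLp φ) = ∫ x, φ x * d x ∂μ := by
    intro φ
    induction φ using SimpleFunc.induction with
    | @const c s hs =>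
      intro hφ
      have h1 : hφ.toLp _ = c • indicatorConstLp (ENNReal.ofReal p) hs (measure_ne_top μ s) (1 : ℝ) := by
        rw [indicatorConstLp, ← MemLp.toLp_const_smul]
        apply MemLp.toLp_congr
        refine Eventually.of_forall fun x => ?_
        by_cases hx : x ∈ s <;> simp [hx]
      rw [h1, map_smul, hd s hs, smul_eq_mul, ← integral_const_mul, ← integral_indicator hs]
      congr 1
      ext x
      by_cases hx : x ∈ s <;> simp [hx]
    | @add f g hfg hf hg =>
      intro hφ
      have hf' : MemLp f (ENNReal.ofReal p) μ := f.memLp_of_isFiniteMeasure _ μ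
      have hg' : MemLp g (ENNReal.ofReal p) μ := g.memLp_of_isFiniteMeasure _ μ
      have int : ∀ f : SimpleFunc α ℝ, Integrable (fun x => f x * d x) μ := by
        intro f
        obtain ⟨C, hC⟩ := f.exists_forall_norm_le
        exact d_int.bdd_mul f.aestronglyMeasurable (Eventually.of_forall hC)
      have h1 : hφ.toLp _ = hf'.toLp f + hg'.toLp g := by
        rw [← MemLp.toLp_add]
        rfl
      rw [h1, map_add, hf hf', hg hg', ← integral_add (int f) (int g)]
      congr 1
      ext x
      simp [add_mul]
  -- Testing `Λ` with `φ · sign d`, for simple `0 ≤ φ ≤ |d| ^ (q - 1)`, bounds `∫ φ |d|` by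
  -- `‖Λ‖ ^ q`, and the supremum over `φ` is `∫ |d| ^ q`.
  have d_memLp : MemLp d (ENNReal.ofReal q) μ := by
    refine ⟨d_meas.aestronglyMeasurable, ?_⟩
    have hq' : ENNReal.ofReal q ≠ 0 := by simpa using hq0
    rw [eLpNorm_lt_top_iff_lintegral_rpow_enorm_lt_top hq' ENNReal.ofReal_ne_top,
      ENNReal.toReal_ofReal hq0.le]
    have h1 : ∫⁻ x, ‖d x‖ₑ ^ q ∂μ = ∫⁻ x, ‖d x‖ₑ ^ (q - 1) ∂(μ.withDensity fun x => ‖d x‖ₑ) := by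
      rw [lintegral_withDensity_eq_lintegral_mul₀ d_meas.enorm.aemeasurable
        (d_meas.enorm.pow_const _).aemeasurable]
      refine lintegral_congr fun x => ?_
      simp only [Pi.mul_apply]
      conv_rhs => rw [← ENNReal.rpow_one ‖d x‖ₑ, ENNReal.rpow_one (‖d x‖ₑ)]
      nth_rewrite 2 [← ENNReal.rpow_one ‖d x‖ₑ]
      rw [← ENNReal.rpow_add_of_nonneg 1 (q - 1) zero_le_one (by linarith [hpq.symm.lt])]
      congr 1
      ring
    rw [h1, lintegral_eq_nnreal]
    refine lt_of_le_of_lt ?_ (ENNReal.ofReal_lt_top (r := ‖Λ‖ ^ q))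
    refine iSup₂_le fun φ hφ => ?_
    rw [← SimpleFunc.lintegral_eq_lintegral, SimpleFunc.coe_map,
      lintegral_withDensity_eq_lintegral_mul₀ d_meas.enorm.aemeasurable
        (g := ENNReal.ofNNReal ∘ φ) (φ.measurable.coe_nnreal_ennreal).aemeasurable]
    -- testing with the simple function `φ * sign d`
    let σ : SimpleFunc α ℝ := SimpleFunc.piecewise {x | 0 ≤ d x}
      (measurableSet_le measurable_const d_meas) (SimpleFunc.const α 1) (SimpleFunc.const α (-1))
    have hσ : ∀ x, σ x * d x = |d x| := by
      intro x
      by_cases hx : 0 ≤ d x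
      · simp [σ, SimpleFunc.piecewise_apply, hx, abs_of_nonneg hx]
      · simp [σ, SimpleFunc.piecewise_apply, hx, abs_of_neg (not_le.1 hx)]
    have hσ1 : ∀ x, |σ x| = 1 := by
      intro x
      by_cases hx : 0 ≤ d x <;> simp [σ, SimpleFunc.piecewise_apply, hx]
    let ψ : SimpleFunc α ℝ := (φ.map ((↑) : NNReal → ℝ)) * σ
    have hψ : ∀ x, ψ x = φ x * σ x := fun x => rfl
    have hψp : MemLp ψ (ENNReal.ofReal p) μ := ψ.memLp_of_isFiniteMeasure _ μ
    have hI := simple ψ hψp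
    have hint : Integrable (fun x => (φ x : ℝ) * |d x|) μ := by
      obtain ⟨C, hC⟩ := (φ.map ((↑) : NNReal → ℝ)).exists_forall_norm_le
      exact d_int.abs.bdd_mul (φ.map ((↑) : NNReal → ℝ)).aestronglyMeasurable
        (Eventually.of_forall hC)
    have hI2 : (fun x => ψ x * d x) = fun x => (φ x : ℝ) * |d x| := by
      ext x; rw [hψ, mul_assoc, hσ]
    rw [hI2] at hI
    set I := ∫ x, (φ x : ℝ) * |d x| ∂μ with hIdef
    have hI0 : 0 ≤ I := integral_nonneg fun x => by positivity
    have hlin : ∫⁻ x, ((fun x => ‖d x‖ₑ) * (ENNReal.ofNNReal ∘ φ)) x ∂μ = ENNReal.ofReal I := by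
      rw [hIdef, ofReal_integral_eq_lintegral_ofReal hint
        (Eventually.of_forall fun x => by positivity)]
      refine lintegral_congr fun x => ?_
      rw [ENNReal.ofReal_mul (by positivity), mul_comm]
      simp [Real.enorm_eq_ofReal_abs]
    rw [hlin]
    refine ENNReal.ofReal_le_ofReal ?_
    have hnorm : ‖hψp.toLp ψ‖ ≤ I ^ (1 / p) := by
      rw [Lp.norm_toLp, ← ENNReal.toReal_ofReal (show 0 ≤ I ^ (1 / p) by positivity)]
      refine ENNReal.toReal_mono ENNReal.ofReal_ne_top ?_
      rw [eLpNorm_eq_lintegral_rpow_enorm_toReal (by simpa using hp0) ENNReal.ofReal_ne_top,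
        ENNReal.toReal_ofReal hp0.le, ← ENNReal.ofReal_rpow_of_nonneg hI0 (by positivity), ← hlin]
      gcongr with x
      have h2 : ‖ψ x‖ₑ = φ x := by
        rw [Real.enorm_eq_ofReal_abs, hψ, abs_mul, hσ1]
        simp
      rw [h2]
      have h3 : (φ x : ℝ≥0∞) ≤ ‖d x‖ₑ ^ (q - 1) := hφ x
      have h4 : (φ x : ℝ≥0∞) ^ (p - 1) ≤ ‖d x‖ₑ := by
        calc (φ x : ℝ≥0∞) ^ (p - 1) ≤ (‖d x‖ₑ ^ (q - 1)) ^ (p - 1) := by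
              gcongr
              linarith [hpq.lt]
          _ = ‖d x‖ₑ := by
              rw [← ENNReal.rpow_mul, show (q - 1) * (p - 1) = 1 by linear_combination hpq.mul_eq_add,
                ENNReal.rpow_one]
      simp only [Pi.mul_apply, Function.comp_apply]
      calc (φ x : ℝ≥0∞) ^ p = (φ x : ℝ≥0∞) ^ (p - 1) * φ x := by
            nth_rewrite 3 [← ENNReal.rpow_one (φ x : ℝ≥0∞)]
            rw [← ENNReal.rpow_add_of_nonneg _ _ (by linarith [hpq.lt]) zero_le_one]
            congr 1; ring
        _ ≤ _ := by gcongr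
    have hle : I ≤ ‖Λ‖ * I ^ (1 / p) := by
      calc I = Λ (hψp.toLp ψ) := hI.symm
        _ ≤ ‖Λ (hψp.toLp ψ)‖ := le_abs_self _
        _ ≤ ‖Λ‖ * ‖hψp.toLp ψ‖ := Λ.le_opNorm _
        _ ≤ _ := by gcongr
    rcases hI0.eq_or_lt with h0 | h0
    · rw [← h0]; positivity
    have h5 : I ^ (1 / q) ≤ ‖Λ‖ := by
      have h6 : I = I ^ (1 / q) * I ^ (1 / p) := by
        rw [← Real.rpow_add h0, one_div, one_div, add_comm, hpq.inv_add_inv_eq_one, Real.rpow_one]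
      have h7 : 0 < I ^ (1 / p) := by positivity
      nth_rewrite 1 [h6] at hle
      exact le_of_mul_le_mul_right hle h7
    calc I = (I ^ (1 / q)) ^ q := by
          rw [← Real.rpow_mul hI0, one_div, inv_mul_cancel₀ hq0.ne', Real.rpow_one]
      _ ≤ ‖Λ‖ ^ q := by gcongr
  refine ⟨d, d_memLp, ?_⟩
  have hpq' : (ENNReal.ofReal p).HolderConjugate (ENNReal.ofReal q) := hpq.ennrealOfReal
  have : Fact (1 ≤ ENNReal.ofReal q) := ⟨by simpa using hpq.symm.lt.le⟩
  let B : Lp ℝ (ENNReal.ofReal p) μ →L[ℝ] ℝ :=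
    ((ContinuousLinearMap.mul ℝ ℝ).lpPairing μ (ENNReal.ofReal p) (ENNReal.ofReal q)).flip
      (d_memLp.toLp d)
  have hB : ∀ f, B f = ∫ x, f x * d x ∂μ := by
    intro f
    simp only [B, ContinuousLinearMap.flip_apply, ContinuousLinearMap.lpPairing_eq_integral]
    refine integral_congr_ae ?_
    filter_upwards [d_memLp.coeFn_toLp] with x hx
    simp [hx]
  suffices Λ = B by intro f; rw [this, hB]
  refine ContinuousLinearMap.ext fun f => ?_
  refine Lp.induction ENNReal.ofReal_ne_top (motive := fun f => Λ f = B f) ?_ ?_ ?_ f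
  · intro c s hs hμs
    have h1 : (Lp.simpleFunc.indicatorConst (ENNReal.ofReal p) hs hμs.ne c :
        Lp ℝ (ENNReal.ofReal p) μ) =
        c • indicatorConstLp (ENNReal.ofReal p) hs (measure_ne_top μ s) (1 : ℝ) := by
      rw [Lp.simpleFunc.coe_indicatorConst, indicatorConstLp, indicatorConstLp,
        ← MemLp.toLp_const_smul]
      apply MemLp.toLp_congr
      refine Eventually.of_forall fun x => ?_
      by_cases hx : x ∈ s <;> simp [hx]
    rw [h1, map_smul, map_smul, hd s hs, hB, ← integral_indicator hs]
    congr 1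
    refine integral_congr_ae ?_
    filter_upwards [indicatorConstLp_coeFn (p := ENNReal.ofReal p) (hs := hs)
      (hμs := measure_ne_top μ s) (c := (1 : ℝ))] with x hx
    rw [hx]
    by_cases hx : x ∈ s <;> simp [hx]
  · intro f g hf hg _ h1 h2
    rw [map_add, map_add, h1, h2]
  · exact isClosed_eq Λ.continuous B.continuous

theorem eLpNorm_mul_rpow_eq_eLpNorm_withDensity {μ : Measure α} {w : α → NNReal}
    (hw : Measurable w) {r : ℝ} (hr : 0 < r) (f : α → ℝ) :
    eLpNorm (fun x => f x * (w x : ℝ) ^ (1 / r)) (ENNReal.ofReal r) μ =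
      eLpNorm f (ENNReal.ofReal r) (μ.withDensity fun x => w x) := by
  have hr' : ENNReal.ofReal r ≠ 0 := by simpa using hr
  rw [eLpNorm_eq_lintegral_rpow_enorm_toReal hr' ENNReal.ofReal_ne_top,
    eLpNorm_eq_lintegral_rpow_enorm_toReal hr' ENNReal.ofReal_ne_top,
    lintegral_withDensity_eq_lintegral_mul_non_measurable _ hw.coe_nnreal_ennreal
      (Eventually.of_forall fun x => ENNReal.coe_lt_top), ENNReal.toReal_ofReal hr.le]
  congr 1
  refine lintegral_congr fun x => ?_
  rw [Pi.mul_apply, enorm_mul, ENNReal.mul_rpow_of_nonneg _ _ hr.le, mul_comm]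
  congr 1
  rw [Real.enorm_rpow_of_nonneg (by positivity) (by positivity), ← ENNReal.rpow_mul, one_div,
    inv_mul_cancel₀ hr.ne', ENNReal.rpow_one]
  simp

/-- Every continuous functional on `L^p` of a `σ`-finite measure, `1 < p < ∞`, is given by an
`L^{p'}` function. The weight `w` transfers the case of finite measures. -/
theorem exists_memLp_forall_apply_eq_integral {μ : Measure α} [SigmaFinite μ] {p q : ℝ}
    (hpq : p.HolderConjugate q) [Fact (1 ≤ ENNReal.ofReal p)]
    (Λ : Lp ℝ (ENNReal.ofReal p) μ →L[ℝ] ℝ) :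
    ∃ d : α → ℝ, MemLp d (ENNReal.ofReal q) μ ∧
      ∀ f : Lp ℝ (ENNReal.ofReal p) μ, Λ f = ∫ x, f x * d x ∂μ := by
  have hp0 : 0 < p := hpq.pos
  have hq0 : 0 < q := hpq.symm.pos
  obtain ⟨w, w_pos, w_meas, w_lt⟩ := exists_pos_lintegral_lt_of_sigmaFinite μ one_ne_zero
  set ν := μ.withDensity fun x => (w x : ℝ≥0∞) with hν
  have : IsFiniteMeasure ν := isFiniteMeasure_withDensity (w_lt.trans ENNReal.one_lt_top).ne
  have hμν : μ ≪ ν := withDensity_absolutelyContinuous' w_meas.coe_nnreal_ennreal.aemeasurable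
    (Eventually.of_forall fun x => by simpa using (w_pos x).ne')
  have hνμ : ν ≪ μ := withDensity_absolutelyContinuous _ _
  have wr_meas : ∀ r : ℝ, Measurable fun x => (w x : ℝ) ^ r := fun r =>
    w_meas.coe_nnreal_real.pow_const r
  have transfer : ∀ {r : ℝ}, 0 < r → ∀ {f : α → ℝ}, MemLp f (ENNReal.ofReal r) ν →
      MemLp (fun x => f x * (w x : ℝ) ^ (1 / r)) (ENNReal.ofReal r) μ := fun hr f hf =>
    ⟨(hf.1.mono_ac hμν).mul (wr_meas _).aestronglyMeasurable, by
      rw [eLpNorm_mul_rpow_eq_eLpNorm_withDensity w_meas hr]; exact hf.2⟩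
  -- `f ↦ f w ^ (1 / p)` is an isometry of `L^p(ν)` onto `L^p(μ)`.
  let J : Lp ℝ (ENNReal.ofReal p) ν →L[ℝ] Lp ℝ (ENNReal.ofReal p) μ :=
    LinearMap.mkContinuous
      { toFun := fun f => (transfer hp0 (Lp.memLp f)).toLp _
        map_add' := fun f g => by
          rw [← MemLp.toLp_add]
          apply MemLp.toLp_congr
          filter_upwards [hμν.ae_le (Lp.coeFn_add f g)] with x hx
          simp only [hx, Pi.add_apply, add_mul]
        map_smul' := fun c f => by
          rw [← MemLp.toLp_const_smul]
          apply MemLp.toLp_congr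
          filter_upwards [hμν.ae_le (Lp.coeFn_smul c f)] with x hx
          simp only [hx, Pi.smul_apply, smul_eq_mul, RingHom.id_apply, mul_assoc] } 1 (fun f => by
        simp only [LinearMap.coe_mk, AddHom.coe_mk, one_mul]
        rw [Lp.norm_toLp, eLpNorm_mul_rpow_eq_eLpNorm_withDensity w_meas hp0, Lp.norm_def])
  obtain ⟨d, hd, hΛ⟩ := exists_memLp_forall_apply_eq_integral_of_isFiniteMeasure hpq (Λ.comp J)
  refine ⟨_, transfer hq0 hd, fun f => ?_⟩
  have hwr : ∀ x (r : ℝ), 0 < (w x : ℝ) ^ r := fun x r =>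
    Real.rpow_pos_of_pos (by exact_mod_cast w_pos x) r
  have hf : MemLp (fun x => f x * ((w x : ℝ) ^ (1 / p))⁻¹) (ENNReal.ofReal p) ν := by
    refine ⟨((Lp.aestronglyMeasurable f).mono_ac hνμ).mul
      (wr_meas _).inv.aestronglyMeasurable, ?_⟩
    rw [← eLpNorm_mul_rpow_eq_eLpNorm_withDensity w_meas hp0]
    refine lt_of_eq_of_lt (eLpNorm_congr_ae (Eventually.of_forall fun x => ?_)) (Lp.memLp f).2
    simp [(hwr x _).ne']
  have hJ : J (hf.toLp _) = f := by
    refine Lp.ext ?_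
    refine (MemLp.coeFn_toLp (transfer hp0 (Lp.memLp (hf.toLp _)))).trans ?_
    filter_upwards [hμν.ae_le hf.coeFn_toLp] with x hx
    rw [hx]
    simp [(hwr x _).ne']
  have h1 := hΛ (hf.toLp _)
  rw [ContinuousLinearMap.comp_apply, hJ] at h1
  rw [h1]
  refine (integral_withDensity_eq_integral_smul w_meas _).trans ?_
  refine integral_congr_ae ?_
  filter_upwards [hμν.ae_le hf.coeFn_toLp] with x hx
  rw [hx, NNReal.smul_def, smul_eq_mul]
  have hw0 : (0 : ℝ) < w x := by exact_mod_cast w_pos x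
  have h2 : (w x : ℝ) = (w x : ℝ) ^ (1 / p) * (w x : ℝ) ^ (1 / q) := by
    rw [← Real.rpow_add hw0, one_div, one_div, hpq.inv_add_inv_eq_one, Real.rpow_one]
  have h3 := (hwr x (1 / p)).ne'
  nth_rewrite 1 [h2]
  field_simp

end LpDuality
end RiemannianSchrodinger

/-! ### Operators in divergence form -/

namespace RiemannianSchrodinger

section DivergenceForm

open Filter Topology

variable {n : ℕ}

/-- The `i`-th partial derivative of a function on `ℝⁿ`. -/
noncomputable def pd (i : Fin n) (f : EuclideanSpace ℝ (Fin n) → ℝ) (x : EuclideanSpace ℝ (Fin n)) : ℝ :=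
  fderiv ℝ f x (EuclideanSpace.single i 1)

/-- The second order operator `∑ᵢⱼ ∂ᵢ (aᵢⱼ ∂ⱼ v)` in divergence form. -/
noncomputable def divForm (a : EuclideanSpace ℝ (Fin n) → Matrix (Fin n) (Fin n) ℝ)
    (v : EuclideanSpace ℝ (Fin n) → ℝ) (x : EuclideanSpace ℝ (Fin n)) : ℝ :=
  ∑ i, pd i (fun y => ∑ j, a y i j * pd j v y) x

/-- The carré du champ `∑ᵢⱼ aᵢⱼ ∂ᵢf ∂ⱼv` of `divForm a`. -/
noncomputable def gradForm (a : EuclideanSpace ℝ (Fin n) → Matrix (Fin n) (Fin n) ℝ)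
    (f v : EuclideanSpace ℝ (Fin n) → ℝ) (x : EuclideanSpace ℝ (Fin n)) : ℝ :=
  ∑ i, ∑ j, a x i j * (pd i f x * pd j v x)

variable {f g : EuclideanSpace ℝ (Fin n) → ℝ} {x : EuclideanSpace ℝ (Fin n)} {i : Fin n}

theorem contDiff_pd (hf : ContDiff ℝ ∞ f) (i : Fin n) : ContDiff ℝ ∞ (pd i f) :=
  (hf.fderiv_right (m := ∞) (by simp)).clm_apply contDiff_const

theorem _root_.ContDiff.diffAt (hf : ContDiff ℝ ∞ f) (x : EuclideanSpace ℝ (Fin n)) :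
    DifferentiableAt ℝ f x := (hf.differentiable (by simp)) x

theorem pd_mul (hf : DifferentiableAt ℝ f x) (hg : DifferentiableAt ℝ g x) :
    pd i (fun y => f y * g y) x = f x * pd i g x + g x * pd i f x := by
  simp [pd, fderiv_fun_mul hf hg]

theorem pd_add (hf : DifferentiableAt ℝ f x) (hg : DifferentiableAt ℝ g x) :
    pd i (fun y => f y + g y) x = pd i f x + pd i g x := by
  simp [pd, fderiv_fun_add hf hg]

theorem pd_sum {ι : Type*} {s : Finset ι} {F : ι → EuclideanSpace ℝ (Fin n) → ℝ}
    (hF : ∀ k ∈ s, DifferentiableAt ℝ (F k) x) :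
    pd i (fun y => ∑ k ∈ s, F k y) x = ∑ k ∈ s, pd i (F k) x := by
  simp [pd, fderiv_fun_sum hF]

theorem pd_const (c : ℝ) : pd i (fun _ => c) x = 0 := by simp [pd]

theorem pd_const_mul (hf : DifferentiableAt ℝ f x) (c : ℝ) :
    pd i (fun y => c * f y) x = c * pd i f x := by
  rw [pd_mul (differentiableAt_const c) hf, pd_const]; ring

theorem pd_comp {φ : ℝ → ℝ} (hφ : DifferentiableAt ℝ φ (f x)) (hf : DifferentiableAt ℝ f x) :
    pd i (fun y => φ (f y)) x = deriv φ (f x) * pd i f x := by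
  have : fderiv ℝ (fun y => φ (f y)) x = deriv φ (f x) • fderiv ℝ f x :=
    (hφ.hasDerivAt.comp_hasFDerivAt x hf.hasFDerivAt).fderiv
  simp [pd, this]

theorem pd_congr (h : f =ᶠ[𝓝 x] g) : pd i f x = pd i g x := by
  simp [pd, h.fderiv_eq]

theorem support_pd_subset (f : EuclideanSpace ℝ (Fin n) → ℝ) (i : Fin n) :
    tsupport (pd i f) ⊆ tsupport f := by
  refine (closure_mono fun x hx => ?_).trans (tsupport_fderiv_subset ℝ (f := f))
  intro h
  exact hx (by simp [pd, h])

theorem integral_mul_pd (hf : ContDiff ℝ ∞ f) (hg : ContDiff ℝ ∞ g) (hc : HasCompactSupport f)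
    (i : Fin n) : ∫ x, f x * pd i g x = -∫ x, pd i f x * g x := by
  have hc' : HasCompactSupport (pd i f) :=
    hc.of_isClosed_subset (isClosed_tsupport _) (support_pd_subset f i)
  refine integral_mul_fderiv_eq_neg_fderiv_mul_of_integrable ?_ ?_ ?_
    (fun x _ => hf.diffAt x) (fun x _ => hg.diffAt x)
  · exact ((contDiff_pd hf i).continuous.mul hg.continuous).integrable_of_hasCompactSupport
      hc'.mul_right
  · exact (hf.continuous.mul (contDiff_pd hg i).continuous).integrable_of_hasCompactSupport
      hc.mul_right
  · exact (hf.continuous.mul hg.continuous).integrable_of_hasCompactSupport hc.mul_right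

variable {a b : EuclideanSpace ℝ (Fin n) → Matrix (Fin n) (Fin n) ℝ}

theorem contDiff_flux (ha : ∀ i j, ContDiff ℝ ∞ fun x => a x i j) (hf : ContDiff ℝ ∞ f)
    (i : Fin n) : ContDiff ℝ ∞ fun y => ∑ j, a y i j * pd j f y :=
  ContDiff.sum fun j _ => (ha i j).mul (contDiff_pd hf j)

theorem contDiff_divForm (ha : ∀ i j, ContDiff ℝ ∞ fun x => a x i j) (hf : ContDiff ℝ ∞ f) :
    ContDiff ℝ ∞ (divForm a f) :=
  ContDiff.sum fun i _ => contDiff_pd (contDiff_flux ha hf i) i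

theorem divForm_congr (hab : a =ᶠ[𝓝 x] b) (hfg : f =ᶠ[𝓝 x] g) :
    divForm a f x = divForm b g x := by
  refine Finset.sum_congr rfl fun i _ => pd_congr ?_
  filter_upwards [hab, hfg.eventually_nhds] with y hy hy'
  refine Finset.sum_congr rfl fun j _ => ?_
  rw [hy, pd_congr hy']

theorem gradForm_congr (hab : a x = b x) {f' g' : EuclideanSpace ℝ (Fin n) → ℝ}
    (hf : f =ᶠ[𝓝 x] f') (hg : g =ᶠ[𝓝 x] g') :
    gradForm a f g x = gradForm b f' g' x := by
  simp only [gradForm, hab, pd_congr hf, pd_congr hg]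

theorem tsupport_divForm_subset (a : EuclideanSpace ℝ (Fin n) → Matrix (Fin n) (Fin n) ℝ)
    (f : EuclideanSpace ℝ (Fin n) → ℝ) : tsupport (divForm a f) ⊆ tsupport f := by
  refine closure_minimal (fun x hx => ?_) (isClosed_tsupport f)
  by_contra h
  apply hx
  have : f =ᶠ[𝓝 x] fun _ => 0 := notMem_tsupport_iff_eventuallyEq.1 h
  rw [divForm_congr EventuallyEq.rfl this]
  simp [divForm, pd_const]

theorem divForm_eq (ha : ∀ i j, ContDiff ℝ ∞ fun x => a x i j) (hf : ContDiff ℝ ∞ f) :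
    divForm a f x = ∑ i, ∑ j, (a x i j * pd i (pd j f) x + pd j f x * pd i (fun y => a y i j) x) := by
  refine Finset.sum_congr rfl fun i _ => ?_
  rw [pd_sum fun j _ => ((ha i j).mul (contDiff_pd hf j)).diffAt x]
  exact Finset.sum_congr rfl fun j _ => pd_mul ((ha i j).diffAt x) ((contDiff_pd hf j).diffAt x)

theorem gradForm_comm (hs : (a x).IsSymm) : gradForm a f g x = gradForm a g f x := by
  rw [gradForm, Finset.sum_comm]
  refine Finset.sum_congr rfl fun i _ => Finset.sum_congr rfl fun j _ => ?_
  rw [hs.apply i j]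
  ring

/-- The product rule. -/
theorem divForm_mul (ha : ∀ i j, ContDiff ℝ ∞ fun x => a x i j) (hs : (a x).IsSymm)
    (hf : ContDiff ℝ ∞ f) (hg : ContDiff ℝ ∞ g) :
    divForm a (fun y => f y * g y) x =
      f x * divForm a g x + g x * divForm a f x + 2 * gradForm a f g x := by
  have h1 : ∀ j, pd j (fun y => f y * g y) = fun y => f y * pd j g y + g y * pd j f y := fun j =>
    funext fun y => pd_mul (hf.diffAt y) (hg.diffAt y)
  have h2 : ∀ i j, pd i (pd j (fun y => f y * g y)) x = f x * pd i (pd j g) x +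
      pd j g x * pd i f x + (g x * pd i (pd j f) x + pd j f x * pd i g x) := by
    intro i j
    rw [h1, pd_add ((hf.mul (contDiff_pd hg j)).diffAt x) ((hg.mul (contDiff_pd hf j)).diffAt x),
      pd_mul (hf.diffAt x) ((contDiff_pd hg j).diffAt x), pd_mul (hg.diffAt x) ((contDiff_pd hf j).diffAt x)]
  have h3 : 2 * gradForm a f g x = gradForm a f g x + gradForm a g f x := by
    rw [gradForm_comm (f := g) hs]; ring
  rw [h3, divForm_eq ha (hf.mul hg), divForm_eq ha hf, divForm_eq ha hg]
  simp only [h2, gradForm, Finset.mul_sum, ← Finset.sum_add_distrib]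
  refine Finset.sum_congr rfl fun i _ => Finset.sum_congr rfl fun j _ => ?_
  rw [congrFun (h1 j) x]
  ring

/-- The chain rule. -/
theorem divForm_comp (ha : ∀ i j, ContDiff ℝ ∞ fun x => a x i j) {φ : ℝ → ℝ}
    (hφ : ContDiff ℝ ∞ φ) (hf : ContDiff ℝ ∞ f) :
    divForm a (fun y => φ (f y)) x =
      deriv φ (f x) * divForm a f x + deriv (deriv φ) (f x) * gradForm a f f x := by
  have hφ' : ContDiff ℝ ∞ (deriv φ) := (contDiff_infty_iff_deriv.1 hφ).2
  have h1 : ∀ j, pd j (fun y => φ (f y)) = fun y => deriv φ (f y) * pd j f y := fun j =>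
    funext fun y => pd_comp (hφ.differentiable (by simp) _) (hf.diffAt y)
  have h2 : ∀ i j, pd i (pd j (fun y => φ (f y))) x = deriv φ (f x) * pd i (pd j f) x +
      pd j f x * (deriv (deriv φ) (f x) * pd i f x) := by
    intro i j
    rw [h1, pd_mul (f := fun y => deriv φ (f y)) ((hφ'.comp hf).diffAt x) ((contDiff_pd hf j).diffAt x)]
    congr 2
    exact pd_comp (hφ'.differentiable (by simp) _) (hf.diffAt x)
  rw [divForm_eq (f := fun y => φ (f y)) ha (hφ.comp hf), divForm_eq ha hf]
  simp only [h2, gradForm, Finset.mul_sum, ← Finset.sum_add_distrib]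
  refine Finset.sum_congr rfl fun i _ => Finset.sum_congr rfl fun j _ => ?_
  rw [congrFun (h1 j) x]
  ring

theorem divForm_const_mul (ha : ∀ i j, ContDiff ℝ ∞ fun x => a x i j) (c : ℝ)
    (hf : ContDiff ℝ ∞ f) : divForm a (fun y => c * f y) x = c * divForm a f x := by
  have h1 : ∀ j, pd j (fun y => c * f y) = fun y => c * pd j f y := fun j =>
    funext fun y => pd_const_mul (hf.diffAt y) c
  have h2 : ∀ i j, pd i (pd j (fun y => c * f y)) x = c * pd i (pd j f) x := fun i j => by
    rw [h1, pd_const_mul ((contDiff_pd hf j).diffAt x)]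
  rw [divForm_eq ha (contDiff_const.mul hf), divForm_eq ha hf]
  simp only [h2, Finset.mul_sum]
  refine Finset.sum_congr rfl fun i _ => Finset.sum_congr rfl fun j _ => ?_
  rw [congrFun (h1 j) x]
  ring

/-- Green's first identity. -/
theorem integral_mul_divForm (ha : ∀ i j, ContDiff ℝ ∞ fun x => a x i j)
    (hf : ContDiff ℝ ∞ f) (hg : ContDiff ℝ ∞ g) (hc : HasCompactSupport f) :
    ∫ x, f x * divForm a g x = -∫ x, gradForm a f g x := by
  have hpc : ∀ i, HasCompactSupport (pd i f) := fun i =>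
    hc.of_isClosed_subset (isClosed_tsupport _) (support_pd_subset f i)
  have h1 : ∀ i, Integrable fun x => f x * pd i (fun y => ∑ j, a y i j * pd j g y) x := fun i =>
    (hf.continuous.mul (contDiff_pd (contDiff_flux ha hg i) i).continuous).integrable_of_hasCompactSupport
      hc.mul_right
  have h2 : ∀ i, Integrable fun x => pd i f x * ∑ j, a x i j * pd j g x := fun i =>
    ((contDiff_pd hf i).continuous.mul (contDiff_flux ha hg i).continuous).integrable_of_hasCompactSupport
      (hpc i).mul_right
  calc ∫ x, f x * divForm a g x
      = ∫ x, ∑ i, f x * pd i (fun y => ∑ j, a y i j * pd j g y) x := by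
        simp only [divForm, Finset.mul_sum]
    _ = ∑ i, -∫ x, pd i f x * ∑ j, a x i j * pd j g x := by
        rw [integral_finsetSum _ fun i _ => h1 i]
        exact Finset.sum_congr rfl fun i _ => integral_mul_pd hf (contDiff_flux ha hg i) hc i
    _ = -∫ x, gradForm a f g x := by
        rw [Finset.sum_neg_distrib, ← integral_finsetSum _ fun i _ => h2 i]
        congr 2
        ext x
        simp only [gradForm, Finset.mul_sum]
        exact Finset.sum_congr rfl fun i _ => Finset.sum_congr rfl fun j _ => by ring

/-- Green's second identity. -/
theorem integral_mul_divForm_comm (ha : ∀ i j, ContDiff ℝ ∞ fun x => a x i j)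
    (hs : ∀ x, (a x).IsSymm) (hf : ContDiff ℝ ∞ f) (hg : ContDiff ℝ ∞ g)
    (hc : HasCompactSupport f) :
    ∫ x, f x * divForm a g x = ∫ x, g x * divForm a f x := by
  have hpc : ∀ i, HasCompactSupport fun y => ∑ j, a y i j * pd j f y := fun i => by
    refine hc.of_isClosed_subset (isClosed_tsupport _) (closure_minimal (fun x hx => ?_)
      (isClosed_tsupport f))
    by_contra h
    refine hx (Finset.sum_eq_zero fun j _ => ?_)
    rw [pd_congr (notMem_tsupport_iff_eventuallyEq.1 h)]
    simp [pd]
  have h1 : ∀ i, Integrable fun x => g x * pd i (fun y => ∑ j, a y i j * pd j f y) x := fun i =>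
    (hg.continuous.mul
      (contDiff_pd (contDiff_flux ha hf i) i).continuous).integrable_of_hasCompactSupport
      (HasCompactSupport.mul_left
        ((hpc i).of_isClosed_subset (isClosed_tsupport _) (support_pd_subset _ i)))
  have h2 : ∀ i, Integrable fun x => (∑ j, a x i j * pd j f x) * pd i g x := fun i =>
    ((contDiff_flux ha hf i).continuous.mul
      (contDiff_pd hg i).continuous).integrable_of_hasCompactSupport (hpc i).mul_right
  symm
  calc ∫ x, g x * divForm a f x
      = ∫ x, ∑ i, g x * pd i (fun y => ∑ j, a y i j * pd j f y) x := by
        simp only [divForm, Finset.mul_sum]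
    _ = ∑ i, -∫ x, (∑ j, a x i j * pd j f x) * pd i g x := by
        rw [integral_finsetSum _ fun i _ => h1 i]
        refine Finset.sum_congr rfl fun i _ => ?_
        rw [integral_mul_pd (contDiff_flux ha hf i) hg (hpc i) i, neg_neg]
        simp only [mul_comm]
    _ = -∫ x, gradForm a g f x := by
        rw [Finset.sum_neg_distrib, ← integral_finsetSum _ fun i _ => h2 i]
        congr 2
        ext x
        simp only [gradForm, Finset.sum_mul]
        exact Finset.sum_congr rfl fun i _ => Finset.sum_congr rfl fun j _ => by ring
    _ = ∫ x, f x * divForm a g x := by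
        rw [integral_mul_divForm ha hf hg hc]
        simp only [gradForm_comm (f := g) (g := f) (hs _)]

end DivergenceForm
end RiemannianSchrodinger

/-! ### The approximate squared distance -/

namespace RiemannianSchrodinger

section KernelAlgebra

open Filter Topology Asymptotics Matrix

variable {n : ℕ}

/-- `½ ⟨(G(x) + G(y)) (x - y), x - y⟩`, a symmetric approximation of the squared distance of the
metric `G`. -/
noncomputable def quad (G : EuclideanSpace ℝ (Fin n) → Matrix (Fin n) (Fin n) ℝ)
    (x y : EuclideanSpace ℝ (Fin n)) : ℝ :=
  (1 / 2) * ∑ k, ∑ l, (G x k l + G y k l) * ((x k - y k) * (x l - y l))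

/-- The covector `∑ₖₗ ∂ᵢGₖₗ(x) zₖ zₗ`. -/
noncomputable def quadGrad (G : EuclideanSpace ℝ (Fin n) → Matrix (Fin n) (Fin n) ℝ)
    (x : EuclideanSpace ℝ (Fin n)) (z : Fin n → ℝ) (i : Fin n) : ℝ :=
  ∑ k, ∑ l, pd i (fun y => G y k l) x * (z k * z l)

/-- The form `∑ₖₗ ∂ᵢ∂ⱼGₖₗ(x) zₖ zₗ`. -/
noncomputable def quadHess (G : EuclideanSpace ℝ (Fin n) → Matrix (Fin n) (Fin n) ℝ)
    (x : EuclideanSpace ℝ (Fin n)) (z : Fin n → ℝ) (i j : Fin n) : ℝ :=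
  ∑ k, ∑ l, pd i (pd j fun y => G y k l) x * (z k * z l)

/-- The divergence `bⱼ = ∑ᵢ ∂ᵢaᵢⱼ`. -/
noncomputable def rowDiv (a : EuclideanSpace ℝ (Fin n) → Matrix (Fin n) (Fin n) ℝ)
    (x : EuclideanSpace ℝ (Fin n)) (j : Fin n) : ℝ :=
  ∑ i, pd i (fun y => a y i j) x

/-- The covector `tr (a ∂ᵢG)`, which is the logarithmic gradient of `det G` if `a = G⁻¹`. -/
noncomputable def traceGrad (a G : EuclideanSpace ℝ (Fin n) → Matrix (Fin n) (Fin n) ℝ)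
    (x : EuclideanSpace ℝ (Fin n)) (i : Fin n) : ℝ :=
  ∑ k, ∑ l, a x k l * pd i (fun y => G y l k) x

theorem quad_comm (G : EuclideanSpace ℝ (Fin n) → Matrix (Fin n) (Fin n) ℝ)
    (x y : EuclideanSpace ℝ (Fin n)) : quad G x y = quad G y x := by
  simp only [quad]
  congr 1
  exact Finset.sum_congr rfl fun k _ => Finset.sum_congr rfl fun l _ => by ring

theorem contDiff_coord (k : Fin n) : ContDiff ℝ ∞ fun x : EuclideanSpace ℝ (Fin n) => x k :=
  (EuclideanSpace.proj (𝕜 := ℝ) k).contDiff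

theorem pd_coord_sub (i k : Fin n) (y x : EuclideanSpace ℝ (Fin n)) :
    pd i (fun x => x k - y k) x = if k = i then 1 else 0 := by
  have h : (fun x : EuclideanSpace ℝ (Fin n) => x k - y k) =
      fun x => EuclideanSpace.proj (𝕜 := ℝ) k x - y k := rfl
  rw [pd, h, fderiv_sub_const, ContinuousLinearMap.fderiv]
  simp

variable {G a : EuclideanSpace ℝ (Fin n) → Matrix (Fin n) (Fin n) ℝ}

theorem contDiff_quad (hG : ∀ i j, ContDiff ℝ ∞ fun x => G x i j) :
    ContDiff ℝ ∞ fun w : EuclideanSpace ℝ (Fin n) × EuclideanSpace ℝ (Fin n) =>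
      quad G w.1 w.2 := by
  have h : ∀ k, ContDiff ℝ ∞ fun w : EuclideanSpace ℝ (Fin n) × EuclideanSpace ℝ (Fin n) =>
      w.1 k - w.2 k := fun k =>
    ((contDiff_coord k).comp contDiff_fst).sub ((contDiff_coord k).comp contDiff_snd)
  exact contDiff_const.mul (ContDiff.sum fun k _ => ContDiff.sum fun l _ =>
    (((hG k l).comp contDiff_fst).add ((hG k l).comp contDiff_snd)).mul ((h k).mul (h l)))

theorem contDiff_quad_left (hG : ∀ i j, ContDiff ℝ ∞ fun x => G x i j)
    (y : EuclideanSpace ℝ (Fin n)) : ContDiff ℝ ∞ fun x => quad G x y :=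
  (contDiff_quad hG).comp (contDiff_id.prodMk contDiff_const)

theorem pd_quad (hG : ∀ i j, ContDiff ℝ ∞ fun x => G x i j) (hGs : ∀ x, (G x).IsSymm)
    (i : Fin n) (x y : EuclideanSpace ℝ (Fin n)) :
    pd i (fun x => quad G x y) x =
      ((G x + G y) *ᵥ fun k => x k - y k) i + (1 / 2) * quadGrad G x (fun k => x k - y k) i := by
  have hz : ∀ k, ContDiff ℝ ∞ fun x : EuclideanSpace ℝ (Fin n) => x k - y k := fun k =>
    (contDiff_coord k).sub contDiff_const
  have hF : ∀ k l, ContDiff ℝ ∞ fun x => G x k l + G y k l := fun k l =>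
    (hG k l).add contDiff_const
  have hpF : ∀ k l, pd i (fun x => G x k l + G y k l) x = pd i (fun x => G x k l) x := fun k l => by
    rw [pd_add ((hG k l).diffAt x) (contDiff_const.diffAt x), pd_const, add_zero]
  have hw : ∀ k l, pd i (fun x => (x k - y k) * (x l - y l)) x =
      (x k - y k) * (if l = i then 1 else 0) + (x l - y l) * (if k = i then 1 else 0) := by
    intro k l
    rw [pd_mul ((hz k).diffAt x) ((hz l).diffAt x), pd_coord_sub, pd_coord_sub]
  have hterm : ∀ k l, pd i (fun x => (G x k l + G y k l) * ((x k - y k) * (x l - y l))) x =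
      (G x k l + G y k l) * ((x k - y k) * (if l = i then 1 else 0) +
        (x l - y l) * (if k = i then 1 else 0)) +
      (x k - y k) * (x l - y l) * pd i (fun x => G x k l) x := by
    intro k l
    rw [pd_mul ((hF k l).diffAt x) (((hz k).mul (hz l)).diffAt x), hw, hpF]
  have h1 : pd i (fun x => quad G x y) x = (1 / 2) * ∑ k, ∑ l,
      ((G x k l + G y k l) * ((x k - y k) * (if l = i then 1 else 0) +
        (x l - y l) * (if k = i then 1 else 0)) +
      (x k - y k) * (x l - y l) * pd i (fun x => G x k l) x) := by
    simp only [quad]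
    rw [pd_const_mul ((ContDiff.sum fun k _ => ContDiff.sum fun l _ =>
      (hF k l).mul ((hz k).mul (hz l))).diffAt x), pd_sum fun k _ => (ContDiff.sum fun l _ =>
      (hF k l).mul ((hz k).mul (hz l))).diffAt x]
    congr 1
    refine Finset.sum_congr rfl fun k _ => ?_
    rw [pd_sum fun l _ => ((hF k l).mul ((hz k).mul (hz l))).diffAt x]
    exact Finset.sum_congr rfl fun l _ => hterm k l
  rw [h1]
  simp only [mul_add, Finset.sum_add_distrib, quadGrad, mulVec, dotProduct, Matrix.add_apply]
  have e1 : ∑ k, ∑ l, (G x k l + G y k l) * ((x k - y k) * (if l = i then 1 else 0)) =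
      ∑ k, (G x i k + G y i k) * (x k - y k) := by
    refine Finset.sum_congr rfl fun k _ => ?_
    simp [(hGs x).apply i k, (hGs y).apply i k]
  have e2 : ∑ k, ∑ l, (G x k l + G y k l) * ((x l - y l) * (if k = i then 1 else 0)) =
      ∑ k, (G x i k + G y i k) * (x k - y k) := by
    rw [Finset.sum_comm]
    refine Finset.sum_congr rfl fun k _ => ?_
    simp
  rw [e1, e2]
  have e3 : ∑ k, ∑ l, (x k - y k) * (x l - y l) * pd i (fun x => G x k l) x =
      ∑ k, ∑ l, pd i (fun x => G x k l) x * ((x k - y k) * (x l - y l)) :=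
    Finset.sum_congr rfl fun k _ => Finset.sum_congr rfl fun l _ => by ring
  rw [e3]
  ring

/-- The Hessian of `quad` in its first variable. The terms linear in `x - y` are kept explicit, because
they cancel against the drift of `divForm` only after contraction with `a`. -/
theorem pd_pd_quad (hG : ∀ i j, ContDiff ℝ ∞ fun x => G x i j) (hGs : ∀ x, (G x).IsSymm)
    (i j : Fin n) (x y : EuclideanSpace ℝ (Fin n)) :
    pd i (pd j fun x => quad G x y) x =
      (G x + G y) j i + ∑ l, pd i (fun x => G x j l) x * (x l - y l) +
      ∑ l, pd j (fun x => G x i l) x * (x l - y l) +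
      (1 / 2) * quadHess G x (fun k => x k - y k) i j := by
  have hz : ∀ k, ContDiff ℝ ∞ fun x : EuclideanSpace ℝ (Fin n) => x k - y k := fun k =>
    (contDiff_coord k).sub contDiff_const
  have hF : ∀ k l, ContDiff ℝ ∞ fun x => G x k l + G y k l := fun k l =>
    (hG k l).add contDiff_const
  have hpF : ∀ k l, pd i (fun x => G x k l + G y k l) x = pd i (fun x => G x k l) x := fun k l => by
    rw [pd_add ((hG k l).diffAt x) (contDiff_const.diffAt x), pd_const, add_zero]
  have hw : ∀ k l, pd i (fun x => (x k - y k) * (x l - y l)) x =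
      (x k - y k) * (if l = i then 1 else 0) + (x l - y l) * (if k = i then 1 else 0) := by
    intro k l
    rw [pd_mul ((hz k).diffAt x) ((hz l).diffAt x), pd_coord_sub, pd_coord_sub]
  have hDG : ∀ k l, ContDiff ℝ ∞ (pd j fun x => G x k l) := fun k l => contDiff_pd (hG k l) j
  have hfun : (pd j fun x => quad G x y) = fun x => (∑ l, (G x j l + G y j l) * (x l - y l)) +
      (1 / 2) * ∑ k, ∑ l, pd j (fun x => G x k l) x * ((x k - y k) * (x l - y l)) := by
    ext x
    rw [pd_quad hG hGs]
    rfl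
  have s1 : ContDiff ℝ ∞ fun x => ∑ l, (G x j l + G y j l) * (x l - y l) :=
    ContDiff.sum fun l _ => (hF j l).mul (hz l)
  have s2 : ∀ k, ContDiff ℝ ∞ fun x =>
      ∑ l, pd j (fun x => G x k l) x * ((x k - y k) * (x l - y l)) := fun k =>
    ContDiff.sum fun l _ => (hDG k l).mul ((hz k).mul (hz l))
  have s3 : ContDiff ℝ ∞ fun x =>
      ∑ k, ∑ l, pd j (fun x => G x k l) x * ((x k - y k) * (x l - y l)) :=
    ContDiff.sum fun k _ => s2 k
  have t1 : pd i (fun x => ∑ l, (G x j l + G y j l) * (x l - y l)) x =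
      (G x + G y) j i + ∑ l, pd i (fun x => G x j l) x * (x l - y l) := by
    rw [pd_sum fun l _ => ((hF j l).mul (hz l)).diffAt x]
    have : ∀ l, pd i (fun x => (G x j l + G y j l) * (x l - y l)) x =
        (G x j l + G y j l) * (if l = i then 1 else 0) +
          pd i (fun x => G x j l) x * (x l - y l) := fun l => by
      rw [pd_mul ((hF j l).diffAt x) ((hz l).diffAt x), pd_coord_sub, hpF]; ring
    simp only [this, Finset.sum_add_distrib]
    simp
  have t2 : pd i (fun x => ∑ k, ∑ l, pd j (fun x => G x k l) x * ((x k - y k) * (x l - y l))) x =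
      2 * ∑ l, pd j (fun x => G x i l) x * (x l - y l) +
        quadHess G x (fun k => x k - y k) i j := by
    rw [pd_sum fun k _ => (s2 k).diffAt x]
    have : ∀ k l, pd i (fun x => pd j (fun x => G x k l) x * ((x k - y k) * (x l - y l))) x =
        pd j (fun x => G x k l) x * ((x k - y k) * (if l = i then 1 else 0)) +
        pd j (fun x => G x k l) x * ((x l - y l) * (if k = i then 1 else 0)) +
          pd i (pd j fun x => G x k l) x * ((x k - y k) * (x l - y l)) := fun k l => by
      rw [pd_mul ((hDG k l).diffAt x) (((hz k).mul (hz l)).diffAt x), hw]; ring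
    have h2 : ∀ k, pd i (fun x => ∑ l, pd j (fun x => G x k l) x * ((x k - y k) * (x l - y l))) x =
        ∑ l, (pd j (fun x => G x k l) x * ((x k - y k) * (if l = i then 1 else 0)) +
        pd j (fun x => G x k l) x * ((x l - y l) * (if k = i then 1 else 0)) +
          pd i (pd j fun x => G x k l) x * ((x k - y k) * (x l - y l))) := fun k => by
      rw [pd_sum fun l _ => ((hDG k l).mul ((hz k).mul (hz l))).diffAt x]
      exact Finset.sum_congr rfl fun l _ => this k l
    simp only [h2, Finset.sum_add_distrib, quadHess]
    have e1 : ∑ k, ∑ l, pd j (fun x => G x k l) x * ((x k - y k) * (if l = i then 1 else 0)) =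
        ∑ l, pd j (fun x => G x i l) x * (x l - y l) := by
      refine Finset.sum_congr rfl fun k _ => ?_
      have : (fun x => G x i k) = fun x => G x k i := funext fun x => (hGs x).apply k i
      simp [this]
    have e2 : ∑ k, ∑ l, pd j (fun x => G x k l) x * ((x l - y l) * (if k = i then 1 else 0)) =
        ∑ l, pd j (fun x => G x i l) x * (x l - y l) := by
      rw [Finset.sum_comm]
      refine Finset.sum_congr rfl fun k _ => ?_
      simp
    rw [e1, e2]
    ring
  rw [hfun, pd_add (s1.diffAt x) ((contDiff_const.mul s3).diffAt x), t1,
    pd_const_mul (s3.diffAt x), t2]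
  ring

end KernelAlgebra
end RiemannianSchrodinger

/-! ### Algebra of the eikonal and transport defects -/

namespace RiemannianSchrodinger

section KernelAlgebra

open Filter Topology Asymptotics Matrix

variable {n : ℕ}

variable {G a : EuclideanSpace ℝ (Fin n) → Matrix (Fin n) (Fin n) ℝ}

theorem gradForm_eq_dotProduct {f g : EuclideanSpace ℝ (Fin n) → ℝ}
    {x : EuclideanSpace ℝ (Fin n)} {u v : Fin n → ℝ} (hu : ∀ i, pd i f x = u i)
    (hv : ∀ i, pd i g x = v i) : gradForm a f g x = u ⬝ᵥ (a x *ᵥ v) := by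
  simp only [gradForm, hu, hv, dotProduct, mulVec, Finset.mul_sum]
  exact Finset.sum_congr rfl fun i _ => Finset.sum_congr rfl fun j _ => by ring

theorem dotProduct_mulVec_comm {X : Matrix (Fin n) (Fin n) ℝ} (hX : X.IsSymm) (u v : Fin n → ℝ) :
    u ⬝ᵥ (X *ᵥ v) = v ⬝ᵥ (X *ᵥ u) := by
  rw [dotProduct_mulVec, ← mulVec_transpose, hX.eq, dotProduct_comm]

/-- The difference of the squared gradients of `quad G` in its two variables. Here `A`, `B` are the
values of `G` at the two points, `X`, `Y` their inverses, `z` is the difference of the points, and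
`q`, `r` are the values of `quadGrad`. As `A - B`, `X - Y` are of first order in `z`, `q`, `r` of
second and `q - r` of third order, every summand on the right is of fifth order, except for the
first one, where `q + r - 2 (A - B) z` contains the error of the trapezoidal rule for `G`. -/
theorem eikonal_defect_eq {X Y A B : Matrix (Fin n) (Fin n) ℝ} (hX : X.IsSymm) (hY : Y.IsSymm)
    (hXA : X * A = 1) (hYB : Y * B = 1) (z q r : Fin n → ℝ) :
    ((A + B) *ᵥ z + (1 / 2 : ℝ) • q) ⬝ᵥ (X *ᵥ ((A + B) *ᵥ z + (1 / 2 : ℝ) • q)) -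
      (-((A + B) *ᵥ z) + (1 / 2 : ℝ) • r) ⬝ᵥ (Y *ᵥ (-((A + B) *ᵥ z) + (1 / 2 : ℝ) • r)) =
    2 * (z ⬝ᵥ (q + r - (2 : ℝ) • ((A - B) *ᵥ z))) +
      ((A - B) *ᵥ z) ⬝ᵥ ((X - Y) *ᵥ ((A - B) *ᵥ z)) -
      (q - r) ⬝ᵥ (X *ᵥ ((A - B) *ᵥ z)) - r ⬝ᵥ ((X - Y) *ᵥ ((A - B) *ᵥ z)) +
      (1 / 4) * ((q - r) ⬝ᵥ (X *ᵥ q) + (q - r) ⬝ᵥ (X *ᵥ r) + r ⬝ᵥ ((X - Y) *ᵥ r)) := by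
  set d := (A - B) *ᵥ z with hd
  set u := (A + B) *ᵥ z with hu
  have hXu : X *ᵥ u = (2 : ℝ) • z - X *ᵥ d := by
    rw [hu, hd, mulVec_mulVec, mulVec_mulVec, Matrix.mul_add, Matrix.mul_sub, hXA, add_mulVec,
      sub_mulVec, one_mulVec]
    module
  have hYu : Y *ᵥ u = (2 : ℝ) • z + Y *ᵥ d := by
    rw [hu, hd, mulVec_mulVec, mulVec_mulVec, Matrix.mul_add, Matrix.mul_sub, hYB, add_mulVec,
      sub_mulVec, one_mulVec]
    module
  simp only [mulVec_add, mulVec_neg, mulVec_smul, sub_mulVec, hXu, hYu, add_dotProduct,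
    dotProduct_add, sub_dotProduct, dotProduct_sub, neg_dotProduct, dotProduct_neg,
    smul_dotProduct, dotProduct_smul, smul_eq_mul]
  have e1 : u ⬝ᵥ (X *ᵥ d) = 2 * (d ⬝ᵥ z) - d ⬝ᵥ (X *ᵥ d) := by
    rw [dotProduct_mulVec_comm hX, hXu]; simp
  have e2 : u ⬝ᵥ (Y *ᵥ d) = 2 * (d ⬝ᵥ z) + d ⬝ᵥ (Y *ᵥ d) := by
    rw [dotProduct_mulVec_comm hY, hYu]; simp
  have e3 : u ⬝ᵥ (X *ᵥ q) = 2 * (q ⬝ᵥ z) - q ⬝ᵥ (X *ᵥ d) := by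
    rw [dotProduct_mulVec_comm hX, hXu]; simp
  have e4 : u ⬝ᵥ (Y *ᵥ r) = 2 * (r ⬝ᵥ z) + r ⬝ᵥ (Y *ᵥ d) := by
    rw [dotProduct_mulVec_comm hY, hYu]; simp
  have e5 : z ⬝ᵥ d = d ⬝ᵥ z := dotProduct_comm _ _
  have e6 : z ⬝ᵥ q = q ⬝ᵥ z := dotProduct_comm _ _
  have e7 : z ⬝ᵥ r = r ⬝ᵥ z := dotProduct_comm _ _
  have e8 : r ⬝ᵥ (X *ᵥ q) = q ⬝ᵥ (X *ᵥ r) := dotProduct_mulVec_comm hX _ _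
  rw [e1, e2, e3, e4, e5, e6, e7, e8]
  ring

/-- The derivative of the identity `a G = 1`. -/
theorem rowDiv_dotProduct_mulVec (hG : ∀ i j, ContDiff ℝ ∞ fun x => G x i j)
    (ha : ∀ i j, ContDiff ℝ ∞ fun x => a x i j) (hinv : ∀ x, a x * G x = 1)
    (x : EuclideanSpace ℝ (Fin n)) (z : Fin n → ℝ) :
    rowDiv a x ⬝ᵥ (G x *ᵥ z) =
      -∑ i, ∑ j, a x i j * ∑ l, pd i (fun y => G y j l) x * z l := by
  have h : ∀ i l, ∑ j, (a x i j * pd i (fun y => G y j l) x + G x j l * pd i (fun y => a y i j) x)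
      = 0 := by
    intro i l
    have h1 : (fun y => ∑ j, a y i j * G y j l) = fun _ => (1 : Matrix (Fin n) (Fin n) ℝ) i l := by
      ext y; rw [← hinv y, Matrix.mul_apply]
    have h2 : pd i (fun y => ∑ j, a y i j * G y j l) x = 0 := by rw [h1, pd_const]
    rw [pd_sum fun j _ => ((ha i j).mul (hG j l)).diffAt x] at h2
    rw [← h2]
    exact Finset.sum_congr rfl fun j _ => (pd_mul ((ha i j).diffAt x) ((hG j l).diffAt x)).symm
  have h3 : rowDiv a x ⬝ᵥ (G x *ᵥ z) +
      ∑ i, ∑ j, a x i j * ∑ l, pd i (fun y => G y j l) x * z l =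
      ∑ i, ∑ l, z l * ∑ j,
        (a x i j * pd i (fun y => G y j l) x + G x j l * pd i (fun y => a y i j) x) := by
    simp only [rowDiv, dotProduct, mulVec, Finset.mul_sum, Finset.sum_mul, mul_add,
      Finset.sum_add_distrib]
    rw [add_comm]
    congr 1
    · refine Finset.sum_congr rfl fun i _ => ?_
      rw [Finset.sum_comm]
      exact Finset.sum_congr rfl fun j _ => Finset.sum_congr rfl fun l _ => by ring
    · calc ∑ j, ∑ l, ∑ i, pd i (fun y => a y i j) x * (G x j l * z l)
          = ∑ j, ∑ i, ∑ l, pd i (fun y => a y i j) x * (G x j l * z l) :=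
            Finset.sum_congr rfl fun j _ => Finset.sum_comm
        _ = ∑ i, ∑ j, ∑ l, pd i (fun y => a y i j) x * (G x j l * z l) := Finset.sum_comm
        _ = _ := Finset.sum_congr rfl fun i _ => by
            rw [Finset.sum_comm]
            exact Finset.sum_congr rfl fun j _ => Finset.sum_congr rfl fun l _ => by ring
  simp only [h, mul_zero, Finset.sum_const_zero] at h3
  linarith

/-- The operator applied to `quad`. The terms linear in `x - y` cancel by the derivative of `a G = 1`. -/
theorem divForm_quad (hG : ∀ i j, ContDiff ℝ ∞ fun x => G x i j) (hGs : ∀ x, (G x).IsSymm)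
    (ha : ∀ i j, ContDiff ℝ ∞ fun x => a x i j) (has : ∀ x, (a x).IsSymm)
    (hinv : ∀ x, a x * G x = 1) (x y : EuclideanSpace ℝ (Fin n)) :
    divForm a (fun x => quad G x y) x =
      (a x * (G x + G y)).trace +
      (1 / 2) * ∑ i, ∑ j, a x i j * quadHess G x (fun k => x k - y k) i j -
      rowDiv a x ⬝ᵥ ((G x - G y) *ᵥ fun k => x k - y k) +
      (1 / 2) * (rowDiv a x ⬝ᵥ quadGrad G x fun k => x k - y k) := by
  set z : Fin n → ℝ := fun k => x k - y k with hz
  have hr := rowDiv_dotProduct_mulVec hG ha hinv x z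
  set r := ∑ i, ∑ j, a x i j * ∑ l, pd i (fun y => G y j l) x * z l with hrdef
  have h1 : divForm a (fun x => quad G x y) x =
      (∑ i, ∑ j, a x i j * (G x + G y) j i) + r +
      (∑ i, ∑ j, a x i j * ∑ l, pd j (fun y => G y i l) x * z l) +
      (1 / 2) * (∑ i, ∑ j, a x i j * quadHess G x z i j) +
      rowDiv a x ⬝ᵥ ((G x + G y) *ᵥ z + (1 / 2 : ℝ) • quadGrad G x z) := by
    have e : rowDiv a x ⬝ᵥ ((G x + G y) *ᵥ z + (1 / 2 : ℝ) • quadGrad G x z) =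
        ∑ i, ∑ j, pd j (fun x => quad G x y) x * pd i (fun y => a y i j) x := by
      rw [Finset.sum_comm]
      simp only [dotProduct, rowDiv, Finset.sum_mul, pd_quad hG hGs, Pi.add_apply, Pi.smul_apply,
        smul_eq_mul]
      exact Finset.sum_congr rfl fun j _ => Finset.sum_congr rfl fun i _ => by ring
    rw [e, divForm_eq ha (contDiff_quad_left hG y)]
    simp only [pd_pd_quad hG hGs, hrdef, Finset.mul_sum (a := (1 / 2 : ℝ)),
      ← Finset.sum_add_distrib]
    refine Finset.sum_congr rfl fun i _ => Finset.sum_congr rfl fun j _ => ?_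
    ring
  have h2 : (∑ i, ∑ j, a x i j * ∑ l, pd j (fun y => G y i l) x * z l) = r := by
    rw [Finset.sum_comm]
    exact Finset.sum_congr rfl fun i _ => Finset.sum_congr rfl fun j _ => by rw [(has x).apply i j]
  have h3 : ∑ i, ∑ j, a x i j * (G x + G y) j i = (a x * (G x + G y)).trace := by
    simp [trace, Matrix.mul_apply]
  have h4 : (G x + G y) *ᵥ z = (2 : ℝ) • (G x *ᵥ z) - (G x - G y) *ᵥ z := by
    rw [add_mulVec, sub_mulVec]; module
  rw [h1, h2, h3, h4, dotProduct_add, dotProduct_sub, dotProduct_smul, dotProduct_smul, hr]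
  simp only [smul_eq_mul]
  ring

theorem trace_sub_mul_add {X Y A B : Matrix (Fin n) (Fin n) ℝ} (hXA : X * A = 1)
    (hYB : Y * B = 1) : ((X - Y) * (A + B)).trace = -((X + Y) * (A - B)).trace := by
  have : (X - Y) * (A + B) = -((X + Y) * (A - B)) + 2 • (X * A) - 2 • (Y * B) := by
    noncomm_ring
  rw [this, hXA, hYB, add_sub_cancel_right, trace_neg]

end KernelAlgebra
end RiemannianSchrodinger

/-! ### The trapezoidal rule -/

namespace RiemannianSchrodinger

section KernelEstimates

open Filter Topology Asymptotics Matrix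

variable {n : ℕ}

/-- The error of the trapezoidal rule on `[0, 1]` is bounded by the oscillation of `F''`. -/
theorem abs_trapezoidal_error_le {F F' F'' : ℝ → ℝ} {C : ℝ} (hF : ∀ t, HasDerivAt F (F' t) t)
    (hF' : ∀ t, HasDerivAt F' (F'' t) t)
    (hC : ∀ s ∈ Set.Icc (0 : ℝ) 1, ∀ t ∈ Set.Icc (0 : ℝ) 1, |F'' t - F'' s| ≤ C) :
    |F' 1 + F' 0 - 2 * (F 1 - F 0)| ≤ C := by
  set g : ℝ → ℝ := fun t => t * (F' t + F' 0) - 2 * (F t - F 0) with hg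
  have hg' : ∀ t, HasDerivAt g (F' 0 - F' t + t * F'' t) t := fun t => by
    have := ((hasDerivAt_id t).mul ((hF' t).add_const (F' 0))).sub
      (((hF t).sub_const (F 0)).const_mul 2)
    convert! this using 1
    simp only [id]
    ring
  have hC0 : 0 ≤ C := (abs_nonneg _).trans (hC 0 (by simp) 0 (by simp))
  have hbound : ∀ t ∈ Set.Icc (0 : ℝ) 1, ‖F' 0 - F' t + t * F'' t‖ ≤ C := by
    intro t ht
    rcases ht.1.eq_or_lt with h0 | h0
    · simp [← h0, hC0]
    obtain ⟨s, hs, hs'⟩ := exists_hasDerivAt_eq_slope F' F'' h0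
      (fun t _ => (hF' t).continuousAt.continuousWithinAt) fun t _ => hF' t
    have hs1 : s ∈ Set.Icc (0 : ℝ) 1 := ⟨hs.1.le, hs.2.le.trans ht.2⟩
    rw [sub_zero, eq_div_iff h0.ne'] at hs'
    have : F' 0 - F' t + t * F'' t = t * (F'' t - F'' s) := by linear_combination hs'
    rw [this, Real.norm_eq_abs, abs_mul, abs_of_pos h0]
    calc t * |F'' t - F'' s| ≤ 1 * C :=
          mul_le_mul ht.2 (hC s hs1 t ht) (abs_nonneg _) zero_le_one
      _ = C := one_mul C
  have := (convex_Icc (0 : ℝ) 1).norm_image_sub_le_of_norm_hasDerivWithin_le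
    (fun t _ => (hg' t).hasDerivWithinAt) hbound (Set.left_mem_Icc.2 zero_le_one)
    (Set.right_mem_Icc.2 zero_le_one)
  simpa [hg] using this

theorem fderiv_apply_eq_sum_pd (f : EuclideanSpace ℝ (Fin n) → ℝ)
    (x z : EuclideanSpace ℝ (Fin n)) : fderiv ℝ f x z = ∑ i, pd i f x * z i := by
  have hz : z = ∑ i, z i • EuclideanSpace.single i (1 : ℝ) := by
    ext j
    simp [Finset.sum_apply, Pi.single_apply]
  conv_lhs => rw [hz]
  rw [map_sum]
  exact Finset.sum_congr rfl fun i _ => by rw [map_smul, smul_eq_mul, mul_comm]; rfl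

theorem hasDerivAt_comp_line {f : EuclideanSpace ℝ (Fin n) → ℝ} (hf : ContDiff ℝ ∞ f)
    (y z : EuclideanSpace ℝ (Fin n)) (t : ℝ) :
    HasDerivAt (fun t : ℝ => f (y + t • z)) (∑ i, pd i f (y + t • z) * z i) t := by
  rw [← fderiv_apply_eq_sum_pd]
  have h1 : HasDerivAt (fun t : ℝ => y + t • z) z t := by
    simpa using ((hasDerivAt_id t).smul_const z).const_add y
  exact (hf.diffAt _).hasFDerivAt.comp_hasDerivAt t h1

variable {K : Set (EuclideanSpace ℝ (Fin n))} {f : EuclideanSpace ℝ (Fin n) → ℝ}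

/-- The distance of the two components of a pair of points of `ℝⁿ`. -/
noncomputable def gap (w : EuclideanSpace ℝ (Fin n) × EuclideanSpace ℝ (Fin n)) : ℝ := ‖w.1 - w.2‖

theorem isBigO_comp_fst (hK : IsCompact K) (hf : ContDiff ℝ ∞ f) :
    (fun w : EuclideanSpace ℝ (Fin n) × EuclideanSpace ℝ (Fin n) => f w.1)
      =O[𝓟 (K ×ˢ K)] fun w => gap w ^ 0 := by
  obtain ⟨C, hC⟩ := hK.exists_bound_of_continuousOn hf.continuous.continuousOn
  exact isBigO_principal.2 ⟨C, fun w hw => by simpa using hC w.1 hw.1⟩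

theorem isBigO_comp_snd (hK : IsCompact K) (hf : ContDiff ℝ ∞ f) :
    (fun w : EuclideanSpace ℝ (Fin n) × EuclideanSpace ℝ (Fin n) => f w.2)
      =O[𝓟 (K ×ˢ K)] fun w => gap w ^ 0 := by
  obtain ⟨C, hC⟩ := hK.exists_bound_of_continuousOn hf.continuous.continuousOn
  exact isBigO_principal.2 ⟨C, fun w hw => by simpa using hC w.2 hw.2⟩

theorem isBigO_coord (k : Fin n) :
    (fun w : EuclideanSpace ℝ (Fin n) × EuclideanSpace ℝ (Fin n) => w.1 k - w.2 k)
      =O[𝓟 (K ×ˢ K)] fun w => gap w ^ 1 := by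
  refine isBigO_principal.2 ⟨1, fun w _ => ?_⟩
  have := EuclideanSpace.norm_eq (w.1 - w.2)
  simpa [gap] using PiLp.norm_apply_le (w.1 - w.2) k

theorem exists_abs_sub_le (hK : IsCompact K) (hKc : Convex ℝ K) (hf : ContDiff ℝ ∞ f) :
    ∃ C, 0 ≤ C ∧ ∀ x ∈ K, ∀ y ∈ K, |f x - f y| ≤ C * ‖x - y‖ := by
  obtain ⟨C, hC⟩ := hK.exists_bound_of_continuousOn
    (hf.continuous_fderiv (by simp)).continuousOn
  refine ⟨max C 0, le_max_right _ _, fun x hx y hy => ?_⟩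
  exact hKc.norm_image_sub_le_of_norm_fderiv_le (fun z _ => hf.diffAt z)
    (fun z hz => (hC z hz).trans (le_max_left _ _)) hy hx

theorem isBigO_sub (hK : IsCompact K) (hKc : Convex ℝ K) (hf : ContDiff ℝ ∞ f) :
    (fun w : EuclideanSpace ℝ (Fin n) × EuclideanSpace ℝ (Fin n) => f w.1 - f w.2)
      =O[𝓟 (K ×ˢ K)] fun w => gap w ^ 1 := by
  obtain ⟨C, -, hC⟩ := exists_abs_sub_le hK hKc hf
  exact isBigO_principal.2 ⟨C, fun w hw => by simpa [gap] using hC w.1 hw.1 w.2 hw.2⟩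

/-- The trapezoidal rule along the segment from `w.2` to `w.1`. -/
theorem isBigO_trapezoidal (hK : IsCompact K) (hKc : Convex ℝ K) (hf : ContDiff ℝ ∞ f) :
    (fun w : EuclideanSpace ℝ (Fin n) × EuclideanSpace ℝ (Fin n) =>
      ∑ i, (pd i f w.1 + pd i f w.2) * (w.1 i - w.2 i) - 2 * (f w.1 - f w.2))
      =O[𝓟 (K ×ˢ K)] fun w => gap w ^ 3 := by
  choose C hC0 hC using fun i j =>
    exists_abs_sub_le hK hKc (contDiff_pd (contDiff_pd hf j) i)
  refine isBigO_principal.2 ⟨∑ i, ∑ j, C i j, fun w hw => ?_⟩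
  obtain ⟨x, y⟩ := w
  obtain ⟨hx, hy⟩ : x ∈ K ∧ y ∈ K := hw
  set z := x - y with hz
  have hzi : ∀ i, x i - y i = z i := fun i => rfl
  have hz_le : ∀ i, |z i| ≤ ‖z‖ := fun i => PiLp.norm_apply_le z i
  have hseg : ∀ t ∈ Set.Icc (0 : ℝ) 1, y + t • z ∈ K := fun t ht =>
    hKc.add_smul_sub_mem hy hx ht
  have key := abs_trapezoidal_error_le (F := fun t : ℝ => f (y + t • z))
    (F' := fun t => ∑ i, pd i f (y + t • z) * z i)
    (F'' := fun t => ∑ i, (∑ j, pd j (pd i f) (y + t • z) * z j) * z i)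
    (C := (∑ i, ∑ j, C i j) * ‖z‖ ^ 3) (hasDerivAt_comp_line hf y z)
    (fun t => HasDerivAt.fun_sum fun i _ =>
      (hasDerivAt_comp_line (contDiff_pd hf i) y z t).mul_const _) ?_
  · have hyx : y + z = x := by rw [hz]; abel
    simp only [one_smul, zero_smul, add_zero, hyx] at key
    simp only [hzi, add_mul, Finset.sum_add_distrib, Real.norm_eq_abs, gap]
    rw [abs_of_nonneg (by positivity : (0 : ℝ) ≤ ‖x - y‖ ^ 3)]
    exact key
  · intro s hs t ht
    have hst : ‖(y + t • z) - (y + s • z)‖ ≤ ‖z‖ := by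
      rw [add_sub_add_left_eq_sub, ← sub_smul, norm_smul]
      have : ‖t - s‖ ≤ 1 := by
        rw [Real.norm_eq_abs, abs_le]
        constructor <;> linarith [hs.1, hs.2, ht.1, ht.2]
      nlinarith [norm_nonneg z]
    calc |∑ i, (∑ j, pd j (pd i f) (y + t • z) * z j) * z i -
          ∑ i, (∑ j, pd j (pd i f) (y + s • z) * z j) * z i|
        = |∑ i, ∑ j, (pd j (pd i f) (y + t • z) - pd j (pd i f) (y + s • z)) * (z j * z i)| := by
          simp only [← Finset.sum_sub_distrib, Finset.sum_mul]
          congr 1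
          exact Finset.sum_congr rfl fun i _ => Finset.sum_congr rfl fun j _ => by ring
      _ ≤ ∑ i, ∑ j, |(pd j (pd i f) (y + t • z) - pd j (pd i f) (y + s • z)) * (z j * z i)| :=
          (Finset.abs_sum_le_sum_abs _ _).trans
            (Finset.sum_le_sum fun i _ => Finset.abs_sum_le_sum_abs _ _)
      _ ≤ ∑ i, ∑ j, C j i * ‖z‖ ^ 3 := by
          refine Finset.sum_le_sum fun i _ => Finset.sum_le_sum fun j _ => ?_
          rw [abs_mul, abs_mul]
          have h1 := (hC j i _ (hseg t ht) _ (hseg s hs)).trans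
            (mul_le_mul_of_nonneg_left hst (hC0 j i))
          have h2 : |z j| * |z i| ≤ ‖z‖ * ‖z‖ :=
            mul_le_mul (hz_le j) (hz_le i) (abs_nonneg _) (norm_nonneg _)
          calc _ ≤ (C j i * ‖z‖) * (‖z‖ * ‖z‖) :=
                mul_le_mul h1 h2 (by positivity) (mul_nonneg (hC0 j i) (norm_nonneg _))
            _ = _ := by ring
      _ = (∑ i, ∑ j, C i j) * ‖z‖ ^ 3 := by
          rw [Finset.sum_comm]
          simp only [Finset.sum_mul]

variable {l : Filter (EuclideanSpace ℝ (Fin n) × EuclideanSpace ℝ (Fin n))} {p q : ℕ}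

theorem isBigO_mul_gap {F H : EuclideanSpace ℝ (Fin n) × EuclideanSpace ℝ (Fin n) → ℝ}
    (hF : F =O[l] fun w => gap w ^ p) (hH : H =O[l] fun w => gap w ^ q) :
    (fun w => F w * H w) =O[l] fun w => gap w ^ (p + q) := by
  simpa only [pow_add] using hF.mul hH

theorem isBigO_dotProduct_gap
    {u v : EuclideanSpace ℝ (Fin n) × EuclideanSpace ℝ (Fin n) → Fin n → ℝ}
    (hu : ∀ i, (fun w => u w i) =O[l] fun w => gap w ^ p)
    (hv : ∀ i, (fun w => v w i) =O[l] fun w => gap w ^ q) :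
    (fun w => u w ⬝ᵥ v w) =O[l] fun w => gap w ^ (p + q) :=
  IsBigO.fun_sum fun i _ => isBigO_mul_gap (hu i) (hv i)

theorem isBigO_mulVec_gap
    {A : EuclideanSpace ℝ (Fin n) × EuclideanSpace ℝ (Fin n) → Matrix (Fin n) (Fin n) ℝ}
    {v : EuclideanSpace ℝ (Fin n) × EuclideanSpace ℝ (Fin n) → Fin n → ℝ}
    (hA : ∀ i j, (fun w => A w i j) =O[l] fun w => gap w ^ p)
    (hv : ∀ i, (fun w => v w i) =O[l] fun w => gap w ^ q) (i : Fin n) :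
    (fun w => (A w *ᵥ v w) i) =O[l] fun w => gap w ^ (p + q) :=
  isBigO_dotProduct_gap (hA i) hv

end KernelEstimates
end RiemannianSchrodinger

/-! ### Estimates of the defects -/

namespace RiemannianSchrodinger

section KernelEstimates

open Filter Topology Asymptotics Matrix

variable {n : ℕ}

/-- A smooth symmetric coefficient matrix `a`, its inverse `G`, and the weight `c`, a solution of
`∇c = ¼ c tr (a ∇G)`; up to constants it is `(det G)^(1/4)`. It is the exponent `1/4` that makes the
first order terms of `transport` cancel, see `isBigO_trace`. -/
structure KernelData (n : ℕ) where
  /-- The coefficient matrix. -/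
  a : EuclideanSpace ℝ (Fin n) → Matrix (Fin n) (Fin n) ℝ
  /-- The inverse of the coefficient matrix. -/
  G : EuclideanSpace ℝ (Fin n) → Matrix (Fin n) (Fin n) ℝ
  /-- The weight. -/
  c : EuclideanSpace ℝ (Fin n) → ℝ
  contDiff_a : ∀ i j, ContDiff ℝ ∞ fun x => a x i j
  contDiff_G : ∀ i j, ContDiff ℝ ∞ fun x => G x i j
  contDiff_c : ContDiff ℝ ∞ c
  symm_a : ∀ x, (a x).IsSymm
  symm_G : ∀ x, (G x).IsSymm
  mul_eq_one : ∀ x, a x * G x = 1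
  pd_c : ∀ i x, pd i c x = c x * ((1 / 4) * traceGrad a G x i)

theorem quadGrad_neg (G : EuclideanSpace ℝ (Fin n) → Matrix (Fin n) (Fin n) ℝ)
    (x : EuclideanSpace ℝ (Fin n)) (z : Fin n → ℝ) : quadGrad G x (-z) = quadGrad G x z := by
  ext i; simp [quadGrad]

theorem quadHess_neg (G : EuclideanSpace ℝ (Fin n) → Matrix (Fin n) (Fin n) ℝ)
    (x : EuclideanSpace ℝ (Fin n)) (z : Fin n → ℝ) : quadHess G x (-z) = quadHess G x z := by
  ext i j; simp [quadHess]

/-- The coordinates of the difference of two points. -/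
def coordDiff (w : EuclideanSpace ℝ (Fin n) × EuclideanSpace ℝ (Fin n)) (k : Fin n) : ℝ :=
  w.1 k - w.2 k

namespace KernelData

variable (D : KernelData n) {K : Set (EuclideanSpace ℝ (Fin n))}

theorem contDiff_quadGrad_coeff (i k l : Fin n) : ContDiff ℝ ∞ (pd i fun y => D.G y k l) :=
  contDiff_pd (D.contDiff_G k l) i

theorem contDiff_rowDiv (j : Fin n) : ContDiff ℝ ∞ fun x => rowDiv D.a x j :=
  ContDiff.sum fun i _ => contDiff_pd (D.contDiff_a i j) i

theorem contDiff_traceGrad (i : Fin n) : ContDiff ℝ ∞ fun x => traceGrad D.a D.G x i :=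
  ContDiff.sum fun k _ => ContDiff.sum fun l _ =>
    (D.contDiff_a k l).mul (contDiff_pd (D.contDiff_G l k) i)

section Bounds

theorem isBigO_coordDiff (k : Fin n) :
    (fun w => coordDiff w k) =O[𝓟 (K ×ˢ K)] fun w => gap w ^ 1 := isBigO_coord k

theorem isBigO_diff (i : Fin n) (hK : IsCompact K) (hKc : Convex ℝ K) :
    (fun w => ((D.G w.1 - D.G w.2) *ᵥ coordDiff w) i) =O[𝓟 (K ×ˢ K)] fun w => gap w ^ 2 :=
  isBigO_mulVec_gap (p := 1) (q := 1)
    (A := fun w : EuclideanSpace ℝ (Fin n) × EuclideanSpace ℝ (Fin n) => D.G w.1 - D.G w.2)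
    (fun i j => isBigO_sub hK hKc (D.contDiff_G i j)) isBigO_coordDiff i

theorem isBigO_coordDiff_mul (k l : Fin n) :
    (fun w => coordDiff w k * coordDiff w l) =O[𝓟 (K ×ˢ K)] fun w => gap w ^ 2 :=
  isBigO_mul_gap (p := 1) (q := 1) (isBigO_coordDiff k) (isBigO_coordDiff l)

theorem isBigO_quadGrad_fst (hK : IsCompact K) (i : Fin n) :
    (fun w => quadGrad D.G w.1 (coordDiff w) i) =O[𝓟 (K ×ˢ K)] fun w => gap w ^ 2 :=
  IsBigO.fun_sum fun k _ => IsBigO.fun_sum fun l _ => isBigO_mul_gap (p := 0) (q := 2)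
    (isBigO_comp_fst hK (D.contDiff_quadGrad_coeff i k l)) (isBigO_coordDiff_mul k l)

theorem isBigO_quadGrad_snd (hK : IsCompact K) (i : Fin n) :
    (fun w => quadGrad D.G w.2 (coordDiff w) i) =O[𝓟 (K ×ˢ K)] fun w => gap w ^ 2 :=
  IsBigO.fun_sum fun k _ => IsBigO.fun_sum fun l _ => isBigO_mul_gap (p := 0) (q := 2)
    (isBigO_comp_snd hK (D.contDiff_quadGrad_coeff i k l)) (isBigO_coordDiff_mul k l)

theorem isBigO_quadGrad_sub (hK : IsCompact K) (hKc : Convex ℝ K) (i : Fin n) :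
    (fun w => (quadGrad D.G w.1 (coordDiff w) - quadGrad D.G w.2 (coordDiff w)) i)
      =O[𝓟 (K ×ˢ K)] fun w => gap w ^ 3 := by
  simp only [quadGrad, Pi.sub_apply, ← Finset.sum_sub_distrib, ← sub_mul]
  exact IsBigO.fun_sum fun k _ => IsBigO.fun_sum fun l _ => isBigO_mul_gap (p := 1) (q := 2)
    (isBigO_sub hK hKc (D.contDiff_quadGrad_coeff i k l)) (isBigO_coordDiff_mul k l)

theorem isBigO_quadHess_fst (hK : IsCompact K) (i j : Fin n) :
    (fun w => quadHess D.G w.1 (coordDiff w) i j) =O[𝓟 (K ×ˢ K)] fun w => gap w ^ 2 :=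
  IsBigO.fun_sum fun k _ => IsBigO.fun_sum fun l _ => isBigO_mul_gap (p := 0) (q := 2)
    (isBigO_comp_fst hK (contDiff_pd (contDiff_pd (D.contDiff_G k l) j) i))
    (isBigO_coordDiff_mul k l)

theorem isBigO_quadHess_sub (hK : IsCompact K) (hKc : Convex ℝ K) (i j : Fin n) :
    (fun w => quadHess D.G w.1 (coordDiff w) i j - quadHess D.G w.2 (coordDiff w) i j)
      =O[𝓟 (K ×ˢ K)] fun w => gap w ^ 3 := by
  simp only [quadHess, ← Finset.sum_sub_distrib, ← sub_mul]
  exact IsBigO.fun_sum fun k _ => IsBigO.fun_sum fun l _ => isBigO_mul_gap (p := 1) (q := 2)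
    (isBigO_sub hK hKc (contDiff_pd (contDiff_pd (D.contDiff_G k l) j) i))
    (isBigO_coordDiff_mul k l)

/-- The first summand in `eikonal_defect_eq` is of fifth order: it is the quadratic form in `z` whose
coefficients are the errors of the trapezoidal rule for the entries of `G`. -/
theorem isBigO_trapezoidal_quadGrad (hK : IsCompact K) (hKc : Convex ℝ K) :
    (fun w => coordDiff w ⬝ᵥ (quadGrad D.G w.1 (coordDiff w) + quadGrad D.G w.2 (coordDiff w) -
      (2 : ℝ) • ((D.G w.1 - D.G w.2) *ᵥ coordDiff w))) =O[𝓟 (K ×ˢ K)] fun w => gap w ^ 5 := by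
  have h : ∀ w : EuclideanSpace ℝ (Fin n) × EuclideanSpace ℝ (Fin n), coordDiff w ⬝ᵥ
      (quadGrad D.G w.1 (coordDiff w) + quadGrad D.G w.2 (coordDiff w) -
      (2 : ℝ) • ((D.G w.1 - D.G w.2) *ᵥ coordDiff w)) =
      ∑ k, ∑ l, (∑ i, (pd i (fun y => D.G y k l) w.1 + pd i (fun y => D.G y k l) w.2) *
        (w.1 i - w.2 i) - 2 * (D.G w.1 k l - D.G w.2 k l)) * (coordDiff w k * coordDiff w l) := by
    intro w
    have e1 : coordDiff w ⬝ᵥ ((D.G w.1 - D.G w.2) *ᵥ coordDiff w) =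
        ∑ k, ∑ l, (D.G w.1 k l - D.G w.2 k l) * (coordDiff w k * coordDiff w l) := by
      simp only [dotProduct, mulVec, Finset.mul_sum, Matrix.sub_apply]
      exact Finset.sum_congr rfl fun i _ => Finset.sum_congr rfl fun j _ => by ring
    have e2 : ∀ x, coordDiff w ⬝ᵥ quadGrad D.G x (coordDiff w) =
        ∑ k, ∑ l, (∑ i, pd i (fun y => D.G y k l) x * coordDiff w i) *
          (coordDiff w k * coordDiff w l) := by
      intro x
      simp only [dotProduct, quadGrad, Finset.mul_sum, Finset.sum_mul]
      rw [Finset.sum_comm]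
      refine Finset.sum_congr rfl fun k _ => ?_
      rw [Finset.sum_comm]
      exact Finset.sum_congr rfl fun i _ => Finset.sum_congr rfl fun j _ => by ring
    rw [dotProduct_sub, dotProduct_add, dotProduct_smul, e1, e2, e2, smul_eq_mul, Finset.mul_sum,
      ← Finset.sum_add_distrib, ← Finset.sum_sub_distrib]
    refine Finset.sum_congr rfl fun k _ => ?_
    rw [Finset.mul_sum, ← Finset.sum_add_distrib, ← Finset.sum_sub_distrib]
    refine Finset.sum_congr rfl fun l _ => ?_
    simp only [add_mul, Finset.sum_add_distrib, coordDiff]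
    ring
  simp only [h]
  exact IsBigO.fun_sum fun k _ => IsBigO.fun_sum fun l _ => isBigO_mul_gap (p := 3) (q := 2)
    (isBigO_trapezoidal hK hKc (D.contDiff_G k l)) (isBigO_coordDiff_mul k l)

theorem isBigO_a_fst (hK : IsCompact K) (i j : Fin n) :
    (fun w : EuclideanSpace ℝ (Fin n) × EuclideanSpace ℝ (Fin n) => D.a w.1 i j)
      =O[𝓟 (K ×ˢ K)] fun w => gap w ^ 0 := isBigO_comp_fst hK (D.contDiff_a i j)

theorem isBigO_a_snd (hK : IsCompact K) (i j : Fin n) :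
    (fun w : EuclideanSpace ℝ (Fin n) × EuclideanSpace ℝ (Fin n) => D.a w.2 i j)
      =O[𝓟 (K ×ˢ K)] fun w => gap w ^ 0 := isBigO_comp_snd hK (D.contDiff_a i j)

theorem isBigO_a_sub (hK : IsCompact K) (hKc : Convex ℝ K) (i j : Fin n) :
    (fun w : EuclideanSpace ℝ (Fin n) × EuclideanSpace ℝ (Fin n) => (D.a w.1 - D.a w.2) i j)
      =O[𝓟 (K ×ˢ K)] fun w => gap w ^ 1 := isBigO_sub hK hKc (D.contDiff_a i j)

end Bounds

theorem pd_quad_fst (i : Fin n) (w : EuclideanSpace ℝ (Fin n) × EuclideanSpace ℝ (Fin n)) :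
    pd i (fun x => quad D.G x w.2) w.1 =
      ((D.G w.1 + D.G w.2) *ᵥ coordDiff w + (1 / 2 : ℝ) • quadGrad D.G w.1 (coordDiff w)) i :=
  pd_quad D.contDiff_G D.symm_G i w.1 w.2

theorem pd_quad_snd (i : Fin n) (w : EuclideanSpace ℝ (Fin n) × EuclideanSpace ℝ (Fin n)) :
    pd i (fun x => quad D.G x w.1) w.2 =
      (-((D.G w.1 + D.G w.2) *ᵥ coordDiff w) + (1 / 2 : ℝ) • quadGrad D.G w.2 (coordDiff w)) i := by
  have h : (fun k => w.2 k - w.1 k) = -coordDiff w := by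
    ext k; simp [coordDiff]
  have := pd_quad D.contDiff_G D.symm_G i w.2 w.1
  rw [h, quadGrad_neg, mulVec_neg, add_comm (D.G w.2)] at this
  exact this

/-- The squared gradients of `quad` in its two variables agree up to fifth order. -/
theorem isBigO_eikonal (hK : IsCompact K) (hKc : Convex ℝ K) :
    (fun w => gradForm D.a (fun x => quad D.G x w.2) (fun x => quad D.G x w.2) w.1 -
      gradForm D.a (fun x => quad D.G x w.1) (fun x => quad D.G x w.1) w.2)
      =O[𝓟 (K ×ˢ K)] fun w => gap w ^ 5 := by
  have hd := fun i => D.isBigO_diff i hK hKc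
  have hq := D.isBigO_quadGrad_fst hK
  have hr := D.isBigO_quadGrad_snd hK
  have hqr := D.isBigO_quadGrad_sub hK hKc
  have had := isBigO_mulVec_gap (p := 0) (q := 2) (D.isBigO_a_fst hK) hd
  have h1 := (D.isBigO_trapezoidal_quadGrad hK hKc).const_mul_left 2
  have h2 := isBigO_dotProduct_gap (p := 2) (q := 3) hd
    (isBigO_mulVec_gap (p := 1) (q := 2) (D.isBigO_a_sub hK hKc) hd)
  have h3 := isBigO_dotProduct_gap (p := 3) (q := 2) hqr had
  have h4 := isBigO_dotProduct_gap (p := 2) (q := 3) hr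
    (isBigO_mulVec_gap (p := 1) (q := 2) (D.isBigO_a_sub hK hKc) hd)
  have h5 := isBigO_dotProduct_gap (p := 3) (q := 2) hqr
    (isBigO_mulVec_gap (p := 0) (q := 2) (D.isBigO_a_fst hK) hq)
  have h6 := isBigO_dotProduct_gap (p := 3) (q := 2) hqr
    (isBigO_mulVec_gap (p := 0) (q := 2) (D.isBigO_a_fst hK) hr)
  have h7 := isBigO_dotProduct_gap (p := 2) (q := 3) hr
    (isBigO_mulVec_gap (p := 1) (q := 2) (D.isBigO_a_sub hK hKc) hr)
  refine ((((h1.add h2).sub h3).sub h4).add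
    (((h5.add h6).add h7).const_mul_left (1 / 4))).congr_left fun w => ?_
  rw [gradForm_eq_dotProduct (fun i => D.pd_quad_fst i w) (fun i => D.pd_quad_fst i w),
    gradForm_eq_dotProduct (fun i => D.pd_quad_snd i w) (fun i => D.pd_quad_snd i w)]
  exact (eikonal_defect_eq (D.symm_a _) (D.symm_a _) (D.mul_eq_one _) (D.mul_eq_one _) _ _ _).symm

/-- The expression `ℒ S + 2 Γ(log c, S)` in the variable `x`, where `ℒ = divForm a`, `Γ = gradForm a`
and `S = quad G`; by the equation for `c` the logarithmic derivative of `c` is `¼ traceGrad a G`.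
Multiplied by `c`, it is the coefficient of `φ'(S)` in `ℒ (c φ(S))`. -/
noncomputable def transport (x y : EuclideanSpace ℝ (Fin n)) : ℝ :=
  divForm D.a (fun x => quad D.G x y) x + (1 / 2) *
    (traceGrad D.a D.G x ⬝ᵥ (D.a x *ᵥ fun j => pd j (fun x => quad D.G x y) x))

theorem gradForm_c_quad (x y : EuclideanSpace ℝ (Fin n)) :
    gradForm D.a D.c (fun x => quad D.G x y) x = D.c x * ((1 / 4) *
      (traceGrad D.a D.G x ⬝ᵥ (D.a x *ᵥ fun j => pd j (fun x => quad D.G x y) x))) := by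
  rw [gradForm_eq_dotProduct (u := (D.c x * (1 / 4)) • traceGrad D.a D.G x)
    (fun i => by rw [D.pd_c, Pi.smul_apply, smul_eq_mul]; ring) (fun i => rfl), smul_dotProduct,
    smul_eq_mul]
  ring

theorem mulVec_pd_quad_fst (w : EuclideanSpace ℝ (Fin n) × EuclideanSpace ℝ (Fin n)) :
    (D.a w.1 *ᵥ fun j => pd j (fun x => quad D.G x w.2) w.1) = (2 : ℝ) • coordDiff w -
      D.a w.1 *ᵥ ((D.G w.1 - D.G w.2) *ᵥ coordDiff w) +
      (1 / 2 : ℝ) • (D.a w.1 *ᵥ quadGrad D.G w.1 (coordDiff w)) := by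
  simp only [D.pd_quad_fst]
  rw [mulVec_add, mulVec_smul, mulVec_mulVec, mulVec_mulVec, Matrix.mul_add, Matrix.mul_sub,
    D.mul_eq_one, add_mulVec, sub_mulVec, one_mulVec]
  module

theorem mulVec_pd_quad_snd (w : EuclideanSpace ℝ (Fin n) × EuclideanSpace ℝ (Fin n)) :
    (D.a w.2 *ᵥ fun j => pd j (fun x => quad D.G x w.1) w.2) = -((2 : ℝ) • coordDiff w) -
      D.a w.2 *ᵥ ((D.G w.1 - D.G w.2) *ᵥ coordDiff w) +
      (1 / 2 : ℝ) • (D.a w.2 *ᵥ quadGrad D.G w.2 (coordDiff w)) := by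
  simp only [D.pd_quad_snd]
  rw [mulVec_add, mulVec_neg, mulVec_smul, mulVec_mulVec, mulVec_mulVec, Matrix.mul_add,
    Matrix.mul_sub, D.mul_eq_one, add_mulVec, sub_mulVec, one_mulVec]
  module

theorem transport_fst (w : EuclideanSpace ℝ (Fin n) × EuclideanSpace ℝ (Fin n)) :
    D.transport w.1 w.2 = (D.a w.1 * (D.G w.1 + D.G w.2)).trace +
      (1 / 2) * ∑ i, ∑ j, D.a w.1 i j * quadHess D.G w.1 (coordDiff w) i j -
      rowDiv D.a w.1 ⬝ᵥ ((D.G w.1 - D.G w.2) *ᵥ coordDiff w) +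
      (1 / 2) * (rowDiv D.a w.1 ⬝ᵥ quadGrad D.G w.1 (coordDiff w)) +
      traceGrad D.a D.G w.1 ⬝ᵥ coordDiff w -
      (1 / 2) * (traceGrad D.a D.G w.1 ⬝ᵥ
        (D.a w.1 *ᵥ ((D.G w.1 - D.G w.2) *ᵥ coordDiff w))) +
      (1 / 4) * (traceGrad D.a D.G w.1 ⬝ᵥ (D.a w.1 *ᵥ quadGrad D.G w.1 (coordDiff w))) := by
  rw [transport, mulVec_pd_quad_fst, divForm_quad D.contDiff_G D.symm_G D.contDiff_a D.symm_a
    D.mul_eq_one]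
  simp only [dotProduct_add, dotProduct_sub, dotProduct_smul, smul_eq_mul]
  have : (fun k => w.1 k - w.2 k) = coordDiff w := rfl
  rw [this]
  ring

theorem transport_snd (w : EuclideanSpace ℝ (Fin n) × EuclideanSpace ℝ (Fin n)) :
    D.transport w.2 w.1 = (D.a w.2 * (D.G w.1 + D.G w.2)).trace +
      (1 / 2) * ∑ i, ∑ j, D.a w.2 i j * quadHess D.G w.2 (coordDiff w) i j -
      rowDiv D.a w.2 ⬝ᵥ ((D.G w.1 - D.G w.2) *ᵥ coordDiff w) +
      (1 / 2) * (rowDiv D.a w.2 ⬝ᵥ quadGrad D.G w.2 (coordDiff w)) -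
      traceGrad D.a D.G w.2 ⬝ᵥ coordDiff w -
      (1 / 2) * (traceGrad D.a D.G w.2 ⬝ᵥ
        (D.a w.2 *ᵥ ((D.G w.1 - D.G w.2) *ᵥ coordDiff w))) +
      (1 / 4) * (traceGrad D.a D.G w.2 ⬝ᵥ (D.a w.2 *ᵥ quadGrad D.G w.2 (coordDiff w))) := by
  rw [transport, mulVec_pd_quad_snd, divForm_quad D.contDiff_G D.symm_G D.contDiff_a D.symm_a
    D.mul_eq_one]
  simp only [dotProduct_add, dotProduct_sub, dotProduct_smul, dotProduct_neg, smul_eq_mul]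
  have h : (fun k => w.2 k - w.1 k) = -coordDiff w := by
    ext k; simp [coordDiff]
  have h2 : (D.G w.2 - D.G w.1) *ᵥ (-coordDiff w) = (D.G w.1 - D.G w.2) *ᵥ coordDiff w := by
    rw [mulVec_neg, ← neg_mulVec, neg_sub]
  rw [h, quadGrad_neg, quadHess_neg, h2, add_comm (D.G w.2)]
  ring

theorem isBigO_dotProduct_sub {u : EuclideanSpace ℝ (Fin n) → Fin n → ℝ}
    {v v' : EuclideanSpace ℝ (Fin n) × EuclideanSpace ℝ (Fin n) → Fin n → ℝ}
    (hK : IsCompact K) (hKc : Convex ℝ K) (hu : ∀ i, ContDiff ℝ ∞ fun x => u x i)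
    (hv : ∀ i, (fun w => v w i) =O[𝓟 (K ×ˢ K)] fun w => gap w ^ 2)
    (hv' : ∀ i, (fun w => (v w - v' w) i) =O[𝓟 (K ×ˢ K)] fun w => gap w ^ 3) :
    (fun w => u w.1 ⬝ᵥ v w - u w.2 ⬝ᵥ v' w) =O[𝓟 (K ×ˢ K)] fun w => gap w ^ 3 := by
  have h : ∀ w, u w.1 ⬝ᵥ v w - u w.2 ⬝ᵥ v' w =
      (u w.1 - u w.2) ⬝ᵥ v w + u w.2 ⬝ᵥ (v w - v' w) := fun w => by
    rw [sub_dotProduct, dotProduct_sub]; ring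
  simp only [h]
  exact (isBigO_dotProduct_gap (p := 1) (q := 2) (fun i => isBigO_sub hK hKc (hu i)) hv).add
    (isBigO_dotProduct_gap (p := 0) (q := 3) (fun i => isBigO_comp_snd hK (hu i)) hv')

theorem isBigO_mulVec_sub
    {v v' : EuclideanSpace ℝ (Fin n) × EuclideanSpace ℝ (Fin n) → Fin n → ℝ}
    (hK : IsCompact K) (hKc : Convex ℝ K)
    (hv : ∀ i, (fun w => v w i) =O[𝓟 (K ×ˢ K)] fun w => gap w ^ 2)
    (hv' : ∀ i, (fun w => (v w - v' w) i) =O[𝓟 (K ×ˢ K)] fun w => gap w ^ 3) (i : Fin n) :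
    (fun w => (D.a w.1 *ᵥ v w - D.a w.2 *ᵥ v' w) i) =O[𝓟 (K ×ˢ K)] fun w => gap w ^ 3 :=
  isBigO_dotProduct_sub (u := fun x => D.a x i) hK hKc (fun j => D.contDiff_a i j) hv hv'

/-- The trace terms in the difference of `transport` at `(x, y)` and `(y, x)` cancel against the
logarithmic gradient of the weight `c`, by the trapezoidal rule. -/
theorem isBigO_trace (hK : IsCompact K) (hKc : Convex ℝ K) :
    (fun w => traceGrad D.a D.G w.1 ⬝ᵥ coordDiff w + traceGrad D.a D.G w.2 ⬝ᵥ coordDiff w -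
      ((D.a w.1 + D.a w.2) * (D.G w.1 - D.G w.2)).trace) =O[𝓟 (K ×ˢ K)] fun w => gap w ^ 3 := by
  have h : ∀ w : EuclideanSpace ℝ (Fin n) × EuclideanSpace ℝ (Fin n),
      traceGrad D.a D.G w.1 ⬝ᵥ coordDiff w + traceGrad D.a D.G w.2 ⬝ᵥ coordDiff w -
      ((D.a w.1 + D.a w.2) * (D.G w.1 - D.G w.2)).trace =
      (1 / 2) * ∑ k, ∑ l, (D.a w.1 k l + D.a w.2 k l) *
        (∑ i, (pd i (fun y => D.G y l k) w.1 + pd i (fun y => D.G y l k) w.2) * (w.1 i - w.2 i) -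
          2 * (D.G w.1 l k - D.G w.2 l k)) +
      (1 / 2) * ∑ k, ∑ l, (D.a w.1 k l - D.a w.2 k l) *
        (∑ i, (pd i (fun y => D.G y l k) w.1 - pd i (fun y => D.G y l k) w.2) * coordDiff w i) := by
    intro w
    have e1 : ((D.a w.1 + D.a w.2) * (D.G w.1 - D.G w.2)).trace =
        ∑ k, ∑ l, (D.a w.1 k l + D.a w.2 k l) * (D.G w.1 l k - D.G w.2 l k) := by
      simp [trace, Matrix.mul_apply]
    have e2 : ∀ x, traceGrad D.a D.G x ⬝ᵥ coordDiff w =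
        ∑ k, ∑ l, D.a x k l * ∑ i, pd i (fun y => D.G y l k) x * coordDiff w i := by
      intro x
      simp only [dotProduct, traceGrad, Finset.sum_mul, Finset.mul_sum]
      rw [Finset.sum_comm]
      refine Finset.sum_congr rfl fun k _ => ?_
      rw [Finset.sum_comm]
      exact Finset.sum_congr rfl fun i _ => Finset.sum_congr rfl fun j _ => by ring
    rw [e1, e2, e2]
    simp only [Finset.mul_sum (a := (1 / 2 : ℝ)), ← Finset.sum_add_distrib,
      ← Finset.sum_sub_distrib]
    refine Finset.sum_congr rfl fun k _ => Finset.sum_congr rfl fun l _ => ?_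
    simp only [add_mul, sub_mul, Finset.sum_add_distrib, Finset.sum_sub_distrib, coordDiff]
    ring
  simp only [h]
  refine IsBigO.add (IsBigO.const_mul_left ?_ _) (IsBigO.const_mul_left ?_ _)
  · exact IsBigO.fun_sum fun k _ => IsBigO.fun_sum fun l _ => isBigO_mul_gap (p := 0) (q := 3)
      ((D.isBigO_a_fst hK k l).add (D.isBigO_a_snd hK k l))
      (isBigO_trapezoidal hK hKc (D.contDiff_G l k))
  · exact IsBigO.fun_sum fun k _ => IsBigO.fun_sum fun l _ => isBigO_mul_gap (p := 1) (q := 2)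
      (isBigO_sub hK hKc (D.contDiff_a k l))
      (IsBigO.fun_sum fun i _ => isBigO_mul_gap (p := 1) (q := 1)
        (isBigO_sub hK hKc (contDiff_pd (D.contDiff_G l k) i)) (isBigO_coordDiff i))

/-- The antisymmetric part of `transport` is of third order. -/
theorem isBigO_transport (hK : IsCompact K) (hKc : Convex ℝ K) :
    (fun w => D.transport w.1 w.2 - D.transport w.2 w.1) =O[𝓟 (K ×ˢ K)] fun w => gap w ^ 3 := by
  have hd := fun i => D.isBigO_diff i hK hKc
  have hq := D.isBigO_quadGrad_fst hK
  have hqr := D.isBigO_quadGrad_sub hK hKc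
  have hdd : ∀ i, (fun w => ((D.G w.1 - D.G w.2) *ᵥ coordDiff w -
      (D.G w.1 - D.G w.2) *ᵥ coordDiff w) i) =O[𝓟 (K ×ˢ K)] fun w => gap w ^ 3 := fun i => by
    simpa using isBigO_zero _ _
  have had : ∀ i, (fun w => (D.a w.1 *ᵥ ((D.G w.1 - D.G w.2) *ᵥ coordDiff w)) i)
      =O[𝓟 (K ×ˢ K)] fun w => gap w ^ 2 :=
    isBigO_mulVec_gap (p := 0) (q := 2) (D.isBigO_a_fst hK) hd
  have haq : ∀ i, (fun w => (D.a w.1 *ᵥ quadGrad D.G w.1 (coordDiff w)) i)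
      =O[𝓟 (K ×ˢ K)] fun w => gap w ^ 2 :=
    isBigO_mulVec_gap (p := 0) (q := 2) (D.isBigO_a_fst hK) hq
  have h1 := D.isBigO_trace hK hKc
  have h2 : (fun w : EuclideanSpace ℝ (Fin n) × EuclideanSpace ℝ (Fin n) =>
      ∑ i, (D.a w.1 i ⬝ᵥ quadHess D.G w.1 (coordDiff w) i -
        D.a w.2 i ⬝ᵥ quadHess D.G w.2 (coordDiff w) i)) =O[𝓟 (K ×ˢ K)] fun w => gap w ^ 3 :=
    IsBigO.fun_sum fun i _ => isBigO_dotProduct_sub (u := fun x => D.a x i) hK hKc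
      (fun j => D.contDiff_a i j) (D.isBigO_quadHess_fst hK i) (D.isBigO_quadHess_sub hK hKc i)
  have h3 := isBigO_dotProduct_sub hK hKc D.contDiff_rowDiv hd hdd
  have h4 := isBigO_dotProduct_sub hK hKc D.contDiff_rowDiv hq hqr
  have h5 := isBigO_dotProduct_sub hK hKc D.contDiff_traceGrad had
    (D.isBigO_mulVec_sub hK hKc hd hdd)
  have h6 := isBigO_dotProduct_sub hK hKc D.contDiff_traceGrad haq
    (D.isBigO_mulVec_sub hK hKc hq hqr)
  refine (((((h1.add (h2.const_mul_left (1 / 2))).sub h3).add (h4.const_mul_left (1 / 2))).sub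
    (h5.const_mul_left (1 / 2))).add (h6.const_mul_left (1 / 4))).congr_left fun w => ?_
  have e := trace_sub_mul_add (D.mul_eq_one w.1) (D.mul_eq_one w.2)
  rw [Matrix.sub_mul, trace_sub] at e
  rw [transport_fst, transport_snd, Finset.sum_sub_distrib]
  simp only [dotProduct] at *
  linear_combination -e

end KernelData

end KernelEstimates
end RiemannianSchrodinger

/-! ### The mollifying kernel and its commutator -/

namespace RiemannianSchrodinger

section Kernel

open Filter Topology Asymptotics Matrix

variable {n : ℕ}

theorem contDiff_pd_fst {F : EuclideanSpace ℝ (Fin n) × EuclideanSpace ℝ (Fin n) → ℝ}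
    (hF : ContDiff ℝ ∞ F) (i : Fin n) :
    ContDiff ℝ ∞ fun w : EuclideanSpace ℝ (Fin n) × EuclideanSpace ℝ (Fin n) =>
      pd i (fun x => F (x, w.2)) w.1 := by
  have h : ∀ w : EuclideanSpace ℝ (Fin n) × EuclideanSpace ℝ (Fin n),
      pd i (fun x => F (x, w.2)) w.1 = fderiv ℝ F w (EuclideanSpace.single i 1, 0) := by
    intro w
    have h1 : HasFDerivAt (fun x : EuclideanSpace ℝ (Fin n) => (x, w.2))
        (ContinuousLinearMap.inl ℝ _ _) w.1 := hasFDerivAt_prodMk_left w.1 w.2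
    have h2 : HasFDerivAt F (fderiv ℝ F w) (w.1, w.2) :=
      (hF.differentiable (by simp) w).hasFDerivAt
    have h3 : fderiv ℝ (fun x => F (x, w.2)) w.1 = _ := (h2.comp w.1 h1).fderiv
    simp [pd, h3]
  simp only [h]
  exact (hF.fderiv_right (m := ∞) (by simp)).clm_apply contDiff_const

theorem contDiff_divForm_fst {a : EuclideanSpace ℝ (Fin n) → Matrix (Fin n) (Fin n) ℝ}
    (ha : ∀ i j, ContDiff ℝ ∞ fun x => a x i j)
    {F : EuclideanSpace ℝ (Fin n) × EuclideanSpace ℝ (Fin n) → ℝ} (hF : ContDiff ℝ ∞ F) :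
    ContDiff ℝ ∞ fun w : EuclideanSpace ℝ (Fin n) × EuclideanSpace ℝ (Fin n) =>
      divForm a (fun x => F (x, w.2)) w.1 :=
  ContDiff.sum fun i _ => contDiff_pd_fst (F := fun v => ∑ j, a v.1 i j *
    pd j (fun x => F (x, v.2)) v.1) (ContDiff.sum fun j _ =>
      ((ha i j).comp contDiff_fst).mul (contDiff_pd_fst hF j)) i

/-- The profiles of the mollifying kernels: smooth functions with compact support that vanish on
`[1/2, ∞)`. Only the values at nonnegative numbers matter. As `1/2 < 1`, the derivatives vanish
on `[1, ∞)`, too. -/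
structure IsProfile (φ : ℝ → ℝ) : Prop where
  contDiff : ContDiff ℝ ∞ φ
  hasCompactSupport : HasCompactSupport φ
  eq_zero : ∀ s, 1 / 2 ≤ s → φ s = 0

namespace KernelData

variable (D : KernelData n) {φ : ℝ → ℝ} {ε : ℝ}

/-- The mollifying kernel `ε⁻ⁿ c(x) c(y) φ(S(x, y) / ε²)`, where `S = quad G`. -/
noncomputable def kernel (φ : ℝ → ℝ) (ε : ℝ) (x y : EuclideanSpace ℝ (Fin n)) : ℝ :=
  (ε ^ n)⁻¹ * (D.c x * D.c y * φ (quad D.G x y * (ε ^ 2)⁻¹))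

theorem kernel_comm (φ : ℝ → ℝ) (ε : ℝ) (x y : EuclideanSpace ℝ (Fin n)) :
    D.kernel φ ε x y = D.kernel φ ε y x := by
  rw [kernel, kernel, quad_comm, mul_comm (D.c x)]

theorem contDiff_kernel (hφ : ContDiff ℝ ∞ φ) (ε : ℝ) :
    ContDiff ℝ ∞ fun w : EuclideanSpace ℝ (Fin n) × EuclideanSpace ℝ (Fin n) =>
      D.kernel φ ε w.1 w.2 :=
  contDiff_const.mul (((D.contDiff_c.comp contDiff_fst).mul (D.contDiff_c.comp contDiff_snd)).mul
    (hφ.comp ((contDiff_quad D.contDiff_G).mul contDiff_const)))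

theorem contDiff_kernel_left (hφ : ContDiff ℝ ∞ φ) (ε : ℝ) (y : EuclideanSpace ℝ (Fin n)) :
    ContDiff ℝ ∞ fun x => D.kernel φ ε x y :=
  (D.contDiff_kernel hφ ε).comp (contDiff_id.prodMk contDiff_const)

/-- The commutator kernel `(ℒₓ - ℒ_y) k(x, y)`. -/
noncomputable def commutator (φ : ℝ → ℝ) (ε : ℝ) (x y : EuclideanSpace ℝ (Fin n)) : ℝ :=
  divForm D.a (fun x => D.kernel φ ε x y) x - divForm D.a (fun y => D.kernel φ ε x y) y

/-- The operator applied to the kernel in its first variable, in powers of `ε⁻²`. -/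
theorem divForm_kernel (hφ : ContDiff ℝ ∞ φ) (ε : ℝ) (x y : EuclideanSpace ℝ (Fin n)) :
    divForm D.a (fun x => D.kernel φ ε x y) x =
      (ε ^ n)⁻¹ * (φ (quad D.G x y * (ε ^ 2)⁻¹) * (D.c y * divForm D.a D.c x) +
        (ε ^ 2)⁻¹ * deriv φ (quad D.G x y * (ε ^ 2)⁻¹) * (D.c x * D.c y * D.transport x y) +
        ((ε ^ 2)⁻¹) ^ 2 * deriv (deriv φ) (quad D.G x y * (ε ^ 2)⁻¹) * (D.c x * D.c y *
          gradForm D.a (fun x => quad D.G x y) (fun x => quad D.G x y) x)) := by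
  set Φ : ℝ → ℝ := fun s => φ (s * (ε ^ 2)⁻¹) with hΦ
  have hφ' : ContDiff ℝ ∞ (deriv φ) := (contDiff_infty_iff_deriv.1 hφ).2
  have hΦs : ContDiff ℝ ∞ Φ := hφ.comp (contDiff_id.mul contDiff_const)
  have hlin : ∀ s, HasDerivAt (fun s : ℝ => s * (ε ^ 2)⁻¹) (ε ^ 2)⁻¹ s := fun s => by
    simpa using (hasDerivAt_id s).mul_const (ε ^ 2)⁻¹
  have hΦ1 : deriv Φ = fun s => deriv φ (s * (ε ^ 2)⁻¹) * (ε ^ 2)⁻¹ := funext fun s =>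
    ((hφ.differentiable (by simp) _).hasDerivAt.comp s (hlin s)).deriv
  have hΦ2 : deriv (deriv Φ) = fun s =>
      deriv (deriv φ) (s * (ε ^ 2)⁻¹) * (ε ^ 2)⁻¹ * (ε ^ 2)⁻¹ := funext fun s => by
    rw [hΦ1]
    exact (((hφ'.differentiable (by simp) _).hasDerivAt.comp s (hlin s)).mul_const _).deriv
  have hS := contDiff_quad_left D.contDiff_G y
  have hΦS : ContDiff ℝ ∞ fun x => Φ (quad D.G x y) := hΦs.comp hS
  have h1 : (fun x => D.kernel φ ε x y) =
      fun x => ((ε ^ n)⁻¹ * D.c y) * (D.c x * Φ (quad D.G x y)) := by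
    ext x; simp only [kernel, hΦ]; ring
  have h2 : gradForm D.a D.c (fun x => Φ (quad D.G x y)) x =
      deriv Φ (quad D.G x y) * gradForm D.a D.c (fun x => quad D.G x y) x := by
    simp only [gradForm, Finset.mul_sum]
    refine Finset.sum_congr rfl fun i _ => Finset.sum_congr rfl fun j _ => ?_
    rw [pd_comp (hΦs.differentiable (by simp) _) (hS.diffAt x)]
    ring
  rw [h1, divForm_const_mul D.contDiff_a _ (D.contDiff_c.mul hΦS),
    divForm_mul D.contDiff_a (D.symm_a x) D.contDiff_c hΦS, h2,
    divForm_comp D.contDiff_a hΦs hS, gradForm_c_quad, hΦ2, hΦ1]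
  simp only [hΦ, transport]
  ring

/-- On the support of the kernel, where `|x - y|` is `O(ε)`, the three summands in the bracket are
`O(ε)`, `ε⁻² O(ε³)` and `ε⁻⁴ O(ε⁵)`, by `isBigO_transport` and `isBigO_eikonal`. -/
theorem commutator_eq (hφ : ContDiff ℝ ∞ φ) (ε : ℝ) (x y : EuclideanSpace ℝ (Fin n)) :
    D.commutator φ ε x y =
      (ε ^ n)⁻¹ * (φ (quad D.G x y * (ε ^ 2)⁻¹) *
          (D.c y * divForm D.a D.c x - D.c x * divForm D.a D.c y) +
        (ε ^ 2)⁻¹ * deriv φ (quad D.G x y * (ε ^ 2)⁻¹) *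
          (D.c x * D.c y * (D.transport x y - D.transport y x)) +
        ((ε ^ 2)⁻¹) ^ 2 * deriv (deriv φ) (quad D.G x y * (ε ^ 2)⁻¹) * (D.c x * D.c y *
          (gradForm D.a (fun x => quad D.G x y) (fun x => quad D.G x y) x -
            gradForm D.a (fun y => quad D.G y x) (fun y => quad D.G y x) y))) := by
  have h : (fun y => D.kernel φ ε x y) = fun y => D.kernel φ ε y x :=
    funext fun y => D.kernel_comm φ ε x y
  rw [commutator, h, D.divForm_kernel hφ, D.divForm_kernel hφ, quad_comm D.G y x]
  ring

theorem continuous_commutator (hφ : ContDiff ℝ ∞ φ) (ε : ℝ) :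
    Continuous fun w : EuclideanSpace ℝ (Fin n) × EuclideanSpace ℝ (Fin n) =>
      D.commutator φ ε w.1 w.2 := by
  have h1 := (contDiff_divForm_fst D.contDiff_a (D.contDiff_kernel hφ ε)).continuous
  have h2 := h1.comp continuous_swap
  refine (h1.sub h2).congr fun w => ?_
  have h : (fun y => D.kernel φ ε w.1 y) = fun y => D.kernel φ ε y w.1 :=
    funext fun y => D.kernel_comm φ ε w.1 y
  rw [commutator, h]
  rfl

variable {κ : ℝ}

theorem le_quad (hκ : ∀ x (v : Fin n → ℝ), κ * (v ⬝ᵥ v) ≤ v ⬝ᵥ (D.G x *ᵥ v))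
    (x y : EuclideanSpace ℝ (Fin n)) : κ * ‖x - y‖ ^ 2 ≤ quad D.G x y := by
  set z : Fin n → ℝ := fun k => x k - y k with hz
  have h1 : quad D.G x y = (1 / 2) * (z ⬝ᵥ (D.G x *ᵥ z) + z ⬝ᵥ (D.G y *ᵥ z)) := by
    simp only [quad, dotProduct, mulVec, Finset.mul_sum, ← Finset.sum_add_distrib]
    exact Finset.sum_congr rfl fun i _ => Finset.sum_congr rfl fun j _ => by simp only [hz]; ring
  have h2 : ‖x - y‖ ^ 2 = z ⬝ᵥ z := by
    rw [EuclideanSpace.norm_sq_eq]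
    simp [dotProduct, hz, sq]
  rw [h1, h2]
  linarith [hκ x z, hκ y z]

theorem one_le_quad_mul (hκ : ∀ x (v : Fin n → ℝ), κ * (v ⬝ᵥ v) ≤ v ⬝ᵥ (D.G x *ᵥ v))
    {L : ℝ} (hL0 : 0 ≤ L) (hL : 1 ≤ κ * L ^ 2) (hκ0 : 0 ≤ κ) (hε : 0 < ε)
    {x y : EuclideanSpace ℝ (Fin n)} (hxy : L * ε ≤ ‖x - y‖) :
    1 ≤ quad D.G x y * (ε ^ 2)⁻¹ := by
  rw [← div_eq_mul_inv, one_le_div (by positivity)]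
  calc ε ^ 2 = 1 * ε ^ 2 := (one_mul _).symm
    _ ≤ κ * L ^ 2 * ε ^ 2 := by gcongr
    _ = κ * (L * ε) ^ 2 := by ring
    _ ≤ κ * ‖x - y‖ ^ 2 := by gcongr
    _ ≤ _ := D.le_quad hκ x y

theorem kernel_eq_zero (hφ : IsProfile φ)
    (hκ : ∀ x (v : Fin n → ℝ), κ * (v ⬝ᵥ v) ≤ v ⬝ᵥ (D.G x *ᵥ v))
    {L : ℝ} (hL0 : 0 ≤ L) (hL : 1 ≤ κ * L ^ 2) (hκ0 : 0 ≤ κ) (hε : 0 < ε)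
    {x y : EuclideanSpace ℝ (Fin n)} (hxy : L * ε ≤ ‖x - y‖) : D.kernel φ ε x y = 0 := by
  have h := D.one_le_quad_mul hκ hL0 hL hκ0 hε hxy
  rw [kernel, hφ.eq_zero _ (by linarith)]
  simp

theorem commutator_eq_zero (hφ : IsProfile φ)
    (hκ : ∀ x (v : Fin n → ℝ), κ * (v ⬝ᵥ v) ≤ v ⬝ᵥ (D.G x *ᵥ v))
    {L : ℝ} (hL0 : 0 ≤ L) (hL : 1 ≤ κ * L ^ 2) (hκ0 : 0 ≤ κ) (hε : 0 < ε)
    {x y : EuclideanSpace ℝ (Fin n)} (hxy : L * ε ≤ ‖x - y‖) : D.commutator φ ε x y = 0 := by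
  have h := D.one_le_quad_mul hκ hL0 hL hκ0 hε hxy
  have h0 : ∀ s, 1 / 2 < s → φ =ᶠ[𝓝 s] fun _ => 0 := fun s hs =>
    (lt_mem_nhds hs).mono fun t ht => hφ.eq_zero t ht.le
  have h1 : ∀ s, 1 / 2 < s → deriv φ s = 0 := fun s hs => by
    rw [(h0 s hs).deriv_eq, deriv_const]
  have h2 : ∀ s, 1 / 2 < s → deriv (deriv φ) s = 0 := fun s hs => by
    have : deriv φ =ᶠ[𝓝 s] fun _ => 0 := (lt_mem_nhds hs).mono fun t ht => h1 t ht
    rw [this.deriv_eq, deriv_const]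
  rw [D.commutator_eq hφ.contDiff, hφ.eq_zero _ (by linarith), h1 _ (by linarith),
    h2 _ (by linarith)]
  simp

theorem exists_forall_abs_le {ψ : ℝ → ℝ} (hψ : Continuous ψ) (hc : HasCompactSupport ψ) :
    ∃ C, 0 ≤ C ∧ ∀ s, |ψ s| ≤ C := by
  obtain ⟨C, hC⟩ := hψ.bounded_above_of_compact_support hc
  exact ⟨C, (norm_nonneg _).trans (hC 0), hC⟩

theorem exists_kernel_bound (hφ : IsProfile φ) {K : Set (EuclideanSpace ℝ (Fin n))}
    (hK : IsCompact K) : ∃ C, 0 ≤ C ∧ ∀ ε : ℝ, 0 < ε → ∀ x ∈ K, ∀ y ∈ K,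
      |D.kernel φ ε x y| ≤ C * (ε ^ n)⁻¹ := by
  obtain ⟨C₀, hC₀, hφ₀⟩ := exists_forall_abs_le hφ.contDiff.continuous hφ.hasCompactSupport
  obtain ⟨C₁, hC₁⟩ := hK.exists_bound_of_continuousOn D.contDiff_c.continuous.continuousOn
  refine ⟨|C₁| * |C₁| * C₀, by positivity, fun ε hε x hx y hy => ?_⟩
  rw [kernel, abs_mul, abs_mul, abs_mul, abs_of_pos (by positivity : (0 : ℝ) < (ε ^ n)⁻¹), mul_comm]
  have h1 : |D.c x| ≤ |C₁| := (hC₁ x hx).trans (le_abs_self _)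
  have h2 : |D.c y| ≤ |C₁| := (hC₁ y hy).trans (le_abs_self _)
  gcongr
  exact hφ₀ _

/-- The commutator kernel is `O(ε · ε⁻ⁿ)`. As it vanishes for `|x - y| ≥ L ε`, its integral operator
is `O(ε)` from `L¹` to `L¹_loc`, so that `divForm a` commutes with the mollification up to `O(ε)` on
functions without any regularity. -/
theorem exists_commutator_bound (hφ : IsProfile φ)
    (hκ : ∀ x (v : Fin n → ℝ), κ * (v ⬝ᵥ v) ≤ v ⬝ᵥ (D.G x *ᵥ v)) (hκ0 : 0 ≤ κ)
    {L : ℝ} (hL0 : 0 ≤ L) (hL : 1 ≤ κ * L ^ 2) {K : Set (EuclideanSpace ℝ (Fin n))}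
    (hK : IsCompact K) (hKc : Convex ℝ K) : ∃ C, 0 ≤ C ∧ ∀ ε : ℝ, 0 < ε → ∀ x ∈ K, ∀ y ∈ K,
      |D.commutator φ ε x y| ≤ C * ε * (ε ^ n)⁻¹ := by
  have hφ' : ContDiff ℝ ∞ (deriv φ) := (contDiff_infty_iff_deriv.1 hφ.contDiff).2
  have hφ'' : ContDiff ℝ ∞ (deriv (deriv φ)) := (contDiff_infty_iff_deriv.1 hφ').2
  obtain ⟨C₀, hC₀, hφ₀⟩ := exists_forall_abs_le hφ.contDiff.continuous hφ.hasCompactSupport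
  obtain ⟨C₁, hC₁, hφ₁⟩ := exists_forall_abs_le hφ'.continuous hφ.hasCompactSupport.deriv
  obtain ⟨C₂, hC₂, hφ₂⟩ := exists_forall_abs_le hφ''.continuous hφ.hasCompactSupport.deriv.deriv
  have hc1 := isBigO_comp_fst hK D.contDiff_c
  have hc2 := isBigO_comp_snd hK D.contDiff_c
  have b0 : (fun w : EuclideanSpace ℝ (Fin n) × EuclideanSpace ℝ (Fin n) =>
      D.c w.2 * divForm D.a D.c w.1 - D.c w.1 * divForm D.a D.c w.2)
      =O[𝓟 (K ×ˢ K)] fun w => gap w ^ 1 := by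
    have hd := contDiff_divForm D.contDiff_a D.contDiff_c
    refine ((isBigO_mul_gap (p := 0) (q := 1) hc2 (isBigO_sub hK hKc hd)).sub
      (isBigO_mul_gap (p := 0) (q := 1) (isBigO_comp_snd hK hd)
        (isBigO_sub hK hKc D.contDiff_c))).congr_left fun w => ?_
    ring
  have b1 := isBigO_mul_gap (p := 0) (q := 3) (isBigO_mul_gap (p := 0) (q := 0) hc1 hc2)
    (D.isBigO_transport hK hKc)
  have b2 := isBigO_mul_gap (p := 0) (q := 5) (isBigO_mul_gap (p := 0) (q := 0) hc1 hc2)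
    (D.isBigO_eikonal hK hKc)
  obtain ⟨B₀, hB₀, hb₀⟩ := b0.exists_nonneg
  obtain ⟨B₁, hB₁, hb₁⟩ := b1.exists_nonneg
  obtain ⟨B₂, hB₂, hb₂⟩ := b2.exists_nonneg
  rw [isBigOWith_principal] at hb₀ hb₁ hb₂
  refine ⟨C₀ * (B₀ * L) + C₁ * (B₁ * L ^ 3) + C₂ * (B₂ * L ^ 5), by positivity,
    fun ε hε x hx y hy => ?_⟩
  rcases le_or_gt (L * ε) ‖x - y‖ with hxy | hxy
  · rw [D.commutator_eq_zero hφ hκ hL0 hL hκ0 hε hxy, abs_zero]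
    positivity
  have h0 := hb₀ (x, y) ⟨hx, hy⟩
  have h1 := hb₁ (x, y) ⟨hx, hy⟩
  have h2 := hb₂ (x, y) ⟨hx, hy⟩
  simp only [gap, norm_pow, zero_add, pow_one, Real.norm_eq_abs, abs_norm] at h0 h1 h2
  have g0 : B₀ * ‖x - y‖ ≤ B₀ * (L * ε) := by gcongr
  have g1 : B₁ * ‖x - y‖ ^ 3 ≤ B₁ * (L * ε) ^ 3 := by gcongr
  have g2 : B₂ * ‖x - y‖ ^ 5 ≤ B₂ * (L * ε) ^ 5 := by gcongr
  rw [D.commutator_eq hφ.contDiff, abs_mul, abs_of_pos (by positivity : (0 : ℝ) < (ε ^ n)⁻¹),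
    mul_comm]
  refine mul_le_mul_of_nonneg_right ?_ (by positivity)
  refine (abs_add_le _ _).trans ((add_le_add (abs_add_le _ _) le_rfl).trans ?_)
  rw [abs_mul, abs_mul _ (D.c x * D.c y * _), abs_mul _ (D.c x * D.c y * _), abs_mul (ε ^ 2)⁻¹,
    abs_mul ((ε ^ 2)⁻¹ ^ 2), abs_of_pos (by positivity : (0 : ℝ) < (ε ^ 2)⁻¹),
    abs_of_pos (by positivity : (0 : ℝ) < (ε ^ 2)⁻¹ ^ 2)]
  have e : (C₀ * (B₀ * L) + C₁ * (B₁ * L ^ 3) + C₂ * (B₂ * L ^ 5)) * ε =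
      C₀ * (B₀ * (L * ε)) + (ε ^ 2)⁻¹ * C₁ * (B₁ * (L * ε) ^ 3) +
        (ε ^ 2)⁻¹ ^ 2 * C₂ * (B₂ * (L * ε) ^ 5) := by
    field_simp
  rw [e]
  gcongr
  · exact hφ₀ _
  · exact h0.trans g0
  · exact hφ₁ _
  · exact h1.trans g1
  · exact hφ₂ _
  · exact h2.trans g2

end KernelData

end Kernel
end RiemannianSchrodinger

/-! ### Integral operators near the diagonal -/

namespace RiemannianSchrodinger

section Mollification

open Filter Topology Matrix

variable {n : ℕ}

/-- The integral operator with kernel `m`. -/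
noncomputable def integralOp (m : EuclideanSpace ℝ (Fin n) → EuclideanSpace ℝ (Fin n) → ℝ)
    (h : EuclideanSpace ℝ (Fin n) → ℝ) (x : EuclideanSpace ℝ (Fin n)) : ℝ :=
  ∫ y, m x y * h y

/-- Continuous kernels supported in the `r`-neighbourhood of the diagonal. -/
structure IsNearDiagonal (r : ℝ) (m : EuclideanSpace ℝ (Fin n) → EuclideanSpace ℝ (Fin n) → ℝ) :
    Prop where
  continuous : Continuous fun w : EuclideanSpace ℝ (Fin n) × EuclideanSpace ℝ (Fin n) => m w.1 w.2
  eq_zero : ∀ x y, r < ‖x - y‖ → m x y = 0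

variable {m : EuclideanSpace ℝ (Fin n) → EuclideanSpace ℝ (Fin n) → ℝ} {r : ℝ}
  {h ξ : EuclideanSpace ℝ (Fin n) → ℝ} {K : Set (EuclideanSpace ℝ (Fin n))}

theorem IsNearDiagonal.exists_bound (hm : IsNearDiagonal r m) (hK : IsCompact K) :
    ∃ B, 0 ≤ B ∧ ∀ x ∈ K, ∀ y, |m x y| ≤ B := by
  obtain ⟨B, hB⟩ := (hK.prod (hK.cthickening (r := r))).exists_bound_of_continuousOn
    hm.continuous.continuousOn
  refine ⟨max B 0, le_max_right _ _, fun x hx y => ?_⟩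
  rcases le_or_gt ‖x - y‖ r with h | h
  · refine (hB (x, y) ⟨hx, ?_⟩).trans (le_max_left _ _)
    refine Metric.mem_cthickening_of_dist_le y x r K hx ?_
    rwa [dist_comm, dist_eq_norm]
  · rw [hm.eq_zero x y h, abs_zero]
    exact le_max_right _ _

theorem IsNearDiagonal.integrable_prod (hm : IsNearDiagonal r m) (hξ : Continuous ξ)
    (hc : HasCompactSupport ξ) (hh : Integrable h) :
    Integrable (fun w : EuclideanSpace ℝ (Fin n) × EuclideanSpace ℝ (Fin n) =>
      ξ w.1 * (m w.1 w.2 * h w.2)) (volume.prod volume) := by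
  obtain ⟨B, hB0, hB⟩ := hm.exists_bound hc
  refine (((hξ.integrable_of_hasCompactSupport hc).mul_prod hh).const_mul B).mono ?_
    (Eventually.of_forall fun w => ?_)
  · exact (hξ.comp continuous_fst).aestronglyMeasurable.mul
      (hm.continuous.aestronglyMeasurable.mul hh.1.comp_snd)
  · by_cases hw : w.1 ∈ tsupport ξ
    · simp only [norm_mul, Real.norm_eq_abs, abs_of_nonneg hB0]
      calc |ξ w.1| * (|m w.1 w.2| * |h w.2|) ≤ |ξ w.1| * (B * |h w.2|) := by
            gcongr
            exact hB _ hw _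
        _ = B * (|ξ w.1| * |h w.2|) := by ring
    · simp [image_eq_zero_of_notMem_tsupport hw]

/-- The transpose of an integral operator, by Fubini. -/
theorem IsNearDiagonal.integral_mul_integralOp (hm : IsNearDiagonal r m) (hξ : Continuous ξ)
    (hc : HasCompactSupport ξ) (hh : Integrable h) :
    ∫ x, ξ x * integralOp m h x = ∫ y, h y * ∫ x, ξ x * m x y := by
  have h1 := integral_integral_swap (f := fun x y => ξ x * (m x y * h y))
    (hm.integrable_prod hξ hc hh)
  simp only [integral_const_mul] at h1
  refine h1.trans (integral_congr_ae (Eventually.of_forall fun y => ?_))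
  simp only [← integral_const_mul]
  exact integral_congr_ae (Eventually.of_forall fun x => by ring)

theorem IsNearDiagonal.integrable_kernel_mul (hm : IsNearDiagonal r m) (hh : Integrable h)
    (x : EuclideanSpace ℝ (Fin n)) : Integrable fun y => m x y * h y := by
  obtain ⟨B, hB0, hB⟩ := hm.exists_bound (isCompact_singleton (x := x))
  exact hh.bdd_mul (c := B) (hm.continuous.comp (by fun_prop :
    Continuous fun y => (x, y))).aestronglyMeasurable (Eventually.of_forall fun y => hB x rfl y)

theorem IsNearDiagonal.continuous_integralOp (hm : IsNearDiagonal r m) (hh : Integrable h) :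
    Continuous (integralOp m h) := by
  refine continuous_iff_continuousAt.2 fun x₀ => ?_
  obtain ⟨B, hB0, hB⟩ := hm.exists_bound (isCompact_closedBall x₀ 1)
  refine continuousAt_of_dominated (bound := fun y => B * |h y|) ?_ ?_ (hh.abs.const_mul B) ?_
  · exact Eventually.of_forall fun x => (hm.integrable_kernel_mul hh x).1
  · filter_upwards [Metric.closedBall_mem_nhds x₀ one_pos] with x hx
    refine Eventually.of_forall fun y => ?_
    rw [norm_mul]
    exact mul_le_mul_of_nonneg_right (hB x hx y) (abs_nonneg _)
  · exact Eventually.of_forall fun y => ((hm.continuous.comp (by fun_prop :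
      Continuous fun x => (x, y))).mul continuous_const).continuousAt

/-- The `L¹` bound for kernels near the diagonal, by Tonelli. -/
theorem IsNearDiagonal.lintegral_integralOp_le (hm : IsNearDiagonal r m) (hK : MeasurableSet K)
    {B : ℝ} (hB : ∀ x ∈ K, ∀ y, |m x y| ≤ B)
    (hh : Integrable h) : ∫⁻ x in K, ‖integralOp m h x‖ₑ ≤
      ENNReal.ofReal B * volume (Metric.closedBall (0 : EuclideanSpace ℝ (Fin n)) r) *
        ∫⁻ y, ‖h y‖ₑ := by
  have hmeas : AEMeasurable (Function.uncurry fun x y => ‖m x y * h y‖ₑ)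
      ((volume.restrict K).prod volume) :=
    (hm.continuous.aestronglyMeasurable.mul hh.1.comp_snd).enorm
  calc ∫⁻ x in K, ‖integralOp m h x‖ₑ
      ≤ ∫⁻ x in K, ∫⁻ y, ‖m x y * h y‖ₑ := lintegral_mono fun x => enorm_integral_le_lintegral_enorm _
    _ = ∫⁻ y, ∫⁻ x in K, ‖m x y * h y‖ₑ := lintegral_lintegral_swap hmeas
    _ ≤ ∫⁻ y, (ENNReal.ofReal B *
          volume (Metric.closedBall (0 : EuclideanSpace ℝ (Fin n)) r)) * ‖h y‖ₑ := by
        refine lintegral_mono fun y => ?_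
        simp only [enorm_mul]
        rw [lintegral_mul_const' _ _ enorm_ne_top]
        gcongr
        calc ∫⁻ x in K, ‖m x y‖ₑ
            ≤ ∫⁻ x in K, (Metric.closedBall y r).indicator (fun _ => ENNReal.ofReal B) x := by
              refine setLIntegral_mono' hK fun x hx => ?_
              by_cases hxy : x ∈ Metric.closedBall y r
              · rw [Set.indicator_of_mem hxy, Real.enorm_eq_ofReal_abs]
                exact ENNReal.ofReal_le_ofReal (hB x hx y)
              · rw [hm.eq_zero x y (by simpa [dist_eq_norm] using hxy)]
                simp
          _ ≤ ∫⁻ x, (Metric.closedBall y r).indicator (fun _ => ENNReal.ofReal B) x :=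
              setLIntegral_le_lintegral _ _
          _ = ENNReal.ofReal B * volume (Metric.closedBall (0 : EuclideanSpace ℝ (Fin n)) r) := by
              rw [lintegral_indicator_const measurableSet_closedBall,
                Measure.addHaar_closedBall_center volume y r]
    _ = _ := lintegral_const_mul' _ _ (ENNReal.mul_ne_top ENNReal.ofReal_ne_top
        (measure_closedBall_lt_top).ne)

/-- The integral operator of a smooth kernel is smoothing; it is rewritten as a convolution with
parameter. -/
theorem contDiff_integralOp (hm : ContDiff ℝ ∞
      fun w : EuclideanSpace ℝ (Fin n) × EuclideanSpace ℝ (Fin n) => m w.1 w.2)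
    (hr : ∀ x y, r < ‖x - y‖ → m x y = 0) (hh : Integrable h) :
    ContDiff ℝ ∞ (integralOp m h) := by
  rw [← contDiffOn_univ]
  have := contDiffOn_convolution_right_with_param_comp (μ := volume) (n := ⊤)
    (ContinuousLinearMap.mul ℝ ℝ) (s := Set.univ) (v := id)
    (g := fun (x : EuclideanSpace ℝ (Fin n)) t => m x (x - t)) (f := h)
    (k := Metric.closedBall (0 : EuclideanSpace ℝ (Fin n)) r) contDiffOn_id isOpen_univ
    (isCompact_closedBall _ _) ?_ hh.locallyIntegrable ?_
  · refine this.congr fun x _ => ?_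
    simp [convolution, integralOp, mul_comm]
  · intro x t _ ht
    refine hr _ _ ?_
    simpa using ht
  · refine ContDiff.contDiffOn ?_
    exact hm.comp (contDiff_fst.prodMk (contDiff_fst.sub contDiff_snd))

end Mollification
end RiemannianSchrodinger

/-! ### The approximate identity -/

namespace RiemannianSchrodinger

section ApproximateIdentity

open Filter Topology Matrix

variable {n : ℕ}

/-- Kernel data with the normalization `c⁴ = det G` and a uniform ellipticity bound for `G`; `L`
bounds the distance from the diagonal at which the kernels with `ε = 1` vanish. -/
structure EllipticData (n : ℕ) extends KernelData n where
  /-- The lower ellipticity constant of `G`. -/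
  κ : ℝ
  /-- A radius with `κ L² ≥ 1`. -/
  L : ℝ
  c_pow : ∀ x, c x ^ 4 = (G x).det
  κ_pos : 0 < κ
  le_dotProduct : ∀ x (v : Fin n → ℝ), κ * (v ⬝ᵥ v) ≤ v ⬝ᵥ (G x *ᵥ v)
  L_pos : 0 < L
  one_le : 1 ≤ κ * L ^ 2

/-- The integral of a positive definite Gaussian-type profile, by the substitution with the square
root of the matrix. -/
theorem sqrt_det_mul_integral_comp_quadForm {A : Matrix (Fin n) (Fin n) ℝ} (hA : A.PosDef)
    (φ : ℝ → ℝ) : √A.det * ∫ v : EuclideanSpace ℝ (Fin n), φ (v.ofLp ⬝ᵥ (A *ᵥ v.ofLp)) =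
      ∫ v : EuclideanSpace ℝ (Fin n), φ (‖v‖ ^ 2) := by
  open scoped MatrixOrder in
  set B : Matrix (Fin n) (Fin n) ℝ := CFC.sqrt A with hB
  have hBB : B * B = A := CFC.sqrt_mul_sqrt_self A hA.posSemidef.nonneg
  have hBs : Bᵀ = B := by
    have := (CFC.sqrt_nonneg A).posSemidef.isHermitian
    rwa [IsHermitian, conjTranspose_eq_transpose_of_trivial] at this
  have hdet : B.det = √A.det := by
    have h := hA.posSemidef.det_sqrt
    rw [hB, h, RCLike.sqrt_of_nonneg hA.posSemidef.det_nonneg]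
    simp
  have hpos : 0 < √A.det := Real.sqrt_pos.2 hA.det_pos
  have hlin : LinearMap.det (toLpLin 2 2 B) = √A.det := by rw [LinearMap.det_toLpLin, hdet]
  have hmap := Measure.map_linearMap_addHaar_eq_smul_addHaar
    (volume : Measure (EuclideanSpace ℝ (Fin n))) (f := toLpLin 2 2 B) (by rw [hlin]; exact hpos.ne')
  have hnorm : ∀ v : EuclideanSpace ℝ (Fin n),
      v.ofLp ⬝ᵥ (A *ᵥ v.ofLp) = ‖toLpLin 2 2 B v‖ ^ 2 := fun v => by
    rw [EuclideanSpace.norm_sq_eq, ← hBB, ← mulVec_mulVec, dotProduct_mulVec, ← mulVec_transpose, hBs]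
    simp [dotProduct, sq, toLpLin_apply]
  have hemb : MeasurableEmbedding (toLpLin 2 2 B) := by
    exact ((toLpLin 2 2 B).equivOfDetNeZero
      (by rw [hlin]; exact hpos.ne')).toContinuousLinearEquiv.toHomeomorph.measurableEmbedding
  simp_rw [hnorm]
  rw [← hemb.integral_map (fun w => φ (‖w‖ ^ 2)), hmap, integral_smul_measure, hlin,
    ENNReal.toReal_ofReal (abs_nonneg _), abs_of_pos (inv_pos.2 hpos), smul_eq_mul,
    mul_inv_cancel_left₀ hpos.ne']

namespace EllipticData

variable (D : EllipticData n) {φ : ℝ → ℝ} {ε : ℝ}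

theorem posDef_G (x : EuclideanSpace ℝ (Fin n)) : (D.G x).PosDef := by
  refine PosDef.of_dotProduct_mulVec_pos ?_ fun v hv => ?_
  · rw [IsHermitian, conjTranspose_eq_transpose_of_trivial]
    exact D.symm_G x
  · have : 0 < v ⬝ᵥ v := by simpa using dotProduct_star_self_pos_iff.2 hv
    simpa using (mul_pos D.κ_pos this).trans_le (D.le_dotProduct x v)

theorem c_sq (x : EuclideanSpace ℝ (Fin n)) : D.c x ^ 2 = √(D.G x).det := by
  rw [← D.c_pow, show D.c x ^ 4 = (D.c x ^ 2) ^ 2 by ring, Real.sqrt_sq (sq_nonneg _)]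

/-- By the normalization of `c` the limit of the mass of the kernel at `x` does not depend on `x`. -/
theorem c_sq_mul_integral (φ : ℝ → ℝ) (x : EuclideanSpace ℝ (Fin n)) :
    D.c x ^ 2 * ∫ v : EuclideanSpace ℝ (Fin n), φ (v.ofLp ⬝ᵥ (D.G x *ᵥ v.ofLp)) =
      ∫ v : EuclideanSpace ℝ (Fin n), φ (‖v‖ ^ 2) := by
  rw [D.c_sq, sqrt_det_mul_integral_comp_quadForm (D.posDef_G x)]

theorem isNearDiagonal_kernel (hφ : IsProfile φ) (hε : 0 < ε) :
    IsNearDiagonal (D.L * ε) (D.kernel φ ε) where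
  continuous := (D.contDiff_kernel hφ.contDiff ε).continuous
  eq_zero _ _ h := D.kernel_eq_zero hφ D.le_dotProduct D.L_pos.le D.one_le D.κ_pos.le hε h.le

theorem isNearDiagonal_commutator (hφ : IsProfile φ) (hε : 0 < ε) :
    IsNearDiagonal (D.L * ε) (D.commutator φ ε) where
  continuous := D.continuous_commutator hφ.contDiff ε
  eq_zero _ _ h := D.commutator_eq_zero hφ D.le_dotProduct D.L_pos.le D.one_le D.κ_pos.le hε h.le

/-- The rescaled form of the mollification. -/
theorem integralOp_kernel_eq (hε : 0 < ε) (h : EuclideanSpace ℝ (Fin n) → ℝ)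
    (x : EuclideanSpace ℝ (Fin n)) :
    integralOp (D.kernel φ ε) h x = ∫ v : EuclideanSpace ℝ (Fin n), D.c x * D.c (x + ε • v) *
      φ (quad D.G x (x + ε • v) * (ε ^ 2)⁻¹) * h (x + ε • v) := by
  have h1 := Measure.integral_comp_smul (volume : Measure (EuclideanSpace ℝ (Fin n)))
    (fun y => D.c x * D.c (x + y) * φ (quad D.G x (x + y) * (ε ^ 2)⁻¹) * h (x + y)) ε
  rw [h1, integral_add_left_eq_self
    (fun y => D.c x * D.c y * φ (quad D.G x y * (ε ^ 2)⁻¹) * h y), finrank_euclideanSpace,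
    Fintype.card_fin, abs_of_pos (by positivity), smul_eq_mul, ← integral_const_mul, integralOp]
  refine integral_congr_ae (Eventually.of_forall fun y => ?_)
  simp only [KernelData.kernel]
  ring

theorem quad_add_smul (hε : ε ≠ 0) (x v : EuclideanSpace ℝ (Fin n)) :
    quad D.G x (x + ε • v) * (ε ^ 2)⁻¹ =
      (1 / 2) * ((v.ofLp ⬝ᵥ (D.G x *ᵥ v.ofLp)) +
        v.ofLp ⬝ᵥ (D.G (x + ε • v) *ᵥ v.ofLp)) := by
  simp only [quad, dotProduct, mulVec, Finset.mul_sum, ← Finset.sum_add_distrib, Finset.sum_mul]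
  refine Finset.sum_congr rfl fun i _ => Finset.sum_congr rfl fun j _ => ?_
  simp only [PiLp.add_apply, PiLp.smul_apply, smul_eq_mul]
  field_simp
  ring

/-- The integrand of the rescaled mollification is bounded, and vanishes for `‖v‖ ≥ L`,
uniformly in `ε ∈ (0, 1]`. -/
theorem exists_integrand_bound (hφ : IsProfile φ) {K : Set (EuclideanSpace ℝ (Fin n))}
    (hK : IsCompact K) {h : EuclideanSpace ℝ (Fin n) → ℝ} (hh : Continuous h) :
    ∃ C, 0 ≤ C ∧ ∀ ε : ℝ, 0 < ε → ε ≤ 1 → ∀ x ∈ K, ∀ v : EuclideanSpace ℝ (Fin n),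
      ‖D.c x * D.c (x + ε • v) * φ (quad D.G x (x + ε • v) * (ε ^ 2)⁻¹) * h (x + ε • v)‖ ≤
        (Metric.closedBall (0 : EuclideanSpace ℝ (Fin n)) D.L).indicator (fun _ => C) v := by
  obtain ⟨C₀, hC₀, hφ₀⟩ := KernelData.exists_forall_abs_le hφ.contDiff.continuous hφ.hasCompactSupport
  have hK' := hK.cthickening (r := D.L)
  obtain ⟨C₁, hC₁⟩ := hK'.exists_bound_of_continuousOn D.contDiff_c.continuous.continuousOn
  obtain ⟨C₂, hC₂⟩ := hK'.exists_bound_of_continuousOn hh.continuousOn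
  refine ⟨|C₁| * |C₁| * C₀ * |C₂|, by positivity, fun ε hε hε1 x hx v => ?_⟩
  by_cases hv : v ∈ Metric.closedBall (0 : EuclideanSpace ℝ (Fin n)) D.L
  · have hv' : ‖v‖ ≤ D.L := by simpa using hv
    have hy : x + ε • v ∈ Metric.cthickening D.L K := by
      refine Metric.mem_cthickening_of_dist_le _ x _ K hx ?_
      rw [dist_eq_norm, add_sub_cancel_left, norm_smul, Real.norm_of_nonneg hε.le]
      calc ε * ‖v‖ ≤ 1 * D.L := by gcongr
        _ = D.L := one_mul _
    have hx' : x ∈ Metric.cthickening D.L K := Metric.self_subset_cthickening K hx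
    rw [Set.indicator_of_mem hv, norm_mul, norm_mul, norm_mul]
    gcongr
    · exact (hC₁ x hx').trans (le_abs_self _)
    · exact (hC₁ _ hy).trans (le_abs_self _)
    · exact hφ₀ _
    · exact (hC₂ _ hy).trans (le_abs_self _)
  · have hv' : D.L < ‖v‖ := by simpa using hv
    have h1 := D.one_le_quad_mul D.le_dotProduct D.L_pos.le D.one_le D.κ_pos.le hε
      (x := x) (y := x + ε • v) (by
        rw [norm_sub_rev, add_sub_cancel_left, norm_smul, Real.norm_of_nonneg hε.le, mul_comm]
        gcongr)
    rw [hφ.eq_zero _ (by linarith), Set.indicator_of_notMem hv]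
    simp

theorem continuous_dotProduct_mulVec : Continuous
    fun w : EuclideanSpace ℝ (Fin n) × EuclideanSpace ℝ (Fin n) =>
      w.2.ofLp ⬝ᵥ (D.G w.1 *ᵥ w.2.ofLp) := by
  simp only [dotProduct, mulVec]
  have h := fun i j => (D.contDiff_G i j).continuous
  fun_prop

theorem integrable_indicator_closedBall (r C : ℝ) : Integrable
    ((Metric.closedBall (0 : EuclideanSpace ℝ (Fin n)) r).indicator fun _ => C) :=
  (integrableOn_const (measure_closedBall_lt_top).ne).integrable_indicator
    measurableSet_closedBall

/-- For continuous functions the mollifications converge at each point. -/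
theorem tendsto_integralOp_kernel (hφ : IsProfile φ) {h : EuclideanSpace ℝ (Fin n) → ℝ}
    (hh : Continuous h) (x : EuclideanSpace ℝ (Fin n)) :
    Tendsto (fun ε => integralOp (D.kernel φ ε) h x) (𝓝[>] 0)
      (𝓝 ((∫ v : EuclideanSpace ℝ (Fin n), φ (‖v‖ ^ 2)) * h x)) := by
  obtain ⟨C, hC0, hC⟩ := D.exists_integrand_bound hφ (isCompact_singleton (x := x)) hh
  have hG := D.continuous_dotProduct_mulVec
  have hc := D.contDiff_c.continuous
  have hφc := hφ.contDiff.continuous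
  have key : Tendsto (fun ε : ℝ => ∫ v : EuclideanSpace ℝ (Fin n), D.c x * D.c (x + ε • v) *
      φ ((1 / 2) * ((v.ofLp ⬝ᵥ (D.G x *ᵥ v.ofLp)) +
        v.ofLp ⬝ᵥ (D.G (x + ε • v) *ᵥ v.ofLp))) * h (x + ε • v)) (𝓝[>] 0)
      (𝓝 (∫ v : EuclideanSpace ℝ (Fin n), D.c x * D.c x *
        φ (v.ofLp ⬝ᵥ (D.G x *ᵥ v.ofLp)) * h x)) := by
    have hcont : Continuous fun w : ℝ × EuclideanSpace ℝ (Fin n) =>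
        D.c x * D.c (x + w.1 • w.2) * φ ((1 / 2) * ((w.2.ofLp ⬝ᵥ (D.G x *ᵥ w.2.ofLp)) +
        w.2.ofLp ⬝ᵥ (D.G (x + w.1 • w.2) *ᵥ w.2.ofLp))) * h (x + w.1 • w.2) := by
      have e1 : Continuous fun w : ℝ × EuclideanSpace ℝ (Fin n) =>
          w.2.ofLp ⬝ᵥ (D.G x *ᵥ w.2.ofLp) :=
        hG.comp (f := fun w : ℝ × EuclideanSpace ℝ (Fin n) => (x, w.2)) (by fun_prop)
      have e2 : Continuous fun w : ℝ × EuclideanSpace ℝ (Fin n) =>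
          w.2.ofLp ⬝ᵥ (D.G (x + w.1 • w.2) *ᵥ w.2.ofLp) :=
        hG.comp (f := fun w : ℝ × EuclideanSpace ℝ (Fin n) => (x + w.1 • w.2, w.2)) (by fun_prop)
      fun_prop
    refine tendsto_integral_filter_of_dominated_convergence _ ?_ ?_
      (integrable_indicator_closedBall D.L C) ?_
    · exact Eventually.of_forall fun ε => (hcont.comp (by fun_prop :
        Continuous fun v : EuclideanSpace ℝ (Fin n) => (ε, v))).aestronglyMeasurable
    · filter_upwards [Ioc_mem_nhdsGT one_pos] with ε hε
      refine Eventually.of_forall fun v => ?_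
      rw [← D.quad_add_smul hε.1.ne']
      exact hC ε hε.1 hε.2 x rfl v
    · refine Eventually.of_forall fun v => ?_
      have := ((hcont.comp (by fun_prop : Continuous fun ε : ℝ => (ε, v))).tendsto 0).mono_left
        (nhdsWithin_le_nhds (s := Set.Ioi 0))
      simp only [Function.comp_def, zero_smul, add_zero] at this
      rw [show (1 / 2 : ℝ) * ((v.ofLp ⬝ᵥ (D.G x *ᵥ v.ofLp)) + v.ofLp ⬝ᵥ (D.G x *ᵥ v.ofLp)) =
        v.ofLp ⬝ᵥ (D.G x *ᵥ v.ofLp) by ring] at this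
      exact this
  rw [integral_mul_const, integral_const_mul, ← sq, D.c_sq_mul_integral] at key
  refine key.congr' ?_
  filter_upwards [self_mem_nhdsWithin] with ε hε
  rw [D.integralOp_kernel_eq hε]
  simp only [D.quad_add_smul (ne_of_gt hε)]

theorem exists_abs_integralOp_kernel_le (hφ : IsProfile φ) {K : Set (EuclideanSpace ℝ (Fin n))}
    (hK : IsCompact K) {h : EuclideanSpace ℝ (Fin n) → ℝ} (hh : Continuous h) :
    ∃ C, ∀ ε : ℝ, 0 < ε → ε ≤ 1 → ∀ x ∈ K, |integralOp (D.kernel φ ε) h x| ≤ C := by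
  obtain ⟨C, hC0, hC⟩ := D.exists_integrand_bound hφ hK hh
  refine ⟨∫ v, (Metric.closedBall (0 : EuclideanSpace ℝ (Fin n)) D.L).indicator (fun _ => C) v,
    fun ε hε hε1 x hx => ?_⟩
  rw [D.integralOp_kernel_eq hε]
  exact norm_integral_le_of_norm_le (integrable_indicator_closedBall D.L C)
    (Eventually.of_forall (hC ε hε hε1 x hx))

theorem measure_closedBall_mul (hε : 0 ≤ ε) :
    volume (Metric.closedBall (0 : EuclideanSpace ℝ (Fin n)) (D.L * ε)) =
      ENNReal.ofReal (ε ^ n) * volume (Metric.closedBall (0 : EuclideanSpace ℝ (Fin n)) D.L) := by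
  rw [mul_comm, Measure.addHaar_closedBall_mul _ _ hε D.L_pos.le, finrank_euclideanSpace,
    Fintype.card_fin]

/-- The mollifications are bounded from `L¹` to `L¹_loc`, uniformly in `ε ∈ (0, 1]`. -/
theorem exists_lintegral_integralOp_kernel_le (hφ : IsProfile φ)
    {K : Set (EuclideanSpace ℝ (Fin n))} (hK : IsCompact K) :
    ∃ C : ENNReal, C ≠ ⊤ ∧ ∀ ε : ℝ, 0 < ε → ε ≤ 1 → ∀ h : EuclideanSpace ℝ (Fin n) → ℝ,
      Integrable h → ∫⁻ x in K, ‖integralOp (D.kernel φ ε) h x‖ₑ ≤ C * ∫⁻ x, ‖h x‖ₑ := by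
  obtain ⟨C, hC0, hC⟩ := D.exists_kernel_bound hφ (hK.cthickening (r := D.L))
  refine ⟨ENNReal.ofReal C * volume (Metric.closedBall (0 : EuclideanSpace ℝ (Fin n)) D.L),
    ENNReal.mul_ne_top ENNReal.ofReal_ne_top measure_closedBall_lt_top.ne,
    fun ε hε hε1 h hh => ?_⟩
  have hB : ∀ x ∈ K, ∀ y, |D.kernel φ ε x y| ≤ C * (ε ^ n)⁻¹ := fun x hx y => by
    rcases le_or_gt (D.L * ε) ‖x - y‖ with hxy | hxy
    · rw [D.kernel_eq_zero hφ D.le_dotProduct D.L_pos.le D.one_le D.κ_pos.le hε hxy, abs_zero]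
      positivity
    · refine hC ε hε x (Metric.self_subset_cthickening K hx) y ?_
      refine Metric.mem_cthickening_of_dist_le _ x _ K hx ?_
      rw [dist_comm, dist_eq_norm]
      calc ‖x - y‖ ≤ D.L * ε := hxy.le
        _ ≤ D.L * 1 := by have := D.L_pos; gcongr
        _ = D.L := mul_one _
  refine ((D.isNearDiagonal_kernel hφ hε).lintegral_integralOp_le hK.measurableSet hB hh).trans
    (le_of_eq ?_)
  rw [D.measure_closedBall_mul hε.le, ← mul_assoc, ← ENNReal.ofReal_mul (by positivity),
    inv_mul_cancel_right₀ (by positivity)]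

theorem exists_lintegral_integralOp_commutator_le (hφ : IsProfile φ)
    {K : Set (EuclideanSpace ℝ (Fin n))} (hK : IsCompact K) :
    ∃ C : ℝ, 0 ≤ C ∧ ∀ ε : ℝ, 0 < ε → ε ≤ 1 → ∀ h : EuclideanSpace ℝ (Fin n) → ℝ,
      Integrable h → ∫⁻ x in K, ‖integralOp (D.commutator φ ε) h x‖ₑ ≤
        ENNReal.ofReal (C * ε) * (volume (Metric.closedBall (0 : EuclideanSpace ℝ (Fin n)) D.L) *
          ∫⁻ x, ‖h x‖ₑ) := by
  obtain ⟨R, hR⟩ := (hK.cthickening (r := D.L)).isBounded.subset_closedBall 0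
  obtain ⟨C, hC0, hC⟩ := D.exists_commutator_bound hφ D.le_dotProduct D.κ_pos.le D.L_pos.le
    D.one_le (isCompact_closedBall 0 R) (convex_closedBall 0 R)
  refine ⟨C, hC0, fun ε hε hε1 h hh => ?_⟩
  have hB : ∀ x ∈ K, ∀ y, |D.commutator φ ε x y| ≤ C * ε * (ε ^ n)⁻¹ := fun x hx y => by
    rcases le_or_gt (D.L * ε) ‖x - y‖ with hxy | hxy
    · rw [D.commutator_eq_zero hφ D.le_dotProduct D.L_pos.le D.one_le D.κ_pos.le hε hxy, abs_zero]
      positivity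
    · refine hC ε hε x (hR (Metric.self_subset_cthickening K hx)) y (hR ?_)
      refine Metric.mem_cthickening_of_dist_le _ x _ K hx ?_
      rw [dist_comm, dist_eq_norm]
      calc ‖x - y‖ ≤ D.L * ε := hxy.le
        _ ≤ D.L * 1 := by have := D.L_pos; gcongr
        _ = D.L := mul_one _
  refine ((D.isNearDiagonal_commutator hφ hε).lintegral_integralOp_le hK.measurableSet hB
    hh).trans (le_of_eq ?_)
  rw [D.measure_closedBall_mul hε.le, ← mul_assoc, ← ENNReal.ofReal_mul (by positivity),
    inv_mul_cancel_right₀ (by positivity), mul_assoc]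

/-- The commutator of the operator with the mollification tends to zero from `L¹` to `L¹_loc`. -/
theorem tendsto_lintegral_integralOp_commutator (hφ : IsProfile φ)
    {K : Set (EuclideanSpace ℝ (Fin n))} (hK : IsCompact K) {h : EuclideanSpace ℝ (Fin n) → ℝ}
    (hh : Integrable h) : Tendsto (fun ε => ∫⁻ x in K, ‖integralOp (D.commutator φ ε) h x‖ₑ)
      (𝓝[>] 0) (𝓝 0) := by
  obtain ⟨C, hC0, hC⟩ := D.exists_lintegral_integralOp_commutator_le hφ hK
  have h1 : Tendsto (fun ε : ℝ => ENNReal.ofReal (C * ε) *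
      (volume (Metric.closedBall (0 : EuclideanSpace ℝ (Fin n)) D.L) * ∫⁻ x, ‖h x‖ₑ))
      (𝓝[>] 0) (𝓝 0) := by
    have h2 : Tendsto (fun ε : ℝ => ENNReal.ofReal (C * ε)) (𝓝[>] 0) (𝓝 0) := by
      have : Tendsto (fun ε : ℝ => C * ε) (𝓝[>] 0) (𝓝 (C * 0)) :=
        ((continuous_const.mul continuous_id).tendsto 0).mono_left nhdsWithin_le_nhds
      simpa using ENNReal.tendsto_ofReal this
    have := ENNReal.Tendsto.mul_const h2 (b := volume (Metric.closedBall
      (0 : EuclideanSpace ℝ (Fin n)) D.L) * ∫⁻ x, ‖h x‖ₑ)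
      (Or.inr (ENNReal.mul_ne_top measure_closedBall_lt_top.ne hh.2.ne))
    simpa using this
  refine tendsto_of_tendsto_of_tendsto_of_le_of_le' tendsto_const_nhds h1
    (Eventually.of_forall fun _ => zero_le) ?_
  filter_upwards [Ioc_mem_nhdsGT one_pos] with ε hε
  exact hC ε hε.1 hε.2 h hh

/-- The mollifications form an approximate identity in `L¹_loc`. -/
theorem tendsto_lintegral_integralOp_kernel_sub (hφ : IsProfile φ)
    (hφ1 : ∫ v : EuclideanSpace ℝ (Fin n), φ (‖v‖ ^ 2) = 1)
    {K : Set (EuclideanSpace ℝ (Fin n))} (hK : IsCompact K) {h : EuclideanSpace ℝ (Fin n) → ℝ}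
    (hh : Integrable h) : Tendsto (fun ε => ∫⁻ x in K, ‖integralOp (D.kernel φ ε) h x - h x‖ₑ)
      (𝓝[>] 0) (𝓝 0) := by
  obtain ⟨C, hC, hCle⟩ := D.exists_lintegral_integralOp_kernel_le hφ hK
  have hcont : ∀ f : EuclideanSpace ℝ (Fin n) → ℝ, Continuous f → Integrable f →
      Tendsto (fun ε => ∫⁻ x in K, ‖integralOp (D.kernel φ ε) f x - f x‖ₑ) (𝓝[>] 0) (𝓝 0) := by
    intro f hf hfi
    obtain ⟨B, hB⟩ := D.exists_abs_integralOp_kernel_le hφ hK hf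
    obtain ⟨B', hB'⟩ := hK.exists_bound_of_continuousOn hf.continuousOn
    have := tendsto_lintegral_filter_of_dominated_convergence (μ := volume.restrict K)
      (l := 𝓝[>] (0 : ℝ)) (F := fun ε x => ‖integralOp (D.kernel φ ε) f x - f x‖ₑ)
      (f := fun _ => 0) (fun _ => ENNReal.ofReal (B + B')) ?_ ?_ ?_ ?_
    · simpa using this
    · filter_upwards [self_mem_nhdsWithin] with ε hε
      exact (((D.isNearDiagonal_kernel hφ hε).continuous_integralOp hfi).sub hf).measurable.enorm
    · filter_upwards [Ioc_mem_nhdsGT one_pos] with ε hε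
      filter_upwards [ae_restrict_mem hK.measurableSet] with x hx
      rw [Real.enorm_eq_ofReal_abs]
      exact ENNReal.ofReal_le_ofReal ((abs_sub _ _).trans
        (add_le_add (hB ε hε.1 hε.2 x hx) (hB' x hx)))
    · simp only [lintegral_const, Measure.restrict_apply_univ]
      exact ENNReal.mul_ne_top ENNReal.ofReal_ne_top hK.measure_lt_top.ne
    · refine Eventually.of_forall fun x => ?_
      have := (D.tendsto_integralOp_kernel hφ hf x).sub_const (f x)
      rw [hφ1, one_mul, sub_self] at this
      simpa [Function.comp_def] using (continuous_enorm.tendsto (0 : ℝ)).comp this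
  refine ENNReal.tendsto_nhds_zero.2 fun η hη => ?_
  -- `h` is approximated by a continuous function `f` up to `δ` in `L¹`.
  obtain ⟨δ, hδ, hδη⟩ : ∃ δ : ENNReal, δ ≠ 0 ∧ C * δ + δ + δ ≤ η := by
    rcases eq_or_ne η ⊤ with rfl | hη'
    · exact ⟨1, one_ne_zero, le_top⟩
    · refine ⟨η / (C + 2), ?_, ?_⟩
      · exact (ENNReal.div_pos hη.ne' (ENNReal.add_ne_top.2 ⟨hC, by simp⟩)).ne'
      · rw [show C * (η / (C + 2)) + η / (C + 2) + η / (C + 2) = (C + 2) * (η / (C + 2)) by ring]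
        exact ENNReal.mul_div_le
  obtain ⟨f, hfc, hfle, hf, hfi⟩ := hh.exists_hasCompactSupport_lintegral_sub_le hδ
  filter_upwards [ENNReal.tendsto_nhds_zero.1 (hcont f hf hfi) δ (pos_iff_ne_zero.2 hδ),
    Ioc_mem_nhdsGT one_pos] with ε hε hε1
  have hlin : ∀ x, integralOp (D.kernel φ ε) h x - h x = integralOp (D.kernel φ ε) (h - f) x +
      ((integralOp (D.kernel φ ε) f x - f x) + (f x - h x)) := fun x => by
    have : integralOp (D.kernel φ ε) (h - f) x =
        integralOp (D.kernel φ ε) h x - integralOp (D.kernel φ ε) f x := by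
      simp only [integralOp, Pi.sub_apply, mul_sub]
      exact integral_sub ((D.isNearDiagonal_kernel hφ hε1.1).integrable_kernel_mul hh x)
        ((D.isNearDiagonal_kernel hφ hε1.1).integrable_kernel_mul hfi x)
    rw [this]; ring
  have hcont1 := (D.isNearDiagonal_kernel hφ hε1.1).continuous_integralOp (hh.sub hfi)
  have hcont2 : Continuous fun x => integralOp (D.kernel φ ε) f x - f x :=
    ((D.isNearDiagonal_kernel hφ hε1.1).continuous_integralOp hfi).sub hf
  calc ∫⁻ x in K, ‖integralOp (D.kernel φ ε) h x - h x‖ₑ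
      ≤ ∫⁻ x in K, (‖integralOp (D.kernel φ ε) (h - f) x‖ₑ +
          (‖integralOp (D.kernel φ ε) f x - f x‖ₑ + ‖h x - f x‖ₑ)) := by
        refine lintegral_mono fun x => ?_
        simp only []
        rw [hlin x]
        refine (enorm_add_le _ _).trans (add_le_add le_rfl ((enorm_add_le _ _).trans
          (add_le_add le_rfl ?_)))
        rw [← enorm_neg, neg_sub]
    _ = (∫⁻ x in K, ‖integralOp (D.kernel φ ε) (h - f) x‖ₑ) +
          ((∫⁻ x in K, ‖integralOp (D.kernel φ ε) f x - f x‖ₑ) + ∫⁻ x in K, ‖h x - f x‖ₑ) := by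
        rw [lintegral_add_left hcont1.measurable.enorm, lintegral_add_left hcont2.measurable.enorm]
    _ ≤ C * δ + (δ + δ) := by
        refine add_le_add ((hCle ε hε1.1 hε1.2 _ (hh.sub hfi)).trans ?_) (add_le_add hε ?_)
        · gcongr
          exact hfle
        · exact (setLIntegral_le_lintegral _ _).trans hfle
    _ ≤ η := by rwa [← add_assoc]

end EllipticData

end ApproximateIdentity
end RiemannianSchrodinger

/-! ### Kato's inequality for global coefficients -/

namespace RiemannianSchrodinger

section FlatKato

open Filter Topology Matrix

variable {n : ℕ}

theorem exists_isProfile (n : ℕ) : ∃ φ : ℝ → ℝ, IsProfile φ ∧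
    ∫ v : EuclideanSpace ℝ (Fin n), φ (‖v‖ ^ 2) = 1 := by
  let b : ContDiffBump (0 : ℝ) := ⟨1 / 4, 1 / 2, by norm_num, by norm_num⟩
  have hbc : Continuous fun v : EuclideanSpace ℝ (Fin n) => b (‖v‖ ^ 2) :=
    b.continuous.comp (by fun_prop)
  have hz : ∀ s : ℝ, 1 / 2 ≤ s → b s = 0 := fun s hs =>
    b.zero_of_le_dist (by rw [Real.dist_0_eq_abs]; exact hs.trans (le_abs_self s))
  have hcs : HasCompactSupport fun v : EuclideanSpace ℝ (Fin n) => b (‖v‖ ^ 2) := by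
    refine HasCompactSupport.intro (isCompact_closedBall (0 : EuclideanSpace ℝ (Fin n)) 1)
      fun v hv => hz _ ?_
    have : 1 < ‖v‖ := by simpa using hv
    nlinarith
  have hpos : 0 < ∫ v : EuclideanSpace ℝ (Fin n), b (‖v‖ ^ 2) := by
    refine hbc.integral_pos_of_hasCompactSupport_nonneg_nonzero hcs (fun v => b.nonneg) (x := 0) ?_
    have : b (‖(0 : EuclideanSpace ℝ (Fin n))‖ ^ 2) = 1 := by
      refine b.one_of_mem_closedBall ?_
      rw [norm_zero, zero_pow two_ne_zero]
      exact Metric.mem_closedBall_self b.rIn_pos.le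
    rw [this]; exact one_ne_zero
  refine ⟨fun s => (∫ v : EuclideanSpace ℝ (Fin n), b (‖v‖ ^ 2))⁻¹ * b s,
    ⟨contDiff_const.mul b.contDiff, b.hasCompactSupport.mul_left, fun s hs => ?_⟩, ?_⟩
  · rw [hz s hs, mul_zero]
  · rw [integral_const_mul, inv_mul_cancel₀ hpos.ne']

namespace EllipticData

variable (D : EllipticData n) {φ : ℝ → ℝ} {ε : ℝ} {h F : EuclideanSpace ℝ (Fin n) → ℝ}
  {U : Set (EuclideanSpace ℝ (Fin n))}

theorem contDiff_integralOp_kernel (hφ : IsProfile φ) (hε : 0 < ε) (hh : Integrable h) :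
    ContDiff ℝ ∞ (integralOp (D.kernel φ ε) h) :=
  contDiff_integralOp (D.contDiff_kernel hφ.contDiff ε) (D.isNearDiagonal_kernel hφ hε).eq_zero hh

/-- The kernel `(x, y) ↦ ℒ_y k(x, y)`. -/
theorem isNearDiagonal_divForm_kernel (hφ : IsProfile φ) (hε : 0 < ε) :
    IsNearDiagonal (D.L * ε) fun x y => divForm D.a (fun y => D.kernel φ ε x y) y where
  continuous := by
    have h1 := (contDiff_divForm_fst D.contDiff_a (D.contDiff_kernel hφ.contDiff ε)).continuous
    refine (h1.comp continuous_swap).congr fun w => ?_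
    have h : (fun y => D.kernel φ ε w.1 y) = fun y => D.kernel φ ε y w.1 :=
      funext fun y => D.kernel_comm φ ε w.1 y
    rw [h]
    rfl
  eq_zero x y hxy := by
    have h0 : (fun y => D.kernel φ ε x y) =ᶠ[𝓝 y] fun _ => 0 := by
      have : ∀ᶠ y' in 𝓝 y, D.L * ε < ‖x - y'‖ :=
        (continuous_const.sub continuous_id).norm.continuousAt.eventually_const_lt hxy
      filter_upwards [this] with y' hy'
      exact (D.isNearDiagonal_kernel hφ hε).eq_zero x y' hy'
    rw [divForm_congr EventuallyEq.rfl h0]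
    simp [divForm, pd_const]

/-- The equation `ℒ h = F` in `U`, in the weak sense. -/
def WeakEq (D : EllipticData n) (U : Set (EuclideanSpace ℝ (Fin n)))
    (h F : EuclideanSpace ℝ (Fin n) → ℝ) : Prop :=
  ∀ η : EuclideanSpace ℝ (Fin n) → ℝ, ContDiff ℝ ∞ η → HasCompactSupport η → tsupport η ⊆ U →
    ∫ x, h x * divForm D.a η x = ∫ x, F x * η x

/-- The equation for the mollification of a weak solution: the error term is the integral operator
of the commutator kernel. -/
theorem integral_integralOp_mul_divForm (hφ : IsProfile φ) (hε : 0 < ε) (hh : Integrable h)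
    (hF : Integrable F) (hw : D.WeakEq U h F) {η : EuclideanSpace ℝ (Fin n) → ℝ}
    (hη : ContDiff ℝ ∞ η) (hc : HasCompactSupport η)
    (hηU : Metric.cthickening (D.L * ε) (tsupport η) ⊆ U) :
    ∫ x, divForm D.a η x * integralOp (D.kernel φ ε) h x =
      ∫ x, η x * (integralOp (D.kernel φ ε) F x + integralOp (D.commutator φ ε) h x) := by
  have hd := contDiff_divForm D.contDiff_a hη
  have hdc : HasCompactSupport (divForm D.a η) :=
    hc.of_isClosed_subset (isClosed_tsupport _) (tsupport_divForm_subset _ _)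
  have hk := D.isNearDiagonal_kernel hφ hε
  have hcm := D.isNearDiagonal_commutator hφ hε
  have hdk := D.isNearDiagonal_divForm_kernel hφ hε
  -- Green's formula in `x` moves the operator to the kernel, and the commutator moves it to `y`.
  have green : ∀ y, ∫ x, divForm D.a η x * D.kernel φ ε x y =
      (∫ x, η x * D.commutator φ ε x y) +
        ∫ x, η x * divForm D.a (fun y => D.kernel φ ε x y) y := fun y => by
    have h1 := integral_mul_divForm_comm D.contDiff_a D.symm_a hη
      (D.contDiff_kernel_left hφ.contDiff ε y) hc
    have i1 : Integrable fun x => η x * D.commutator φ ε x y :=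
      (hη.continuous.mul (hcm.continuous.comp (by fun_prop :
        Continuous fun x => (x, y)))).integrable_of_hasCompactSupport hc.mul_right
    have i2 : Integrable fun x => η x * divForm D.a (fun y => D.kernel φ ε x y) y :=
      (hη.continuous.mul (hdk.continuous.comp (by fun_prop :
        Continuous fun x => (x, y)))).integrable_of_hasCompactSupport hc.mul_right
    rw [← integral_add i1 i2]
    calc ∫ x, divForm D.a η x * D.kernel φ ε x y
        = ∫ x, D.kernel φ ε x y * divForm D.a η x := by simp only [mul_comm]
      _ = _ := by
          rw [← h1]
          refine integral_congr_ae (Eventually.of_forall fun x => ?_)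
          simp only [KernelData.commutator]
          ring
  have hint : ∀ m : EuclideanSpace ℝ (Fin n) → EuclideanSpace ℝ (Fin n) → ℝ,
      IsNearDiagonal (D.L * ε) m → Integrable fun y => h y * ∫ x, η x * m x y := by
    intro m hm
    have := (hm.integrable_prod hη.continuous hc hh).integral_prod_right
    refine this.congr (Eventually.of_forall fun y => ?_)
    simp only [← integral_const_mul]
    exact integral_congr_ae (Eventually.of_forall fun x => by ring)
  rw [hk.integral_mul_integralOp hd.continuous hdc hh]
  simp_rw [green, mul_add]
  rw [integral_add (hint _ hcm) (hint _ hdk), ← hcm.integral_mul_integralOp hη.continuous hc hh,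
    ← hdk.integral_mul_integralOp hη.continuous hc hh, integral_add, add_comm]
  · congr 1
    refine integral_congr_ae (Eventually.of_forall fun x => ?_)
    by_cases hx : x ∈ tsupport η
    · simp only []
      congr 1
      have hsub : tsupport (fun y => D.kernel φ ε x y) ⊆ Metric.closedBall x (D.L * ε) := by
        refine closure_minimal (fun y hy => ?_) Metric.isClosed_closedBall
        by_contra hy'
        refine hy (hk.eq_zero x y ?_)
        rw [Metric.mem_closedBall, not_le, dist_comm, dist_eq_norm] at hy'
        exact hy'
      have := hw (fun y => D.kernel φ ε x y)
        ((D.contDiff_kernel hφ.contDiff ε).comp (contDiff_const.prodMk contDiff_id))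
        ((isCompact_closedBall x (D.L * ε)).of_isClosed_subset (isClosed_tsupport _) hsub)
        (hsub.trans ((Metric.closedBall_subset_cthickening hx _).trans hηU))
      simp only [integralOp]
      calc ∫ y, divForm D.a (fun y => D.kernel φ ε x y) y * h y
          = ∫ y, h y * divForm D.a (fun y => D.kernel φ ε x y) y := by simp only [mul_comm]
        _ = ∫ y, F y * D.kernel φ ε x y := this
        _ = _ := by simp only [mul_comm]
    · simp [image_eq_zero_of_notMem_tsupport hx]
  · exact (hη.continuous.mul (hk.continuous_integralOp hF)).integrable_of_hasCompactSupport
      hc.mul_right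
  · exact (hη.continuous.mul (hcm.continuous_integralOp hh)).integrable_of_hasCompactSupport
      hc.mul_right

theorem gradForm_self_nonneg (f : EuclideanSpace ℝ (Fin n) → ℝ) (x : EuclideanSpace ℝ (Fin n)) :
    0 ≤ gradForm D.a f f x := by
  set v : Fin n → ℝ := fun i => pd i f x
  have h1 : gradForm D.a f f x = v ⬝ᵥ (D.a x *ᵥ v) := by
    simp only [gradForm, dotProduct, mulVec, Finset.mul_sum, v]
    exact Finset.sum_congr rfl fun i _ => Finset.sum_congr rfl fun j _ => by ring
  have h2 : D.G x *ᵥ (D.a x *ᵥ v) = v := by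
    rw [mulVec_mulVec, mul_eq_one_comm.1 (D.mul_eq_one x), one_mulVec]
  have h3 := D.le_dotProduct x (D.a x *ᵥ v)
  rw [h2] at h3
  rw [h1, dotProduct_comm]
  refine le_trans (mul_nonneg D.κ_pos.le ?_) h3
  exact Finset.sum_nonneg fun i _ => mul_self_nonneg _

/-- Kato's inequality for the mollification, with an error term: it is smooth, so that the chain
rule and the convexity of `β` apply. -/
theorem le_integral_comp_integralOp (hφ : IsProfile φ) (hε : 0 < ε) (hh : Integrable h)
    (hF : Integrable F) (hw : D.WeakEq U h F) {ψ : EuclideanSpace ℝ (Fin n) → ℝ}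
    (hψ : ContDiff ℝ ∞ ψ) (hc : HasCompactSupport ψ) (hψ0 : ∀ x, 0 ≤ ψ x)
    (hψU : Metric.cthickening (D.L * ε) (tsupport ψ) ⊆ U) {β : ℝ → ℝ} (hβ : ContDiff ℝ ∞ β)
    (hβ2 : ∀ s, 0 ≤ deriv (deriv β) s) :
    ∫ x, ψ x * deriv β (integralOp (D.kernel φ ε) h x) *
        (integralOp (D.kernel φ ε) F x + integralOp (D.commutator φ ε) h x) ≤
      ∫ x, β (integralOp (D.kernel φ ε) h x) * divForm D.a ψ x := by
  set u := integralOp (D.kernel φ ε) h with hu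
  have hus : ContDiff ℝ ∞ u := D.contDiff_integralOp_kernel hφ hε hh
  have hβ' : ContDiff ℝ ∞ (deriv β) := (contDiff_infty_iff_deriv.1 hβ).2
  set η : EuclideanSpace ℝ (Fin n) → ℝ := fun x => ψ x * deriv β (u x) with hη
  have hηs : ContDiff ℝ ∞ η := hψ.mul (hβ'.comp hus)
  have hηc : HasCompactSupport η := hc.mul_right
  have hηt : tsupport η ⊆ tsupport ψ := tsupport_mul_subset_left
  have h1 := D.integral_integralOp_mul_divForm hφ hε hh hF hw hηs hηc
    ((Metric.cthickening_subset_of_subset _ hηt).trans hψU)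
  have h2 : ∫ x, divForm D.a η x * u x = ∫ x, η x * divForm D.a u x := by
    rw [integral_mul_divForm_comm D.contDiff_a D.symm_a hηs hus hηc]
    simp only [mul_comm]
  rw [← h1, h2]
  have h3 := integral_mul_divForm_comm D.contDiff_a D.symm_a hψ (hβ.comp hus) hc
  simp only [Function.comp_def] at h3
  rw [← h3]
  refine integral_mono ?_ ?_ fun x => ?_
  · exact (hηs.continuous.mul (contDiff_divForm D.contDiff_a hus).continuous
      ).integrable_of_hasCompactSupport hηc.mul_right
  · exact (hψ.continuous.mul (contDiff_divForm D.contDiff_a (hβ.comp hus)).continuous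
      ).integrable_of_hasCompactSupport hc.mul_right
  · simp only []
    rw [divForm_comp D.contDiff_a hβ hus, hη, mul_assoc]
    refine mul_le_mul_of_nonneg_left ?_ (hψ0 x)
    have := mul_nonneg (hβ2 (u x)) (D.gradForm_self_nonneg u x)
    linarith

/-- A sequence of mollifications that converges almost everywhere. -/
theorem exists_seq_tendsto_ae (hφ : IsProfile φ)
    (hφ1 : ∫ v : EuclideanSpace ℝ (Fin n), φ (‖v‖ ^ 2) = 1)
    {K : Set (EuclideanSpace ℝ (Fin n))} (hK : IsCompact K) (hh : Integrable h) :
    ∃ ε : ℕ → ℝ, (∀ k, 0 < ε k) ∧ Tendsto ε atTop (𝓝[>] 0) ∧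
      ∀ᵐ x ∂(volume.restrict K),
        Tendsto (fun k => integralOp (D.kernel φ (ε k)) h x) atTop (𝓝 (h x)) := by
  have hpos : ∀ k : ℕ, (0 : ℝ) < 1 / ((k : ℝ) + 1) := fun k => by positivity
  have hlim : Tendsto (fun k : ℕ => (1 : ℝ) / ((k : ℝ) + 1)) atTop (𝓝[>] 0) :=
    tendsto_nhdsWithin_iff.2 ⟨tendsto_one_div_add_atTop_nhds_zero_nat,
      Eventually.of_forall hpos⟩
  have h1 := (D.tendsto_lintegral_integralOp_kernel_sub hφ hφ1 hK hh).comp hlim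
  have h2 : TendstoInMeasure (volume.restrict K)
      (fun k : ℕ => integralOp (D.kernel φ (1 / ((k : ℝ) + 1))) h) atTop h := by
    refine tendstoInMeasure_of_tendsto_eLpNorm one_ne_zero (fun k => ?_) hh.1.restrict ?_
    · exact (D.contDiff_integralOp_kernel hφ (hpos k) hh).continuous.aestronglyMeasurable
    · simpa only [eLpNorm_one_eq_lintegral_enorm, Pi.sub_apply, Function.comp_def] using h1
  obtain ⟨ns, hns, hae⟩ := h2.exists_seq_tendsto_ae
  exact ⟨fun k => 1 / ((ns k : ℝ) + 1), fun k => hpos _, hlim.comp hns.tendsto_atTop, hae⟩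

theorem tendsto_lintegral_of_enorm_le {K : Set (EuclideanSpace ℝ (Fin n))} (hK : MeasurableSet K)
    {f G : ℕ → EuclideanSpace ℝ (Fin n) → ℝ}
    (hf : Tendsto (fun k => ∫⁻ x in K, ‖f k x‖ₑ) atTop (𝓝 0)) {B : ℝ}
    (hG : ∀ k, ∀ x ∈ K, |G k x| ≤ B * |f k x|) (hG0 : ∀ k, ∀ x ∉ K, G k x = 0) :
    Tendsto (fun k => ∫⁻ x, ‖G k x‖ₑ) atTop (𝓝 0) := by
  have h1 : Tendsto (fun k => ENNReal.ofReal |B| * ∫⁻ x in K, ‖f k x‖ₑ) atTop (𝓝 0) := by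
    simpa using ENNReal.Tendsto.const_mul hf (a := ENNReal.ofReal |B|)
      (Or.inr ENNReal.ofReal_ne_top)
  refine tendsto_of_tendsto_of_tendsto_of_le_of_le tendsto_const_nhds h1
    (fun _ => zero_le) fun k => ?_
  simp only []
  rw [← lintegral_const_mul' _ _ ENNReal.ofReal_ne_top, ← lintegral_indicator hK]
  refine lintegral_mono fun x => ?_
  by_cases hx : x ∈ K
  · rw [Set.indicator_of_mem hx, Real.enorm_eq_ofReal_abs, Real.enorm_eq_ofReal_abs,
      ← ENNReal.ofReal_mul (abs_nonneg _)]
    exact ENNReal.ofReal_le_ofReal ((hG k x hx).trans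
      (mul_le_mul_of_nonneg_right (le_abs_self B) (abs_nonneg _)))
  · rw [hG0 k x hx]; simp

theorem abs_sub_le_of_abs_deriv_le_one {β : ℝ → ℝ} (hβ : ContDiff ℝ ∞ β)
    (hβ1 : ∀ s, |deriv β s| ≤ 1) (s t : ℝ) : |β s - β t| ≤ |s - t| := by
  have := Convex.norm_image_sub_le_of_norm_deriv_le (f := β) (C := 1) (s := Set.univ) (x := t)
    (y := s) (fun x _ => hβ.differentiable (by simp) x) (fun x _ => hβ1 x) convex_univ
    (Set.mem_univ _) (Set.mem_univ _)
  simpa using this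

theorem integrable_comp_mul {β : ℝ → ℝ} (hβ : ContDiff ℝ ∞ β) (hβ1 : ∀ s, |deriv β s| ≤ 1)
    {ξ : EuclideanSpace ℝ (Fin n) → ℝ} (hξ : Continuous ξ) (hc : HasCompactSupport ξ)
    (hh : Integrable h) : Integrable fun x => β (h x) * ξ x := by
  obtain ⟨B, hB⟩ := hξ.bounded_above_of_compact_support hc
  have h1 : Integrable fun x => (β (h x) - β 0) * ξ x := by
    refine (hh.abs.mul_const B).mono
      (((hβ.continuous.comp_aestronglyMeasurable hh.1).sub aestronglyMeasurable_const).mul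
        hξ.aestronglyMeasurable) (Eventually.of_forall fun x => ?_)
    rw [norm_mul, Real.norm_of_nonneg (mul_nonneg (abs_nonneg _) ((norm_nonneg _).trans (hB 0)))]
    gcongr
    · simpa using abs_sub_le_of_abs_deriv_le_one hβ hβ1 (h x) 0
    · exact hB x
  have h2 : Integrable fun x => β 0 * ξ x :=
    (hξ.integrable_of_hasCompactSupport hc).const_mul _
  exact (h1.add h2).congr (Eventually.of_forall fun x => by simp only [Pi.add_apply]; ring)

/-- Kato's inequality for a smooth convex function of a weak solution. -/
theorem WeakEq.le_integral_comp {D : EllipticData n} (hw : D.WeakEq U h F) (hU : IsOpen U)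
    (hh : Integrable h)
    (hF : Integrable F) {ψ : EuclideanSpace ℝ (Fin n) → ℝ}
    (hψ : ContDiff ℝ ∞ ψ) (hc : HasCompactSupport ψ) (hψ0 : ∀ x, 0 ≤ ψ x)
    (hψU : tsupport ψ ⊆ U) {β : ℝ → ℝ} (hβ : ContDiff ℝ ∞ β)
    (hβ1 : ∀ s, |deriv β s| ≤ 1) (hβ2 : ∀ s, 0 ≤ deriv (deriv β) s) :
    ∫ x, ψ x * deriv β (h x) * F x ≤ ∫ x, β (h x) * divForm D.a ψ x := by
  obtain ⟨φ, hφ, hφ1⟩ := exists_isProfile n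
  have hK : IsCompact (tsupport ψ) := hc
  obtain ⟨ε, hε0, hε, hae⟩ := D.exists_seq_tendsto_ae hφ hφ1 hK hh
  have hβ' : ContDiff ℝ ∞ (deriv β) := (contDiff_infty_iff_deriv.1 hβ).2
  have hd := (contDiff_divForm D.contDiff_a hψ).continuous
  have hdc : HasCompactSupport (divForm D.a ψ) :=
    hc.of_isClosed_subset (isClosed_tsupport _) (tsupport_divForm_subset _ _)
  have hd0 : ∀ x ∉ tsupport ψ, divForm D.a ψ x = 0 := fun x hx =>
    image_eq_zero_of_notMem_tsupport fun h => hx (tsupport_divForm_subset _ _ h)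
  have hψz : ∀ x ∉ tsupport ψ, ψ x = 0 := fun x hx => image_eq_zero_of_notMem_tsupport hx
  obtain ⟨B, hB⟩ := hd.bounded_above_of_compact_support hdc
  obtain ⟨B', hB'⟩ := hψ.continuous.bounded_above_of_compact_support hc
  have hus : ∀ k, ContDiff ℝ ∞ (integralOp (D.kernel φ (ε k)) h) := fun k =>
    D.contDiff_integralOp_kernel hφ (hε0 k) hh
  have hh1 := (D.tendsto_lintegral_integralOp_kernel_sub hφ hφ1 hK hh).comp hε
  have hF1 := (D.tendsto_lintegral_integralOp_kernel_sub hφ hφ1 hK hF).comp hε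
  have hT1 := (D.tendsto_lintegral_integralOp_commutator hφ hK hh).comp hε
  set w : ℕ → EuclideanSpace ℝ (Fin n) → ℝ := fun k x =>
    ψ x * deriv β (integralOp (D.kernel φ (ε k)) h x) with hwdef
  have hwc : ∀ k, Continuous (w k) := fun k =>
    hψ.continuous.mul (hβ'.continuous.comp (hus k).continuous)
  have hw0 : ∀ k, ∀ x ∉ tsupport ψ, w k x = 0 := fun k x hx => by
    rw [hwdef]; simp only []; rw [hψz x hx, zero_mul]
  have hwcs : ∀ k, HasCompactSupport (w k) := fun k => hc.mul_right
  have hwB : ∀ k x, |w k x| ≤ B' := fun k x => by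
    rw [hwdef, abs_mul]
    calc |ψ x| * |deriv β _| ≤ B' * 1 := by
          gcongr
          · exact (norm_nonneg _).trans (hB' 0)
          · exact hB' x
          · exact hβ1 _
      _ = B' := mul_one _
  -- the right-hand side
  have lim1 : Tendsto (fun k => ∫ x, β (integralOp (D.kernel φ (ε k)) h x) * divForm D.a ψ x)
      atTop (𝓝 (∫ x, β (h x) * divForm D.a ψ x)) := by
    refine tendsto_integral_of_L1 _ (integrable_comp_mul hβ hβ1 hd hdc hh).1
      (Eventually.of_forall fun k =>
        ((hβ.continuous.comp (hus k).continuous).mul hd).integrable_of_hasCompactSupport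
          hdc.mul_left) ?_
    refine tendsto_lintegral_of_enorm_le hK.measurableSet hh1 (B := B) (fun k x _ => ?_)
      fun k x hx => by rw [hd0 x hx]; ring
    rw [← sub_mul, abs_mul, mul_comm]
    exact mul_le_mul (hB x) (abs_sub_le_of_abs_deriv_le_one hβ hβ1 _ _) (abs_nonneg _)
      ((norm_nonneg _).trans (hB 0))
  -- the three parts of the left-hand side
  have lim2 : Tendsto (fun k => ∫ x, w k x * F x) atTop (𝓝 (∫ x, ψ x * deriv β (h x) * F x)) := by
    refine tendsto_integral_of_dominated_convergence (fun x => B' * |F x|)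
      (fun k => (hwc k).aestronglyMeasurable.mul hF.1) (hF.abs.const_mul _)
      (fun k => Eventually.of_forall fun x => ?_) ?_
    · rw [norm_mul]
      exact mul_le_mul_of_nonneg_right (hwB k x) (norm_nonneg _)
    · filter_upwards [(ae_restrict_iff' hK.measurableSet).1 hae] with x hx
      by_cases hxK : x ∈ tsupport ψ
      · exact (((hβ'.continuous.tendsto _).comp (hx hxK)).const_mul _).mul_const _
      · simp only [hw0 _ x hxK, hψz x hxK, zero_mul]
        exact tendsto_const_nhds
  have lim3 : Tendsto (fun k => ∫ x, w k x * (integralOp (D.kernel φ (ε k)) F x - F x))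
      atTop (𝓝 0) := by
    have := tendsto_integral_of_L1 (μ := volume) (l := atTop)
      (F := fun k x => w k x * (integralOp (D.kernel φ (ε k)) F x - F x)) (fun _ => (0 : ℝ))
      aestronglyMeasurable_const (Eventually.of_forall fun k => ?_) ?_
    · simpa using this
    · simp only [mul_sub]
      refine Integrable.sub ?_ (hF.bdd_mul (hwc k).aestronglyMeasurable
        (Eventually.of_forall (hwB k)))
      exact ((hwc k).mul ((D.contDiff_integralOp_kernel hφ (hε0 k) hF).continuous)
        ).integrable_of_hasCompactSupport (hwcs k).mul_right
    · refine tendsto_lintegral_of_enorm_le hK.measurableSet hF1 (B := B') (fun k x _ => ?_)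
        fun k x hx => by rw [hw0 k x hx]; ring
      rw [sub_zero, abs_mul]
      exact mul_le_mul_of_nonneg_right (hwB k x) (abs_nonneg _)
  have lim4 : Tendsto (fun k => ∫ x, w k x * integralOp (D.commutator φ (ε k)) h x)
      atTop (𝓝 0) := by
    have := tendsto_integral_of_L1 (μ := volume) (l := atTop)
      (F := fun k x => w k x * integralOp (D.commutator φ (ε k)) h x) (fun _ => (0 : ℝ))
      aestronglyMeasurable_const (Eventually.of_forall fun k => ?_) ?_
    · simpa using this
    · exact ((hwc k).mul ((D.isNearDiagonal_commutator hφ (hε0 k)).continuous_integralOp hh)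
        ).integrable_of_hasCompactSupport (hwcs k).mul_right
    · refine tendsto_lintegral_of_enorm_le hK.measurableSet hT1 (B := B') (fun k x _ => ?_)
        fun k x hx => by rw [hw0 k x hx]; ring
      rw [sub_zero, abs_mul]
      exact mul_le_mul_of_nonneg_right (hwB k x) (abs_nonneg _)
  have lim5 := (lim2.add lim3).add lim4
  simp only [add_zero] at lim5
  refine le_of_tendsto_of_tendsto lim5 lim1 ?_
  obtain ⟨δ, hδ, hδU⟩ := hK.exists_cthickening_subset_open hU hψU
  have hsmall : ∀ᶠ k in atTop, D.L * ε k ≤ δ := by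
    have : Tendsto (fun k => D.L * ε k) atTop (𝓝 (D.L * 0)) :=
      (tendsto_nhdsWithin_iff.1 hε).1.const_mul _
    rw [mul_zero] at this
    exact (this.eventually_lt_const hδ).mono fun k hk => hk.le
  filter_upwards [hsmall] with k hk
  refine le_trans (le_of_eq ?_) (D.le_integral_comp_integralOp hφ (hε0 k) hh hF hw hψ hc hψ0
    ((Metric.cthickening_mono hk _).trans hδU) hβ hβ2)
  have iF : Integrable fun x => w k x * F x :=
    hF.bdd_mul (hwc k).aestronglyMeasurable (Eventually.of_forall (hwB k))
  have iF' : Integrable fun x => w k x * (integralOp (D.kernel φ (ε k)) F x - F x) := by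
    simp only [mul_sub]
    exact (((hwc k).mul ((D.contDiff_integralOp_kernel hφ (hε0 k) hF).continuous)
        ).integrable_of_hasCompactSupport (hwcs k).mul_right).sub iF
  have iT : Integrable fun x => w k x * integralOp (D.commutator φ (ε k)) h x :=
    ((hwc k).mul ((D.isNearDiagonal_commutator hφ (hε0 k)).continuous_integralOp hh)
        ).integrable_of_hasCompactSupport (hwcs k).mul_right
  have iS : Integrable fun x => w k x * F x +
      w k x * (integralOp (D.kernel φ (ε k)) F x - F x) := iF.add iF'
  rw [← integral_add iF iF', ← integral_add iS iT]
  refine integral_congr_ae (Eventually.of_forall fun x => ?_)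
  simp only [hwdef]
  ring

theorem contDiff_sqrt_sq_add {δ : ℝ} (hδ : 0 < δ) : ContDiff ℝ ∞ fun s : ℝ => √(s ^ 2 + δ ^ 2) :=
  ContDiff.sqrt (by fun_prop) fun s => by positivity

theorem deriv_sqrt_sq_add {δ : ℝ} (hδ : 0 < δ) (s : ℝ) :
    deriv (fun s : ℝ => √(s ^ 2 + δ ^ 2)) s = s / √(s ^ 2 + δ ^ 2) := by
  have h1 : HasDerivAt (fun s : ℝ => s ^ 2 + δ ^ 2) (2 * s) s := by
    simpa using (hasDerivAt_pow 2 s).add_const (δ ^ 2)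
  rw [(h1.sqrt (by positivity)).deriv]
  field_simp

theorem deriv_deriv_sqrt_sq_add_nonneg {δ : ℝ} (hδ : 0 < δ) (s : ℝ) :
    0 ≤ deriv (deriv fun s : ℝ => √(s ^ 2 + δ ^ 2)) s := by
  rw [show (deriv fun s : ℝ => √(s ^ 2 + δ ^ 2)) = fun s => s / √(s ^ 2 + δ ^ 2) from
    funext (deriv_sqrt_sq_add hδ)]
  have hp : 0 < √(s ^ 2 + δ ^ 2) := Real.sqrt_pos.2 (by positivity)
  have h1 := ((contDiff_sqrt_sq_add hδ).differentiable (by simp) s).hasDerivAt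
  rw [deriv_sqrt_sq_add hδ] at h1
  have h0 : HasDerivAt (fun s : ℝ => s / √(s ^ 2 + δ ^ 2)) _ s := (hasDerivAt_id s).div h1 hp.ne'
  rw [h0.deriv]
  refine div_nonneg ?_ (sq_nonneg _)
  have h2 : √(s ^ 2 + δ ^ 2) ^ 2 = s ^ 2 + δ ^ 2 := Real.sq_sqrt (by positivity)
  have h3 : 1 * √(s ^ 2 + δ ^ 2) - id s * (s / √(s ^ 2 + δ ^ 2)) = δ ^ 2 / √(s ^ 2 + δ ^ 2) := by
    simp only [id]
    field_simp
    linarith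
  rw [h3]
  positivity

/-- Kato's inequality: if `ℒ h = F` in the weak sense, where `F` is a nonnegative multiple of `h`
at each point, then `ℒ |h| ≥ |F|`. -/
theorem WeakEq.le_integral_abs {D : EllipticData n} (hw : D.WeakEq U h F) (hU : IsOpen U)
    (hh : Integrable h)
    (hF : Integrable F) (hFh : ∀ᵐ x, ∃ b : ℝ, 0 ≤ b ∧ F x = b * h x)
    {ψ : EuclideanSpace ℝ (Fin n) → ℝ}
    (hψ : ContDiff ℝ ∞ ψ) (hc : HasCompactSupport ψ) (hψ0 : ∀ x, 0 ≤ ψ x)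
    (hψU : tsupport ψ ⊆ U) :
    ∫ x, ψ x * |F x| ≤ ∫ x, |h x| * divForm D.a ψ x := by
  have hd := (contDiff_divForm D.contDiff_a hψ).continuous
  have hdc : HasCompactSupport (divForm D.a ψ) :=
    hc.of_isClosed_subset (isClosed_tsupport _) (tsupport_divForm_subset _ _)
  obtain ⟨B, hB⟩ := hd.bounded_above_of_compact_support hdc
  obtain ⟨B', hB'⟩ := hψ.continuous.bounded_above_of_compact_support hc
  set δ : ℕ → ℝ := fun k => 1 / ((k : ℝ) + 1) with hδdef
  have hδ0 : ∀ k, 0 < δ k := fun k => by positivity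
  have hδ1 : ∀ k, δ k ≤ 1 := fun k => by
    rw [hδdef]
    exact (div_le_one (by positivity)).2 (by linarith [Nat.cast_nonneg (α := ℝ) k])
  have hδ : Tendsto δ atTop (𝓝 0) := tendsto_one_div_add_atTop_nhds_zero_nat
  have hsq : ∀ s, Tendsto (fun k => √(s ^ 2 + δ k ^ 2)) atTop (𝓝 |s|) := fun s => by
    have h1 : Tendsto (fun k => √(s ^ 2 + δ k ^ 2)) atTop (𝓝 √(s ^ 2 + 0 ^ 2)) :=
      ((by fun_prop : Continuous fun t : ℝ => √(s ^ 2 + t ^ 2)).tendsto 0).comp hδ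
    rwa [zero_pow two_ne_zero, add_zero, Real.sqrt_sq_eq_abs] at h1
  have hle : ∀ k s, |s| ≤ √(s ^ 2 + δ k ^ 2) := fun k s => by
    rw [← Real.sqrt_sq_eq_abs]
    exact Real.sqrt_le_sqrt (by have := sq_nonneg (δ k); linarith)
  have hp : ∀ k s, 0 < √(s ^ 2 + δ k ^ 2) := fun k s =>
    Real.sqrt_pos.2 (by have := hδ0 k; positivity)
  have hder : ∀ k s, |deriv (fun s : ℝ => √(s ^ 2 + δ k ^ 2)) s| ≤ 1 := fun k s => by
    rw [deriv_sqrt_sq_add (hδ0 k), abs_div, abs_of_pos (hp k s)]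
    exact (div_le_one (hp k s)).2 (hle k s)
  -- The smooth convex functions `√(s² + δ²)` tend to `|s|`, and their derivatives to the sign of `s`.
  have key : ∀ k, _ := fun k => hw.le_integral_comp hU hh hF hψ hc hψ0 hψU
    (contDiff_sqrt_sq_add (hδ0 k)) (hder k) (deriv_deriv_sqrt_sq_add_nonneg (hδ0 k))
  simp only [deriv_sqrt_sq_add (hδ0 _)] at key
  refine le_of_tendsto_of_tendsto' (b := atTop)
    (f := fun k => ∫ x, ψ x * (h x / √(h x ^ 2 + δ k ^ 2)) * F x)
    (g := fun k => ∫ x, √(h x ^ 2 + δ k ^ 2) * divForm D.a ψ x) ?_ ?_ key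
  · refine tendsto_integral_of_dominated_convergence (fun x => B' * |F x|) (fun k => ?_)
      (hF.abs.const_mul _) (fun k => Eventually.of_forall fun x => ?_) ?_
    · refine (hψ.continuous.aestronglyMeasurable.mul ?_).mul hF.1
      have : Continuous fun s : ℝ => s / √(s ^ 2 + δ k ^ 2) :=
        continuous_id.div (by fun_prop) fun s => (hp k s).ne'
      exact this.comp_aestronglyMeasurable hh.1
    · rw [norm_mul, norm_mul]
      have h1 : ‖h x / √(h x ^ 2 + δ k ^ 2)‖ ≤ 1 := by
        rw [← deriv_sqrt_sq_add (hδ0 k)]; exact hder k _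
      calc ‖ψ x‖ * ‖h x / √(h x ^ 2 + δ k ^ 2)‖ * ‖F x‖ ≤ B' * 1 * |F x| := by
            gcongr
            · rw [mul_one]; exact (norm_nonneg _).trans (hB' 0)
            · exact (norm_nonneg _).trans (hB' 0)
            · exact hB' x
            · exact le_rfl
        _ = B' * |F x| := by ring
    · filter_upwards [hFh] with x ⟨b, hb, hFx⟩
      rcases eq_or_ne (h x) 0 with h0 | h0
      · simp [hFx, h0]
      · have h1 : Tendsto (fun k => h x / √(h x ^ 2 + δ k ^ 2)) atTop (𝓝 (h x / |h x|)) :=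
          tendsto_const_nhds.div (hsq (h x)) (abs_ne_zero.2 h0)
        have h2 := (h1.const_mul (ψ x)).mul_const (F x)
        convert h2 using 2
        rw [hFx, abs_mul, abs_of_nonneg hb]
        have : |h x| ≠ 0 := abs_ne_zero.2 h0
        field_simp
        rw [sq_abs]
  · refine tendsto_integral_of_dominated_convergence
      (fun x => |h x| * B + ‖divForm D.a ψ x‖) (fun k => ?_)
      ((hh.abs.mul_const _).add (hd.integrable_of_hasCompactSupport hdc).norm)
      (fun k => Eventually.of_forall fun x => ?_) ?_
    · exact ((by fun_prop : Continuous fun s : ℝ =>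
        √(s ^ 2 + δ k ^ 2)).comp_aestronglyMeasurable hh.1).mul hd.aestronglyMeasurable
    · have h1 : √(h x ^ 2 + δ k ^ 2) ≤ |h x| + 1 := by
        refine Real.sqrt_le_iff.2 ⟨by positivity, ?_⟩
        have h2 : δ k ^ 2 ≤ 1 := pow_le_one₀ (hδ0 k).le (hδ1 k)
        nlinarith [abs_nonneg (h x), sq_abs (h x)]
      rw [norm_mul, Real.norm_of_nonneg (hp k _).le]
      calc √(h x ^ 2 + δ k ^ 2) * ‖divForm D.a ψ x‖ ≤ (|h x| + 1) * ‖divForm D.a ψ x‖ := by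
            gcongr
        _ = |h x| * ‖divForm D.a ψ x‖ + ‖divForm D.a ψ x‖ := by ring
        _ ≤ _ := by gcongr; exact hB x
    · exact Eventually.of_forall fun x => (hsq (h x)).mul_const _

end EllipticData

end FlatKato
end RiemannianSchrodinger

/-! ### Smooth matrix functions and global elliptic data -/

namespace RiemannianSchrodinger

section Determinant

open Filter Topology Matrix

variable {n : ℕ}

theorem contDiffOn_det {E : Type*} [NormedAddCommGroup E] [NormedSpace ℝ E] {s : Set E}
    {A : E → Matrix (Fin n) (Fin n) ℝ} (hA : ∀ i j, ContDiffOn ℝ ∞ (fun x => A x i j) s) :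
    ContDiffOn ℝ ∞ (fun x => (A x).det) s := by
  simp only [Matrix.det_apply]
  exact ContDiffOn.sum fun σ _ => (contDiffOn_prod fun i _ => hA _ _).const_smul _

theorem contDiffOn_inv {E : Type*} [NormedAddCommGroup E] [NormedSpace ℝ E] {s : Set E}
    {A : E → Matrix (Fin n) (Fin n) ℝ} (hA : ∀ i j, ContDiffOn ℝ ∞ (fun x => A x i j) s)
    (h0 : ∀ x ∈ s, (A x).det ≠ 0) (i j : Fin n) : ContDiffOn ℝ ∞ (fun x => (A x)⁻¹ i j) s := by
  have h1 : ∀ x, (A x)⁻¹ i j = (A x).det⁻¹ * ((A x).updateRow j (Pi.single i 1)).det := fun x => by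
    rw [Matrix.inv_def, Matrix.smul_apply, Matrix.adjugate_apply, Ring.inverse_eq_inv', smul_eq_mul]
  simp only [h1]
  refine ((contDiffOn_det hA).inv h0).mul (contDiffOn_det fun k l => ?_)
  by_cases hk : k = j
  · subst hk
    simp only [updateRow_self]
    exact contDiffOn_const
  · simp only [updateRow_ne hk]
    exact hA k l

/-- Jacobi's formula. -/
theorem pd_det {G : EuclideanSpace ℝ (Fin n) → Matrix (Fin n) (Fin n) ℝ}
    (hG : ∀ i j, ContDiff ℝ ∞ fun x => G x i j) {a : Matrix (Fin n) (Fin n) ℝ}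
    {x : EuclideanSpace ℝ (Fin n)} (ha : a * G x = 1) (i : Fin n) :
    pd i (fun y => (G y).det) x = (G x).det * ∑ k, ∑ l, a k l * pd i (fun y => G y l k) x := by
  let Δ : ContinuousMultilinearMap ℝ (fun _ : Fin n => Fin n → ℝ) ℝ :=
    ⟨(detRowAlternating (R := ℝ) (n := Fin n)).toMultilinearMap, by
      exact Continuous.matrix_det (A := fun M : Matrix (Fin n) (Fin n) ℝ => M) continuous_id⟩
  have hΔ : ∀ M : Matrix (Fin n) (Fin n) ℝ, Δ M = M.det := fun M => rfl
  have hGd : HasFDerivAt (fun y => (fun k l => G y k l : Fin n → Fin n → ℝ))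
      (ContinuousLinearMap.pi fun k => ContinuousLinearMap.pi fun l =>
        fderiv ℝ (fun y => G y k l) x) x :=
    hasFDerivAt_pi.2 fun k => hasFDerivAt_pi.2 fun l => ((hG k l).diffAt x).hasFDerivAt
  have h1 := (Δ.hasFDerivAt (G x)).comp x hGd
  have h2 : pd i (fun y => (G y).det) x =
      ∑ k, ((G x).updateRow k fun l => pd i (fun y => G y k l) x).det := by
    have : fderiv ℝ (fun y => (G y).det) x = _ := h1.fderiv
    rw [pd, this]
    exact (Δ.linearDeriv_apply _ _).trans rfl
  have hdet : (G x).det ≠ 0 := fun h => by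
    have := congrArg Matrix.det ha
    rw [det_mul, h, mul_zero, det_one] at this
    exact zero_ne_one this
  have hadj : (G x).adjugate = (G x).det • a := by
    rw [← inv_eq_left_inv ha, Matrix.inv_def, smul_smul, Ring.inverse_eq_inv',
      mul_inv_cancel₀ hdet, one_smul]
  have h3 : ∀ k (v : Fin n → ℝ), ((G x).updateRow k v).det = (G x).det * ∑ l, a l k * v l := by
    intro k v
    rw [← cramer_transpose_apply, cramer_eq_adjugate_mulVec, ← adjugate_transpose, hadj]
    simp [mulVec, dotProduct, Finset.mul_sum, mul_assoc]
  rw [h2]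
  simp only [h3, ← Finset.mul_sum]
  rw [Finset.sum_comm]

/-- The elliptic data of a smooth uniformly positive definite matrix function `G`: the coefficients
`G⁻¹` and the weight `(det G)^(1/4)`, whose differential equation is Jacobi's formula. -/
noncomputable def EllipticData.ofMatrix (G : EuclideanSpace ℝ (Fin n) → Matrix (Fin n) (Fin n) ℝ)
    (hG : ∀ i j, ContDiff ℝ ∞ fun x => G x i j) (hs : ∀ x, (G x).IsSymm) (κ : ℝ) (hκ : 0 < κ)
    (hle : ∀ x (v : Fin n → ℝ), κ * (v ⬝ᵥ v) ≤ v ⬝ᵥ (G x *ᵥ v)) : EllipticData n :=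
  have hpd : ∀ x, (G x).PosDef := fun x => by
    refine PosDef.of_dotProduct_mulVec_pos ?_ fun v hv => ?_
    · rw [IsHermitian, conjTranspose_eq_transpose_of_trivial]
      exact hs x
    · have : 0 < v ⬝ᵥ v := by simpa using dotProduct_star_self_pos_iff.2 hv
      simpa using (mul_pos hκ this).trans_le (hle x v)
  have hdet : ∀ x, 0 < (G x).det := fun x => (hpd x).det_pos
  have hinv : ∀ x, (G x)⁻¹ * G x = 1 := fun x => nonsing_inv_mul _ (hdet x).ne'.isUnit
  have hds : ContDiff ℝ ∞ fun x => (G x).det :=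
    contDiffOn_univ.1 (contDiffOn_det fun i j => (hG i j).contDiffOn)
  { a := fun x => (G x)⁻¹
    G := G
    c := fun x => (G x).det ^ (1 / 4 : ℝ)
    contDiff_a := fun i j => contDiffOn_univ.1
      (contDiffOn_inv (fun i j => (hG i j).contDiffOn) (fun x _ => (hdet x).ne') i j)
    contDiff_G := hG
    contDiff_c := hds.rpow_const_of_ne fun x => (hdet x).ne'
    symm_a := fun x => by
      rw [IsSymm, transpose_nonsing_inv, hs x]
    symm_G := hs
    mul_eq_one := hinv
    pd_c := fun i x => by
      have h := Real.hasDerivAt_rpow_const (x := (G x).det) (p := 1 / 4) (Or.inl (hdet x).ne')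
      rw [pd_comp (φ := fun s => s ^ (1 / 4 : ℝ)) h.differentiableAt (hds.diffAt x), h.deriv,
        pd_det hG (hinv x), Real.rpow_sub_one (hdet x).ne']
      have := (hdet x).ne'
      simp only [traceGrad]
      field_simp
    κ := κ
    L := √(1 / κ)
    c_pow := fun x => by
      rw [← Real.rpow_natCast, ← Real.rpow_mul (hdet x).le]
      norm_num
    κ_pos := hκ
    le_dotProduct := hle
    L_pos := Real.sqrt_pos.2 (by positivity)
    one_le := by
      rw [Real.sq_sqrt (by positivity), mul_one_div_cancel hκ.ne'] }

end Determinant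

/-! ### Kato's inequality in open sets -/

section LocalKato

open Filter Topology Matrix

variable {n : ℕ} {W : Set (EuclideanSpace ℝ (Fin n))}

/-- On a compact set, a continuous positive definite matrix function is uniformly positive. -/
theorem exists_uniform_lower_bound {K : Set (EuclideanSpace ℝ (Fin n))} (hK : IsCompact K)
    {A : EuclideanSpace ℝ (Fin n) → Matrix (Fin n) (Fin n) ℝ}
    (hA : ∀ i j, ContinuousOn (fun x => A x i j) K) (hpos : ∀ x ∈ K, (A x).PosDef) :
    ∃ κ : ℝ, 0 < κ ∧ ∀ x ∈ K, ∀ v : Fin n → ℝ, κ * (v ⬝ᵥ v) ≤ v ⬝ᵥ (A x *ᵥ v) := by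
  set S : Set (Fin n → ℝ) := {v | v ⬝ᵥ v = 1} with hS
  have hSc : IsCompact S := by
    refine Metric.isCompact_of_isClosed_isBounded
      (isClosed_eq (by simp only [dotProduct]; fun_prop) continuous_const) ?_
    refine (Metric.isBounded_closedBall (x := (0 : Fin n → ℝ)) (r := 1)).subset fun v hv => ?_
    rw [mem_closedBall_zero_iff, pi_norm_le_iff_of_nonneg zero_le_one]
    intro i
    have h1 : v i * v i ≤ v ⬝ᵥ v :=
      Finset.single_le_sum (f := fun i => v i * v i) (fun j _ => mul_self_nonneg _)
        (Finset.mem_univ i)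
    rw [show v ⬝ᵥ v = 1 from hv] at h1
    rw [Real.norm_eq_abs, ← Real.sqrt_sq_eq_abs]
    exact Real.sqrt_le_one.2 (by nlinarith)
  have hcont : ContinuousOn
      (fun w : EuclideanSpace ℝ (Fin n) × (Fin n → ℝ) => w.2 ⬝ᵥ (A w.1 *ᵥ w.2)) (K ×ˢ S) := by
    simp only [dotProduct, mulVec]
    refine continuousOn_finsetSum _ fun i _ => (by fun_prop : ContinuousOn
      (fun w : EuclideanSpace ℝ (Fin n) × (Fin n → ℝ) => w.2 i) _).mul
      (continuousOn_finsetSum _ fun j _ => ContinuousOn.mul ?_ (by fun_prop))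
    exact (hA i j).comp continuousOn_fst fun w hw => hw.1
  rcases (K ×ˢ S).eq_empty_or_nonempty with he | hne
  · refine ⟨1, one_pos, fun x hx v => ?_⟩
    by_cases hv : v = 0
    · simp [hv]
    · exfalso
      have hvv : 0 < v ⬝ᵥ v := by simpa using dotProduct_star_self_pos_iff.2 hv
      have : (x, (√(v ⬝ᵥ v))⁻¹ • v) ∈ K ×ˢ S := by
        refine ⟨hx, ?_⟩
        simp only [hS, Set.mem_ofPred_eq, smul_dotProduct, dotProduct_smul, smul_eq_mul]
        rw [← mul_assoc, ← mul_inv, Real.mul_self_sqrt hvv.le, inv_mul_cancel₀ hvv.ne']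
      rw [he] at this
      exact this
  · obtain ⟨w, hw, hmin⟩ := (hK.prod hSc).exists_isMinOn hne hcont
    have hw0 : w.2 ≠ 0 := fun h => by
      have := hw.2
      simp [hS, h] at this
    refine ⟨w.2 ⬝ᵥ (A w.1 *ᵥ w.2), by simpa using (hpos w.1 hw.1).dotProduct_mulVec_pos hw0,
      fun x hx v => ?_⟩
    by_cases hv : v = 0
    · simp [hv]
    · have hvv : 0 < v ⬝ᵥ v := by simpa using dotProduct_star_self_pos_iff.2 hv
      have hmem : (x, (√(v ⬝ᵥ v))⁻¹ • v) ∈ K ×ˢ S := by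
        refine ⟨hx, ?_⟩
        simp only [hS, Set.mem_ofPred_eq, smul_dotProduct, dotProduct_smul, smul_eq_mul]
        rw [← mul_assoc, ← mul_inv, Real.mul_self_sqrt hvv.le, inv_mul_cancel₀ hvv.ne']
      have h1 := hmin hmem
      simp only [Set.mem_ofPred_eq, mulVec_smul, smul_dotProduct, dotProduct_smul,
        smul_eq_mul] at h1
      rw [← mul_assoc, ← mul_inv, Real.mul_self_sqrt hvv.le, ← div_eq_inv_mul,
        le_div_iff₀ hvv] at h1
      exact h1

theorem contDiff_mul_of_tsupport_subset (hW : IsOpen W) {χ f : EuclideanSpace ℝ (Fin n) → ℝ}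
    (hχ : ContDiff ℝ ∞ χ) (hχW : tsupport χ ⊆ W) (hf : ContDiffOn ℝ ∞ f W) :
    ContDiff ℝ ∞ fun x => χ x * f x := by
  refine contDiff_iff_contDiffAt.2 fun x => ?_
  by_cases hx : x ∈ tsupport χ
  · exact hχ.contDiffAt.mul (hf.contDiffAt (hW.mem_nhds (hχW hx)))
  · have : (fun x => χ x * f x) =ᶠ[𝓝 x] fun _ => 0 := by
      filter_upwards [notMem_tsupport_iff_eventuallyEq.1 hx] with y hy
      simp [hy]
    exact contDiffAt_const.congr_of_eventuallyEq this

/-- A smooth cutoff function, equal to one near a compact subset of an open set. -/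
theorem exists_cutoff (hW : IsOpen W) {K : Set (EuclideanSpace ℝ (Fin n))} (hK : IsCompact K)
    (hKW : K ⊆ W) : ∃ (χ : EuclideanSpace ℝ (Fin n) → ℝ) (U : Set (EuclideanSpace ℝ (Fin n))),
      ContDiff ℝ ∞ χ ∧ HasCompactSupport χ ∧ tsupport χ ⊆ W ∧ (∀ x, χ x ∈ Set.Icc 0 1) ∧
      IsOpen U ∧ K ⊆ U ∧ U ⊆ W ∧ ∀ x ∈ U, χ x = 1 := by
  obtain ⟨K', hK', hKK', hK'W⟩ := exists_compact_between hK hW hKW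
  obtain ⟨χ, h1, h0, h01⟩ := exists_contMDiffMap_one_nhds_of_subset_interior
    𝓘(ℝ, EuclideanSpace ℝ (Fin n)) (n := ⊤) hK.isClosed hKK'
  obtain ⟨U, hU, hKU, hU1⟩ := mem_nhdsSet_iff_exists.1 h1
  have hs : tsupport χ ⊆ K' := closure_minimal (fun x hx => by_contra fun h => hx (h0 x h))
    hK'.isClosed
  exact ⟨χ, U ∩ W, χ.contMDiff.contDiff, hK'.of_isClosed_subset (isClosed_tsupport _) hs,
    hs.trans hK'W, h01, hU.inter hW, Set.subset_inter hKU hKW, Set.inter_subset_right,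
    fun x hx => hU1 hx.1⟩

/-- A smooth positive definite matrix function on an open set agrees near a compact subset with the
coefficient matrix of global elliptic data. -/
theorem exists_ellipticData (hW : IsOpen W) {K : Set (EuclideanSpace ℝ (Fin n))} (hK : IsCompact K)
    (hKW : K ⊆ W) {A : EuclideanSpace ℝ (Fin n) → Matrix (Fin n) (Fin n) ℝ}
    (hA : ∀ i j, ContDiffOn ℝ ∞ (fun x => A x i j) W) (hpos : ∀ x ∈ W, (A x).PosDef) :
    ∃ (D : EllipticData n) (U : Set (EuclideanSpace ℝ (Fin n))), IsOpen U ∧ K ⊆ U ∧ U ⊆ W ∧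
      ∀ x ∈ U, D.a x = A x := by
  obtain ⟨χ, U, hχ, hχc, hχW, h01, hU, hKU, hUW, hU1⟩ := exists_cutoff hW hK hKW
  have hinv := contDiffOn_inv hA fun x hx => (hpos x hx).det_pos.ne'
  obtain ⟨κ, hκ, hκle⟩ := exists_uniform_lower_bound hχc (A := fun x => (A x)⁻¹)
    (fun i j => (hinv i j).continuousOn.mono hχW) fun x hx => (hpos x (hχW hx)).inv
  have hsymm : ∀ x ∈ W, ((A x)⁻¹).IsSymm := fun x hx => by
    have := (hpos x hx).inv.isHermitian
    rwa [IsHermitian, conjTranspose_eq_transpose_of_trivial] at this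
  have hz : ∀ x, x ∉ tsupport χ → χ x = 0 := fun x hx => image_eq_zero_of_notMem_tsupport hx
  -- The inverse matrices, not the coefficients, are interpolated with the identity matrix.
  set G : EuclideanSpace ℝ (Fin n) → Matrix (Fin n) (Fin n) ℝ := fun x =>
    χ x • (A x)⁻¹ + (1 - χ x) • 1 with hG
  refine ⟨EllipticData.ofMatrix G (fun i j => ?_) (fun x => ?_) (min κ 1) (lt_min hκ one_pos)
    (fun x v => ?_), U, hU, hKU, hUW, fun x hx => ?_⟩
  · simp only [hG, Matrix.add_apply, Matrix.smul_apply, smul_eq_mul]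
    exact (contDiff_mul_of_tsupport_subset hW hχ hχW (hinv i j)).add
      ((contDiff_const.sub hχ).mul contDiff_const)
  · by_cases hx : x ∈ tsupport χ
    · exact ((hsymm x (hχW hx)).smul _).add (isSymm_one.smul _)
    · simp only [hG, hz x hx, zero_smul, zero_add]
      exact isSymm_one.smul _
  · have hv : 0 ≤ v ⬝ᵥ v := Finset.sum_nonneg fun i _ => mul_self_nonneg _
    simp only [hG, add_mulVec, smul_mulVec, one_mulVec, dotProduct_add, dotProduct_smul,
      smul_eq_mul]
    have h1 : χ x * (min κ 1 * (v ⬝ᵥ v)) ≤ χ x * (v ⬝ᵥ ((A x)⁻¹ *ᵥ v)) := by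
      by_cases hx : x ∈ tsupport χ
      · exact mul_le_mul_of_nonneg_left ((mul_le_mul_of_nonneg_right (min_le_left _ _) hv).trans
          (hκle x hx v)) (h01 x).1
      · simp [hz x hx]
    have h2 : (1 - χ x) * (min κ 1 * (v ⬝ᵥ v)) ≤ (1 - χ x) * (v ⬝ᵥ v) :=
      mul_le_mul_of_nonneg_left ((mul_le_mul_of_nonneg_right (min_le_right _ _) hv).trans
        (one_mul _).le) (sub_nonneg.2 (h01 x).2)
    linarith
  · change (G x)⁻¹ = A x
    simp only [hG, hU1 x hx, one_smul, sub_self, zero_smul, add_zero]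
    exact nonsing_inv_nonsing_inv _ (hpos x (hUW hx)).det_pos.ne'.isUnit

/-- Kato's inequality for weak solutions of `∂ᵢ (Aᵢⱼ ∂ⱼ h) = F` in an open set, with a smooth
positive definite matrix `A`. -/
theorem le_integral_abs_mul_divForm (hW : IsOpen W)
    {A : EuclideanSpace ℝ (Fin n) → Matrix (Fin n) (Fin n) ℝ}
    (hA : ∀ i j, ContDiffOn ℝ ∞ (fun x => A x i j) W) (hpos : ∀ x ∈ W, (A x).PosDef)
    {h F : EuclideanSpace ℝ (Fin n) → ℝ} (hh : LocallyIntegrableOn h W)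
    (hF : LocallyIntegrableOn F W)
    (hw : ∀ η : EuclideanSpace ℝ (Fin n) → ℝ, ContDiff ℝ ∞ η → HasCompactSupport η →
      tsupport η ⊆ W → ∫ x, h x * divForm A η x = ∫ x, F x * η x)
    (hFh : ∀ᵐ x, x ∈ W → ∃ b : ℝ, 0 ≤ b ∧ F x = b * h x)
    {ψ : EuclideanSpace ℝ (Fin n) → ℝ} (hψ : ContDiff ℝ ∞ ψ) (hc : HasCompactSupport ψ)
    (hψ0 : ∀ x, 0 ≤ ψ x) (hψW : tsupport ψ ⊆ W) :
    ∫ x, ψ x * |F x| ≤ ∫ x, |h x| * divForm A ψ x := by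
  obtain ⟨D, U, hU, hKU, hUW, hDA⟩ := exists_ellipticData hW hc hψW hA hpos
  obtain ⟨K, hK, hψK, hKU'⟩ := exists_compact_between hc hU hKU
  have hdiv : ∀ η : EuclideanSpace ℝ (Fin n) → ℝ, ∀ x ∈ U, divForm D.a η x = divForm A η x :=
    fun η x hx => divForm_congr ((hU.mem_nhds hx |> fun h => by
      filter_upwards [h] with y hy using hDA y hy)) EventuallyEq.rfl
  have hz : ∀ B (η : EuclideanSpace ℝ (Fin n) → ℝ), ∀ x ∉ tsupport η, divForm B η x = 0 :=
    fun B η x hx => image_eq_zero_of_notMem_tsupport fun h => hx (tsupport_divForm_subset _ _ h)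
  have hhi : Integrable (K.indicator h) :=
    (integrable_indicator_iff hK.measurableSet).2
      (hh.integrableOn_compact_subset (hKU'.trans hUW) hK)
  have hFi : Integrable (K.indicator F) :=
    (integrable_indicator_iff hK.measurableSet).2
      (hF.integrableOn_compact_subset (hKU'.trans hUW) hK)
  have heq : D.WeakEq (interior K) (K.indicator h) (K.indicator F) := by
    intro η hη hηc hηK
    have e1 : ∀ x, K.indicator h x * divForm D.a η x = h x * divForm A η x := fun x => by
      by_cases hx : x ∈ tsupport η
      · rw [Set.indicator_of_mem (interior_subset (hηK hx)),
          hdiv η x (hKU' (interior_subset (hηK hx)))]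
      · rw [hz _ _ _ hx, hz _ _ _ hx]; ring
    have e2 : ∀ x, K.indicator F x * η x = F x * η x := fun x => by
      by_cases hx : x ∈ tsupport η
      · rw [Set.indicator_of_mem (interior_subset (hηK hx))]
      · rw [image_eq_zero_of_notMem_tsupport hx]; ring
    simp only [e1, e2]
    exact hw η hη hηc (hηK.trans (interior_subset.trans (hKU'.trans hUW)))
  have key := heq.le_integral_abs isOpen_interior hhi hFi ?_ hψ hc hψ0 hψK
  · have e1 : ∀ x, |K.indicator h x| * divForm D.a ψ x = |h x| * divForm A ψ x := fun x => by
      by_cases hx : x ∈ tsupport ψ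
      · rw [Set.indicator_of_mem (interior_subset (hψK hx)), hdiv ψ x (hKU hx)]
      · rw [hz _ _ _ hx, hz _ _ _ hx]; ring
    have e2 : ∀ x, ψ x * |K.indicator F x| = ψ x * |F x| := fun x => by
      by_cases hx : x ∈ tsupport ψ
      · rw [Set.indicator_of_mem (interior_subset (hψK hx))]
      · rw [image_eq_zero_of_notMem_tsupport hx]; ring
    simpa only [e1, e2] using key
  · filter_upwards [hFh] with x hx
    by_cases hxK : x ∈ K
    · rw [Set.indicator_of_mem hxK, Set.indicator_of_mem hxK]
      exact hx (hUW (hKU' hxK))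
    · exact ⟨0, le_rfl, by rw [Set.indicator_of_notMem hxK]; ring⟩

end LocalKato
end RiemannianSchrodinger

/-! ### Green's formula and change of variables in open sets -/

namespace RiemannianSchrodinger

section ChangeOfVariables

open Filter Topology Matrix

variable {n : ℕ} {W : Set (EuclideanSpace ℝ (Fin n))}
  {A : EuclideanSpace ℝ (Fin n) → Matrix (Fin n) (Fin n) ℝ} {f η : EuclideanSpace ℝ (Fin n) → ℝ}

theorem divForm_eq_zero_of_notMem_tsupport (A : EuclideanSpace ℝ (Fin n) → Matrix (Fin n) (Fin n) ℝ)
    {x : EuclideanSpace ℝ (Fin n)} (hx : x ∉ tsupport η) : divForm A η x = 0 :=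
  image_eq_zero_of_notMem_tsupport fun h => hx (tsupport_divForm_subset _ _ h)

theorem gradForm_eq_zero_of_notMem_tsupport (A : EuclideanSpace ℝ (Fin n) → Matrix (Fin n) (Fin n) ℝ)
    (f : EuclideanSpace ℝ (Fin n) → ℝ)
    {x : EuclideanSpace ℝ (Fin n)} (hx : x ∉ tsupport η) : gradForm A η f x = 0 := by
  have : ∀ i, pd i η x = 0 := fun i =>
    image_eq_zero_of_notMem_tsupport fun h => hx (support_pd_subset _ _ h)
  simp [gradForm, this]

/-- Smooth functions and coefficients on an open set agree near a compact subset with global ones;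
`T` is the multiplication by a cutoff function. -/
theorem exists_global (hW : IsOpen W) {K : Set (EuclideanSpace ℝ (Fin n))} (hK : IsCompact K)
    (hKW : K ⊆ W) (hA : ∀ i j, ContDiffOn ℝ ∞ (fun x => A x i j) W) (hs : ∀ x ∈ W, (A x).IsSymm) :
    ∃ (a : EuclideanSpace ℝ (Fin n) → Matrix (Fin n) (Fin n) ℝ)
      (T : (EuclideanSpace ℝ (Fin n) → ℝ) → EuclideanSpace ℝ (Fin n) → ℝ)
      (U : Set (EuclideanSpace ℝ (Fin n))), (∀ i j, ContDiff ℝ ∞ fun x => a x i j) ∧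
      (∀ x, (a x).IsSymm) ∧ IsOpen U ∧ K ⊆ U ∧ U ⊆ W ∧ (∀ x ∈ U, a x = A x) ∧
      (∀ f, ContDiffOn ℝ ∞ f W → ContDiff ℝ ∞ (T f)) ∧ ∀ f, ∀ x ∈ U, T f x = f x := by
  obtain ⟨χ, U, hχ, hχc, hχW, h01, hU, hKU, hUW, hU1⟩ := exists_cutoff hW hK hKW
  refine ⟨fun x => χ x • A x, fun f x => χ x * f x, U, fun i j => ?_, fun x => ?_, hU, hKU, hUW,
    fun x hx => ?_, fun f hf => contDiff_mul_of_tsupport_subset hW hχ hχW hf, fun f x hx => ?_⟩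
  · simp only [Matrix.smul_apply, smul_eq_mul]
    exact contDiff_mul_of_tsupport_subset hW hχ hχW (hA i j)
  · by_cases hx : x ∈ tsupport χ
    · exact (hs x (hχW hx)).smul _
    · simp only [image_eq_zero_of_notMem_tsupport hx, zero_smul]
      exact isSymm_zero
  · simp [hU1 x hx]
  · simp [hU1 x hx]

theorem eventuallyEq_of_isOpen {β : Type*} {U : Set (EuclideanSpace ℝ (Fin n))} (hU : IsOpen U)
    {f g : EuclideanSpace ℝ (Fin n) → β} (h : ∀ x ∈ U, f x = g x) {x : EuclideanSpace ℝ (Fin n)}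
    (hx : x ∈ U) : f =ᶠ[𝓝 x] g := by
  filter_upwards [hU.mem_nhds hx] with y hy using h y hy

/-- Green's formula with coefficients that are smooth near the support of `η`. -/
theorem integral_mul_divForm_of_tsupport_subset (hW : IsOpen W)
    (hA : ∀ i j, ContDiffOn ℝ ∞ (fun x => A x i j) W) (hs : ∀ x ∈ W, (A x).IsSymm)
    (hη : ContDiff ℝ ∞ η) (hc : HasCompactSupport η) (hηW : tsupport η ⊆ W)
    (hf : ContDiffOn ℝ ∞ f W) : ∫ x, η x * divForm A f x = -∫ x, gradForm A η f x := by
  obtain ⟨a, T, U, ha, has, hU, hKU, hUW, haA, hT, hTf⟩ := exists_global hW hc hηW hA hs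
  have key := integral_mul_divForm ha hη (hT f hf) hc
  have e1 : ∀ x, η x * divForm a (T f) x = η x * divForm A f x := fun x => by
    by_cases hx : x ∈ tsupport η
    · rw [divForm_congr (eventuallyEq_of_isOpen hU haA (hKU hx))
        (eventuallyEq_of_isOpen hU (hTf f) (hKU hx))]
    · rw [image_eq_zero_of_notMem_tsupport hx]; ring
  have e2 : ∀ x, gradForm a η (T f) x = gradForm A η f x := fun x => by
    by_cases hx : x ∈ tsupport η
    · exact gradForm_congr (haA x (hKU hx)) EventuallyEq.rfl
        (eventuallyEq_of_isOpen hU (hTf f) (hKU hx))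
    · rw [gradForm_eq_zero_of_notMem_tsupport _ _ hx, gradForm_eq_zero_of_notMem_tsupport _ _ hx]
  simpa only [e1, e2] using key

theorem integral_mul_divForm_comm_of_tsupport_subset (hW : IsOpen W)
    (hA : ∀ i j, ContDiffOn ℝ ∞ (fun x => A x i j) W) (hs : ∀ x ∈ W, (A x).IsSymm)
    (hη : ContDiff ℝ ∞ η) (hc : HasCompactSupport η) (hηW : tsupport η ⊆ W)
    (hf : ContDiffOn ℝ ∞ f W) : ∫ x, η x * divForm A f x = ∫ x, f x * divForm A η x := by
  obtain ⟨a, T, U, ha, has, hU, hKU, hUW, haA, hT, hTf⟩ := exists_global hW hc hηW hA hs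
  have key := integral_mul_divForm_comm ha has hη (hT f hf) hc
  have e1 : ∀ x, η x * divForm a (T f) x = η x * divForm A f x := fun x => by
    by_cases hx : x ∈ tsupport η
    · rw [divForm_congr (eventuallyEq_of_isOpen hU haA (hKU hx))
        (eventuallyEq_of_isOpen hU (hTf f) (hKU hx))]
    · rw [image_eq_zero_of_notMem_tsupport hx]; ring
  have e2 : ∀ x, T f x * divForm a η x = f x * divForm A η x := fun x => by
    by_cases hx : x ∈ tsupport η
    · rw [hTf f x (hKU hx), divForm_congr (eventuallyEq_of_isOpen hU haA (hKU hx)) EventuallyEq.rfl]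
    · rw [divForm_eq_zero_of_notMem_tsupport _ hx, divForm_eq_zero_of_notMem_tsupport _ hx]
      ring
  simpa only [e1, e2] using key

theorem continuousOn_divForm (hW : IsOpen W)
    (hA : ∀ i j, ContDiffOn ℝ ∞ (fun x => A x i j) W) (hs : ∀ x ∈ W, (A x).IsSymm)
    (hf : ContDiffOn ℝ ∞ f W) : ContinuousOn (divForm A f) W := by
  intro x hx
  obtain ⟨a, T, U, ha, has, hU, hKU, hUW, haA, hT, hTf⟩ :=
    exists_global hW (isCompact_singleton (x := x)) (Set.singleton_subset_iff.2 hx) hA hs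
  have hxU : x ∈ U := hKU rfl
  have : divForm a (T f) =ᶠ[𝓝 x] divForm A f := by
    filter_upwards [hU.mem_nhds hxU] with y hy
    exact divForm_congr (eventuallyEq_of_isOpen hU haA hy)
      (eventuallyEq_of_isOpen hU (hTf f) hy)
  exact ((contDiff_divForm ha (hT f hf)).continuous.continuousAt.congr this).continuousWithinAt

theorem contDiff_indicator (hW : IsOpen W) (hf : ContDiffOn ℝ ∞ f W)
    {K : Set (EuclideanSpace ℝ (Fin n))} (hK : IsCompact K) (hKW : K ⊆ W)
    (h0 : ∀ x ∈ W, x ∉ K → f x = 0) :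
    ContDiff ℝ ∞ (W.indicator f) ∧ HasCompactSupport (W.indicator f) ∧
      tsupport (W.indicator f) ⊆ K := by
  have hz : ∀ x, x ∉ K → W.indicator f x = 0 := fun x hx => by
    by_cases hxW : x ∈ W
    · rw [Set.indicator_of_mem hxW, h0 x hxW hx]
    · exact Set.indicator_of_notMem hxW f
  have hs : tsupport (W.indicator f) ⊆ K :=
    closure_minimal (fun x hx => by_contra fun h => hx (hz x h)) hK.isClosed
  refine ⟨contDiff_iff_contDiffAt.2 fun x => ?_, HasCompactSupport.intro hK hz, hs⟩
  by_cases hx : x ∈ W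
  · refine (hf.contDiffAt (hW.mem_nhds hx)).congr_of_eventuallyEq ?_
    exact eventuallyEq_of_isOpen hW (fun y hy => Set.indicator_of_mem hy f) hx
  · have : W.indicator f =ᶠ[𝓝 x] fun _ => 0 :=
      eventuallyEq_of_isOpen hK.isClosed.isOpen_compl (fun y hy => hz y hy) (fun h => hx (hKW h))
    exact contDiffAt_const.congr_of_eventuallyEq this

/-- If a diffeomorphism `τ` transforms the carré du champ of `A₀` to that of `A₁`, up to the
Jacobian determinant, then it does so for the operators in divergence form: both represent the same
functional on test functions. -/
theorem divForm_comp_diffeomorphism {Ω₁ Ω₀ : Set (EuclideanSpace ℝ (Fin n))} (hΩ₁ : IsOpen Ω₁)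
    (hΩ₀ : IsOpen Ω₀) {τ σ : EuclideanSpace ℝ (Fin n) → EuclideanSpace ℝ (Fin n)}
    (hτ : ContDiffOn ℝ ∞ τ Ω₁) (hσ : ContDiffOn ℝ ∞ σ Ω₀) (hτm : Set.MapsTo τ Ω₁ Ω₀)
    (hσm : Set.MapsTo σ Ω₀ Ω₁) (hστ : ∀ y ∈ Ω₁, σ (τ y) = y) (hτσ : ∀ y ∈ Ω₀, τ (σ y) = y)
    {A₁ A₀ : EuclideanSpace ℝ (Fin n) → Matrix (Fin n) (Fin n) ℝ}
    (hA₁ : ∀ i j, ContDiffOn ℝ ∞ (fun x => A₁ x i j) Ω₁) (hs₁ : ∀ x ∈ Ω₁, (A₁ x).IsSymm)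
    (hA₀ : ∀ i j, ContDiffOn ℝ ∞ (fun x => A₀ x i j) Ω₀) (hs₀ : ∀ x ∈ Ω₀, (A₀ x).IsSymm)
    (H : ∀ y ∈ Ω₁, ∀ f h : EuclideanSpace ℝ (Fin n) → ℝ, DifferentiableAt ℝ f (τ y) →
      DifferentiableAt ℝ h (τ y) → gradForm A₁ (fun z => f (τ z)) (fun z => h (τ z)) y =
        |(fderiv ℝ τ y).det| * gradForm A₀ f h (τ y))
    (hf : ContDiffOn ℝ ∞ f Ω₀) {y : EuclideanSpace ℝ (Fin n)} (hy : y ∈ Ω₁) :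
    divForm A₁ (fun z => f (τ z)) y = |(fderiv ℝ τ y).det| * divForm A₀ f (τ y) := by
  have hfτ : ContDiffOn ℝ ∞ (fun z => f (τ z)) Ω₁ := hf.comp hτ hτm
  have hPc := continuousOn_divForm hΩ₁ hA₁ hs₁ hfτ
  have hdet : ContinuousOn (fun y => |(fderiv ℝ τ y).det|) Ω₁ :=
    (ContinuousLinearMap.continuous_det.comp_continuousOn
      (hτ.continuousOn_fderiv_of_isOpen hΩ₁ (by simp))).abs
  have hQc : ContinuousOn (fun y => |(fderiv ℝ τ y).det| * divForm A₀ f (τ y)) Ω₁ :=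
    hdet.mul ((continuousOn_divForm hΩ₀ hA₀ hs₀ hf).comp hτ.continuousOn hτm)
  have himg : τ '' Ω₁ = Ω₀ := Set.Subset.antisymm (Set.image_subset_iff.2 hτm)
    fun z hz => ⟨σ z, hσm hz, hτσ z hz⟩
  have hinj : Set.InjOn τ Ω₁ := fun a ha b hb hab => by rw [← hστ a ha, hab, hστ b hb]
  have hder : ∀ x ∈ Ω₁, HasFDerivWithinAt τ (fderiv ℝ τ x) Ω₁ x := fun x hx =>
    (((hτ.contDiffAt (hΩ₁.mem_nhds hx)).differentiableAt (by simp)).hasFDerivAt).hasFDerivWithinAt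
  have hcv := fun g : EuclideanSpace ℝ (Fin n) → ℝ =>
    integral_image_eq_integral_abs_det_fderiv_smul volume hΩ₁.measurableSet hder hinj g
  simp only [himg, smul_eq_mul] at hcv
  -- Both sides have the same integrals against test functions, by Green's formula for `A₁` and `A₀`.
  have weak : ∀ η : EuclideanSpace ℝ (Fin n) → ℝ, ContDiff ℝ ∞ η → HasCompactSupport η →
      tsupport η ⊆ Ω₁ → ∫ y, η y * divForm A₁ (fun z => f (τ z)) y =
        ∫ y, η y * (|(fderiv ℝ τ y).det| * divForm A₀ f (τ y)) := by
    intro η hη hc hηΩ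
    obtain ⟨hη', hc', hs'⟩ := contDiff_indicator hΩ₀ (f := fun z => η (σ z))
      (hη.comp_contDiffOn hσ)
      (hc.isCompact.image_of_continuousOn (hτ.continuousOn.mono hηΩ))
      ((Set.image_mono hηΩ).trans himg.subset) (fun x hx hxK => by
        by_contra h
        exact hxK ⟨σ x, subset_tsupport _ h, hτσ x hx⟩)
    set η' := Ω₀.indicator fun z => η (σ z) with hη'def
    have hη'Ω : tsupport η' ⊆ Ω₀ := hs'.trans ((Set.image_mono hηΩ).trans himg.subset)
    have hηη' : ∀ y ∈ Ω₁, η' (τ y) = η y := fun y hy => by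
      rw [hη'def, Set.indicator_of_mem (hτm hy), hστ y hy]
    have r1 : ∀ F : EuclideanSpace ℝ (Fin n) → ℝ, (∀ y, y ∉ Ω₁ → F y = 0) →
        ∫ y, F y = ∫ y in Ω₁, F y := fun F hF =>
      (setIntegral_eq_integral_of_forall_compl_eq_zero hF).symm
    have r0 : ∀ F : EuclideanSpace ℝ (Fin n) → ℝ, (∀ y, y ∉ Ω₀ → F y = 0) →
        ∫ y, F y = ∫ y in Ω₀, F y := fun F hF =>
      (setIntegral_eq_integral_of_forall_compl_eq_zero hF).symm
    have hz1 : ∀ y, y ∉ Ω₁ → η y = 0 := fun y hy =>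
      image_eq_zero_of_notMem_tsupport fun h => hy (hηΩ h)
    rw [integral_mul_divForm_of_tsupport_subset hΩ₁ hA₁ hs₁ hη hc hηΩ hfτ,
      r1 _ fun y hy => gradForm_eq_zero_of_notMem_tsupport _ _ fun h => hy (hηΩ h),
      r1 (fun y => η y * _) fun y hy => by rw [hz1 y hy, zero_mul]]
    have e1 : ∫ y in Ω₁, gradForm A₁ η (fun z => f (τ z)) y =
        ∫ y in Ω₁, |(fderiv ℝ τ y).det| * gradForm A₀ η' f (τ y) := by
      refine setIntegral_congr_fun hΩ₁.measurableSet fun y hy => ?_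
      rw [← H y hy η' f (hη'.diffAt _)
        ((hf.contDiffAt (hΩ₀.mem_nhds (hτm hy))).differentiableAt (by simp))]
      exact gradForm_congr rfl (eventuallyEq_of_isOpen hΩ₁ (fun z hz => (hηη' z hz).symm) hy)
        EventuallyEq.rfl
    have e2 : ∫ y in Ω₁, η y * (|(fderiv ℝ τ y).det| * divForm A₀ f (τ y)) =
        ∫ y in Ω₁, |(fderiv ℝ τ y).det| * (η' (τ y) * divForm A₀ f (τ y)) := by
      refine setIntegral_congr_fun hΩ₁.measurableSet fun y hy => ?_
      simp only [hηη' y hy]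
      ring
    rw [e1, e2, ← hcv (fun z => gradForm A₀ η' f z), ← hcv (fun z => η' z * divForm A₀ f z),
      ← r0 _ fun y hy => gradForm_eq_zero_of_notMem_tsupport _ _ fun h => hy (hη'Ω h),
      ← r0 (fun y => η' y * _) fun y hy => by
        rw [hη'def, Set.indicator_of_notMem hy, zero_mul],
      integral_mul_divForm_of_tsupport_subset hΩ₀ hA₀ hs₀ hη' hc' hη'Ω hf]
  have hae := hΩ₁.ae_eq_zero_of_integral_contDiff_smul_eq_zero (μ := volume)
    (f := fun y => divForm A₁ (fun z => f (τ z)) y -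
      |(fderiv ℝ τ y).det| * divForm A₀ f (τ y))
    ((hPc.sub hQc).locallyIntegrableOn hΩ₁.measurableSet) (fun η hη hc hηΩ => by
      have i1 : ∀ F : EuclideanSpace ℝ (Fin n) → ℝ, ContinuousOn F Ω₁ →
          Integrable fun y => η y * F y := fun F hF => by
        have hcont : Continuous fun y => η y * F y := by
          refine continuous_iff_continuousAt.2 fun x => ?_
          by_cases hx : x ∈ tsupport η
          · exact hη.continuous.continuousAt.mul (hF.continuousAt (hΩ₁.mem_nhds (hηΩ hx)))
          · have : (fun y => η y * F y) =ᶠ[𝓝 x] fun _ => 0 := by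
              filter_upwards [notMem_tsupport_iff_eventuallyEq.1 hx] with y hy
              simp [hy]
            exact continuousAt_const.congr this.symm
        exact hcont.integrable_of_hasCompactSupport hc.mul_right
      simp only [smul_eq_mul, mul_sub]
      rw [integral_sub (i1 _ hPc) (i1 _ hQc), weak η hη hc hηΩ, sub_self])
  have hae' : (divForm A₁ fun z => f (τ z)) =ᵐ[volume.restrict Ω₁]
      fun y => |(fderiv ℝ τ y).det| * divForm A₀ f (τ y) := by
    rw [EventuallyEq, ae_restrict_iff' hΩ₁.measurableSet]
    filter_upwards [hae] with y hy hyΩ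
    exact sub_eq_zero.1 (hy hyΩ)
  exact Measure.eqOn_open_of_ae_eq hae' hΩ₁ hPc hQc hy

end ChangeOfVariables
end RiemannianSchrodinger

/-! ### The metric and the Laplacian in charts -/

namespace RiemannianSchrodinger

section MetricInCharts

open Filter Topology Matrix

variable {n : ℕ} {M : Type*} [TopologicalSpace M] [ChartedSpace (EuclideanSpace ℝ (Fin n)) M]
  [IsManifold (𝓡 n) ∞ M]

theorem isManifold_one : IsManifold (𝓡 n) 1 M := IsManifold.of_le (n := ∞) (by simp)

theorem contMDiffOn_chart_symm (x : M) :
    ContMDiffOn 𝓘(ℝ, EuclideanSpace ℝ (Fin n)) (𝓡 n) ∞ (extChartAt (𝓡 n) x).symm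
      (extChartAt (𝓡 n) x).target := contMDiffOn_extChartAt_symm x

theorem mdifferentiableAt_chart_symm (x : M) {y : EuclideanSpace ℝ (Fin n)}
    (hy : y ∈ (extChartAt (𝓡 n) x).target) :
    MDifferentiableAt 𝓘(ℝ, EuclideanSpace ℝ (Fin n)) (𝓡 n) (extChartAt (𝓡 n) x).symm y :=
  ((contMDiffOn_chart_symm x).contMDiffAt
    ((isOpen_extChartAt_target x).mem_nhds hy)).mdifferentiableAt (by simp)

theorem contDiffOn_metricMatrix (g : SmoothMetric n M) (x : M) (i j : Fin n) :
    ContDiffOn ℝ ∞ (fun y => metricMatrix g x y i j) (extChartAt (𝓡 n) x).target := by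
  have ho := isOpen_extChartAt_target (I := 𝓡 n) x
  have hcoord : ∀ i : Fin n, ContMDiffOn 𝓘(ℝ, EuclideanSpace ℝ (Fin n)) ((𝓡 n).tangent) ∞
      (fun y => Bundle.TotalSpace.mk' (EuclideanSpace ℝ (Fin n))
        (E := fun x : M => TangentSpace (𝓡 n) x)
        ((extChartAt (𝓡 n) x).symm y) (coordVector n x y i)) (extChartAt (𝓡 n) x).target := by
    intro i
    have h1 := (contMDiffOn_chart_symm x).contMDiffOn_tangentMapWithin (m := ∞) (by simp)
      ho.uniqueMDiffOn
    have h2 : ContMDiffOn 𝓘(ℝ, EuclideanSpace ℝ (Fin n)) 𝓘(ℝ, EuclideanSpace ℝ (Fin n)).tangent ∞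
        (fun y => (Bundle.TotalSpace.mk' (EuclideanSpace ℝ (Fin n)) y
          (EuclideanSpace.single i (1 : ℝ)) :
            TangentBundle 𝓘(ℝ, EuclideanSpace ℝ (Fin n)) (EuclideanSpace ℝ (Fin n))))
        (extChartAt (𝓡 n) x).target :=
      contMDiffOn_vectorSpace_iff_contDiffOn.2 contDiffOn_const
    refine (h1.comp h2 fun y hy => hy).congr fun y hy => ?_
    simp only [Function.comp_apply, tangentMapWithin, coordVector]
    rw [mfderivWithin_of_isOpen ho hy]
  have key : ContMDiffOn 𝓘(ℝ, EuclideanSpace ℝ (Fin n)) ((𝓡 n).prod 𝓘(ℝ)) ∞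
      (fun y => Bundle.TotalSpace.mk' ℝ (E := Bundle.Trivial M ℝ) ((extChartAt (𝓡 n) x).symm y)
        (g.inner ((extChartAt (𝓡 n) x).symm y) (coordVector n x y i) (coordVector n x y j)))
      (extChartAt (𝓡 n) x).target := by
    apply ContMDiffOn.clm_bundle_apply₂ (F₁ := EuclideanSpace ℝ (Fin n))
      (F₂ := EuclideanSpace ℝ (Fin n))
    · exact g.contMDiff.comp_contMDiffOn (contMDiffOn_chart_symm x)
    · exact hcoord i
    · exact hcoord j
  intro y hy
  have := key y hy
  simp only [Bundle.contMDiffWithinAt_totalSpace] at this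
  exact this.2.contDiffWithinAt

/-- The derivative of the inverse chart at `y`, as an endomorphism of the model space, to which the
tangent spaces of `M` are definitionally equal. -/
noncomputable def chartDeriv (n : ℕ) {M : Type*} [TopologicalSpace M]
    [ChartedSpace (EuclideanSpace ℝ (Fin n)) M] (x : M) (y : EuclideanSpace ℝ (Fin n)) :
    EuclideanSpace ℝ (Fin n) →L[ℝ] EuclideanSpace ℝ (Fin n) :=
  mfderiv 𝓘(ℝ, EuclideanSpace ℝ (Fin n)) (𝓡 n) (extChartAt (𝓡 n) x).symm y

/-- The metric at `p` as a bilinear form on the model space. -/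
noncomputable def modelInner (g : SmoothMetric n M) (p : M) :
    EuclideanSpace ℝ (Fin n) →L[ℝ] EuclideanSpace ℝ (Fin n) →L[ℝ] ℝ :=
  g.inner p

theorem metricMatrix_apply (g : SmoothMetric n M) (x : M) (y : EuclideanSpace ℝ (Fin n))
    (i j : Fin n) : metricMatrix g x y i j = modelInner g ((extChartAt (𝓡 n) x).symm y)
      (chartDeriv n x y (EuclideanSpace.single i 1))
      (chartDeriv n x y (EuclideanSpace.single j 1)) := rfl

theorem sum_single (v : EuclideanSpace ℝ (Fin n)) :
    v = ∑ i, v i • EuclideanSpace.single i (1 : ℝ) := by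
  ext k
  simp [Finset.sum_apply, Pi.single_apply]

theorem modelInner_chartDeriv (g : SmoothMetric n M) (x : M) (y v w : EuclideanSpace ℝ (Fin n)) :
    modelInner g ((extChartAt (𝓡 n) x).symm y) (chartDeriv n x y v) (chartDeriv n x y w) =
      v.ofLp ⬝ᵥ (metricMatrix g x y *ᵥ w.ofLp) := by
  conv_lhs => rw [sum_single v, sum_single w]
  simp only [map_sum, map_smul, _root_.sum_apply, _root_.smul_apply,
    smul_eq_mul, dotProduct, mulVec, metricMatrix_apply, Finset.mul_sum]
  rw [Finset.sum_comm]
  exact Finset.sum_congr rfl fun i _ => Finset.sum_congr rfl fun j _ => by ring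

theorem isSymm_metricMatrix (g : SmoothMetric n M) (x : M) (y : EuclideanSpace ℝ (Fin n)) :
    (metricMatrix g x y).IsSymm := by
  ext i j
  exact g.symm _ _ _

theorem injective_chartDeriv (x : M) {y : EuclideanSpace ℝ (Fin n)}
    (hy : y ∈ (extChartAt (𝓡 n) x).target) : Function.Injective (chartDeriv n x y) := by
  have := isManifold_one (n := n) (M := M)
  have h := isInvertible_mfderivWithin_extChartAt_symm (I := 𝓡 n) hy
  rw [ModelWithCorners.range_eq_univ, mfderivWithin_univ] at h
  exact h.injective

theorem posDef_metricMatrix (g : SmoothMetric n M) (x : M) {y : EuclideanSpace ℝ (Fin n)}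
    (hy : y ∈ (extChartAt (𝓡 n) x).target) : (metricMatrix g x y).PosDef := by
  refine PosDef.of_dotProduct_mulVec_pos ?_ fun v hv => ?_
  · rw [IsHermitian, conjTranspose_eq_transpose_of_trivial]
    exact isSymm_metricMatrix g x y
  · have h1 := modelInner_chartDeriv g x y (WithLp.toLp 2 v) (WithLp.toLp 2 v)
    have h2 : chartDeriv n x y (WithLp.toLp 2 v) ≠ 0 := fun h => hv (by
      have := injective_chartDeriv x hy (h.trans (map_zero _).symm)
      simpa using this)
    have h3 := g.pos ((extChartAt (𝓡 n) x).symm y) (chartDeriv n x y (WithLp.toLp 2 v)) h2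
    simp only [star_trivial]
    rw [← h1]
    exact h3

theorem volDensity_pos (g : SmoothMetric n M) (x : M) {y : EuclideanSpace ℝ (Fin n)}
    (hy : y ∈ (extChartAt (𝓡 n) x).target) : 0 < volDensity g x y :=
  Real.sqrt_pos.2 (posDef_metricMatrix g x hy).det_pos

theorem contDiffOn_volDensity (g : SmoothMetric n M) (x : M) :
    ContDiffOn ℝ ∞ (volDensity g x) (extChartAt (𝓡 n) x).target :=
  (contDiffOn_det (contDiffOn_metricMatrix g x)).sqrt fun _ hy =>
    (posDef_metricMatrix g x hy).det_pos.ne'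

/-- The coefficients `√(det g) gⁱʲ` of the Laplacian in a chart. -/
noncomputable def chartCoeff (g : SmoothMetric n M) (x : M) (y : EuclideanSpace ℝ (Fin n)) :
    Matrix (Fin n) (Fin n) ℝ :=
  volDensity g x y • (metricMatrix g x y)⁻¹

theorem contDiffOn_chartCoeff (g : SmoothMetric n M) (x : M) (i j : Fin n) :
    ContDiffOn ℝ ∞ (fun y => chartCoeff g x y i j) (extChartAt (𝓡 n) x).target :=
  (contDiffOn_volDensity g x).mul (contDiffOn_inv (contDiffOn_metricMatrix g x)
    (fun _ hy => (posDef_metricMatrix g x hy).det_pos.ne') i j)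

theorem posDef_chartCoeff (g : SmoothMetric n M) (x : M) {y : EuclideanSpace ℝ (Fin n)}
    (hy : y ∈ (extChartAt (𝓡 n) x).target) : (chartCoeff g x y).PosDef :=
  (posDef_metricMatrix g x hy).inv.smul (volDensity_pos g x hy)

theorem isSymm_chartCoeff (g : SmoothMetric n M) (x : M) (y : EuclideanSpace ℝ (Fin n)) :
    (chartCoeff g x y).IsSymm := by
  rw [IsSymm, chartCoeff, transpose_smul, transpose_nonsing_inv, isSymm_metricMatrix]

theorem laplacian_eq_divForm_self (g : SmoothMetric n M) (ψ : M → ℝ) (x : M) :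
    laplacian g ψ x = (volDensity g x (extChartAt (𝓡 n) x x))⁻¹ *
      divForm (chartCoeff g x) (fun z => ψ ((extChartAt (𝓡 n) x).symm z))
        (extChartAt (𝓡 n) x x) := by
  simp only [laplacian, divForm, pd, chartCoeff, Matrix.smul_apply, smul_eq_mul, Finset.mul_sum,
    mul_assoc]

/-- The overlap of two charts, in the coordinates of the first one. -/
def overlap (n : ℕ) {M : Type*} [TopologicalSpace M]
    [ChartedSpace (EuclideanSpace ℝ (Fin n)) M] (x₁ x₀ : M) : Set (EuclideanSpace ℝ (Fin n)) :=
  (extChartAt (𝓡 n) x₁).target ∩ (extChartAt (𝓡 n) x₁).symm ⁻¹' (extChartAt (𝓡 n) x₀).source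

/-- The change of coordinates between two charts. -/
noncomputable def transition (n : ℕ) {M : Type*} [TopologicalSpace M]
    [ChartedSpace (EuclideanSpace ℝ (Fin n)) M] (x₁ x₀ : M) (y : EuclideanSpace ℝ (Fin n)) :
    EuclideanSpace ℝ (Fin n) :=
  extChartAt (𝓡 n) x₀ ((extChartAt (𝓡 n) x₁).symm y)

variable (x₁ x₀ : M)

theorem isOpen_overlap : IsOpen (overlap n x₁ x₀) :=
  (continuousOn_extChartAt_symm x₁).isOpen_inter_preimage (isOpen_extChartAt_target x₁)
    (isOpen_extChartAt_source x₀)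

theorem contDiffOn_transition : ContDiffOn ℝ ∞ (transition n x₁ x₀) (overlap n x₁ x₀) := by
  have h := contDiffOn_ext_coord_change (I := 𝓡 n) (n := ∞) x₀ x₁
  rwa [PartialEquiv.trans_source, PartialEquiv.symm_source] at h

variable {x₁ x₀} {y : EuclideanSpace ℝ (Fin n)}

theorem chart_symm_transition (hy : y ∈ overlap n x₁ x₀) :
    (extChartAt (𝓡 n) x₀).symm (transition n x₁ x₀ y) = (extChartAt (𝓡 n) x₁).symm y :=
  (extChartAt (𝓡 n) x₀).left_inv hy.2

theorem mapsTo_transition : Set.MapsTo (transition n x₁ x₀) (overlap n x₁ x₀) (overlap n x₀ x₁) :=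
  fun y hy => ⟨(extChartAt (𝓡 n) x₀).map_source hy.2, by
    rw [Set.mem_preimage, chart_symm_transition hy]
    exact (extChartAt (𝓡 n) x₁).map_target hy.1⟩

theorem transition_transition (hy : y ∈ overlap n x₁ x₀) :
    transition n x₀ x₁ (transition n x₁ x₀ y) = y := by
  rw [transition, chart_symm_transition hy, (extChartAt (𝓡 n) x₁).right_inv hy.1]

theorem differentiableAt_transition (hy : y ∈ overlap n x₁ x₀) :
    DifferentiableAt ℝ (transition n x₁ x₀) y :=
  ((contDiffOn_transition x₁ x₀).contDiffAt
    ((isOpen_overlap x₁ x₀).mem_nhds hy)).differentiableAt (by simp)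

theorem chartDeriv_transition (hy : y ∈ overlap n x₁ x₀) (v : EuclideanSpace ℝ (Fin n)) :
    chartDeriv n x₁ y v =
      chartDeriv n x₀ (transition n x₁ x₀ y) (fderiv ℝ (transition n x₁ x₀) y v) := by
  have h1 : (extChartAt (𝓡 n) x₁).symm =ᶠ[𝓝 y]
      (extChartAt (𝓡 n) x₀).symm ∘ transition n x₁ x₀ :=
    eventuallyEq_of_isOpen (isOpen_overlap x₁ x₀) (fun z hz => (chart_symm_transition hz).symm) hy
  have h2 := mfderiv_comp (I := 𝓘(ℝ, EuclideanSpace ℝ (Fin n)))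
    (I' := 𝓘(ℝ, EuclideanSpace ℝ (Fin n))) (I'' := 𝓡 n) (f := transition n x₁ x₀)
    (g := (extChartAt (𝓡 n) x₀).symm) y
    (mdifferentiableAt_chart_symm x₀ (mapsTo_transition hy).1)
    (differentiableAt_transition hy).mdifferentiableAt
  have h3 : chartDeriv n x₁ y = (chartDeriv n x₀ (transition n x₁ x₀ y)).comp
      (fderiv ℝ (transition n x₁ x₀) y) := by
    rw [mfderiv_eq_fderiv] at h2
    exact h1.mfderiv_eq.trans h2
  rw [h3]; rfl

/-- The Jacobian matrix of a change of coordinates. -/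
noncomputable def jacobian (n : ℕ) {M : Type*} [TopologicalSpace M]
    [ChartedSpace (EuclideanSpace ℝ (Fin n)) M] (x₁ x₀ : M) (y : EuclideanSpace ℝ (Fin n)) :
    Matrix (Fin n) (Fin n) ℝ :=
  Matrix.of fun k i => fderiv ℝ (transition n x₁ x₀) y (EuclideanSpace.single i 1) k

theorem fderiv_transition_eq (v : EuclideanSpace ℝ (Fin n)) :
    (fderiv ℝ (transition n x₁ x₀) y v).ofLp = jacobian n x₁ x₀ y *ᵥ v.ofLp := by
  conv_lhs => rw [sum_single v]
  ext k
  simp [mulVec, dotProduct, jacobian, mul_comm]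

theorem det_fderiv_transition :
    (fderiv ℝ (transition n x₁ x₀) y).det = (jacobian n x₁ x₀ y).det := by
  rw [ContinuousLinearMap.det, ← LinearMap.det_toLpLin 2]
  congr 1
  ext v k
  simp [fderiv_transition_eq, toLpLin_apply]

theorem metricMatrix_transition (g : SmoothMetric n M) (hy : y ∈ overlap n x₁ x₀) :
    metricMatrix g x₁ y = (jacobian n x₁ x₀ y)ᵀ * metricMatrix g x₀ (transition n x₁ x₀ y) *
      jacobian n x₁ x₀ y := by
  ext i j
  rw [metricMatrix_apply, chartDeriv_transition hy, chartDeriv_transition hy,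
    ← chart_symm_transition hy, modelInner_chartDeriv, fderiv_transition_eq, fderiv_transition_eq]
  simp only [PiLp.ofLp_single, mulVec_single_one, Matrix.mul_assoc]
  simp [Matrix.mul_apply, dotProduct, mulVec]

theorem volDensity_transition (g : SmoothMetric n M) (hy : y ∈ overlap n x₁ x₀) :
    volDensity g x₁ y = |(fderiv ℝ (transition n x₁ x₀) y).det| *
      volDensity g x₀ (transition n x₁ x₀ y) := by
  rw [volDensity, metricMatrix_transition g hy, det_mul, det_mul, det_transpose, volDensity,
    det_fderiv_transition, ← Real.sqrt_sq_eq_abs, ← Real.sqrt_mul (sq_nonneg _)]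
  congr 1; ring

theorem det_jacobian_ne_zero (g : SmoothMetric n M) (hy : y ∈ overlap n x₁ x₀) :
    (jacobian n x₁ x₀ y).det ≠ 0 := fun h => by
  have := volDensity_transition g hy
  rw [det_fderiv_transition, h, abs_zero, zero_mul] at this
  exact (volDensity_pos g x₁ hy.1).ne' this

theorem pd_comp_transition {f : EuclideanSpace ℝ (Fin n) → ℝ} (hy : y ∈ overlap n x₁ x₀)
    (hf : DifferentiableAt ℝ f (transition n x₁ x₀ y)) :
    (fun i => pd i (fun z => f (transition n x₁ x₀ z)) y) =
      (jacobian n x₁ x₀ y)ᵀ *ᵥ fun k => pd k f (transition n x₁ x₀ y) := by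
  ext i
  have h : fderiv ℝ (fun z => f (transition n x₁ x₀ z)) y =
      (fderiv ℝ f (transition n x₁ x₀ y)).comp (fderiv ℝ (transition n x₁ x₀) y) :=
    fderiv_comp y hf (differentiableAt_transition hy)
  rw [pd, h, ContinuousLinearMap.comp_apply]
  conv_lhs => rw [sum_single (fderiv ℝ (transition n x₁ x₀) y _)]
  simp [mulVec, dotProduct, jacobian, pd]

theorem gradForm_chartCoeff_transition (g : SmoothMetric n M) (hy : y ∈ overlap n x₁ x₀)
    {f h : EuclideanSpace ℝ (Fin n) → ℝ} (hf : DifferentiableAt ℝ f (transition n x₁ x₀ y))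
    (hh : DifferentiableAt ℝ h (transition n x₁ x₀ y)) :
    gradForm (chartCoeff g x₁) (fun z => f (transition n x₁ x₀ z))
        (fun z => h (transition n x₁ x₀ z)) y =
      |(fderiv ℝ (transition n x₁ x₀) y).det| *
        gradForm (chartCoeff g x₀) f h (transition n x₁ x₀ y) := by
  have hJ := (det_jacobian_ne_zero g hy).isUnit
  have hinv : (metricMatrix g x₁ y)⁻¹ = (jacobian n x₁ x₀ y)⁻¹ *
      (metricMatrix g x₀ (transition n x₁ x₀ y))⁻¹ * ((jacobian n x₁ x₀ y)ᵀ)⁻¹ := by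
    rw [metricMatrix_transition g hy, Matrix.mul_inv_rev, Matrix.mul_inv_rev, Matrix.mul_assoc]
  have hJT : IsUnit ((jacobian n x₁ x₀ y)ᵀ).det := by rwa [det_transpose]
  rw [gradForm_eq_dotProduct (congrFun (pd_comp_transition hy hf))
    (congrFun (pd_comp_transition hy hh)), gradForm_eq_dotProduct (fun _ => rfl) (fun _ => rfl),
    chartCoeff, chartCoeff, volDensity_transition g hy, hinv]
  simp only [smul_mulVec, dotProduct_smul, smul_eq_mul, mul_assoc]
  congr 2
  rw [mulVec_mulVec, Matrix.mul_assoc, Matrix.mul_assoc, nonsing_inv_mul _ hJT, Matrix.mul_one, ← mulVec_mulVec,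
    mulVec_transpose, ← dotProduct_mulVec, mulVec_mulVec, mul_nonsing_inv _ hJ, one_mulVec]

/-- The coordinate expression of the Laplacian is valid in every chart. -/
theorem laplacian_eq_divForm (g : SmoothMetric n M) {ψ : M → ℝ}
    (hψ : ContMDiff (𝓡 n) 𝓘(ℝ, ℝ) ∞ ψ) {x₀ x : M} (hx : x ∈ (extChartAt (𝓡 n) x₀).source) :
    laplacian g ψ x = (volDensity g x₀ (extChartAt (𝓡 n) x₀ x))⁻¹ *
      divForm (chartCoeff g x₀) (fun z => ψ ((extChartAt (𝓡 n) x₀).symm z))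
        (extChartAt (𝓡 n) x₀ x) := by
  have hxx : extChartAt (𝓡 n) x x ∈ overlap n x x₀ := by
    refine ⟨mem_extChartAt_target x, ?_⟩
    rwa [Set.mem_preimage, extChartAt_to_inv]
  have hτ : transition n x x₀ (extChartAt (𝓡 n) x x) = extChartAt (𝓡 n) x₀ x := by
    rw [transition, extChartAt_to_inv]
  have hs : ContDiffOn ℝ ∞ (fun z => ψ ((extChartAt (𝓡 n) x₀).symm z)) (overlap n x₀ x) :=
    ((hψ.comp_contMDiffOn (contMDiffOn_chart_symm x₀)).contDiffOn).mono Set.inter_subset_left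
  have key := divForm_comp_diffeomorphism (isOpen_overlap x x₀) (isOpen_overlap x₀ x)
    (contDiffOn_transition x x₀) (contDiffOn_transition x₀ x) mapsTo_transition mapsTo_transition
    (fun y hy => transition_transition hy) (fun y hy => transition_transition hy)
    (A₁ := chartCoeff g x) (A₀ := chartCoeff g x₀)
    (fun i j => (contDiffOn_chartCoeff g x i j).mono Set.inter_subset_left)
    (fun y _ => isSymm_chartCoeff g x y)
    (fun i j => (contDiffOn_chartCoeff g x₀ i j).mono Set.inter_subset_left)
    (fun y _ => isSymm_chartCoeff g x₀ y)
    (fun y hy f h hf hh => gradForm_chartCoeff_transition g hy hf hh) hs hxx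
  have hcongr : divForm (chartCoeff g x) (fun z => ψ ((extChartAt (𝓡 n) x).symm z))
      (extChartAt (𝓡 n) x x) = divForm (chartCoeff g x)
        (fun z => ψ ((extChartAt (𝓡 n) x₀).symm (transition n x x₀ z))) (extChartAt (𝓡 n) x x) :=
    divForm_congr EventuallyEq.rfl (eventuallyEq_of_isOpen (isOpen_overlap x x₀)
      (fun z hz => by rw [chart_symm_transition hz]) hxx)
  have hdet : |(fderiv ℝ (transition n x x₀) (extChartAt (𝓡 n) x x)).det| ≠ 0 := by
    rw [det_fderiv_transition]
    exact abs_ne_zero.2 (det_jacobian_ne_zero g hxx)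
  rw [laplacian_eq_divForm_self, hcongr, key, volDensity_transition g hxx, hτ]
  field_simp

end MetricInCharts
end RiemannianSchrodinger

/-! ### The Riemannian volume -/

namespace RiemannianSchrodinger

section RiemannianVolume

open Filter Topology Matrix

variable {n : ℕ} {M : Type*} [TopologicalSpace M] [ChartedSpace (EuclideanSpace ℝ (Fin n)) M]
  [IsManifold (𝓡 n) ∞ M] [MeasurableSpace M] [BorelSpace M]

theorem measurableSet_target_inter_preimage (x : M) {S : Set M} (hS : MeasurableSet S) :
    MeasurableSet ((extChartAt (𝓡 n) x).target ∩ (extChartAt (𝓡 n) x).symm ⁻¹' S) := by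
  have ht := (isOpen_extChartAt_target (I := 𝓡 n) x).measurableSet
  have h1 : Measurable ((extChartAt (𝓡 n) x).target.domRestrict (extChartAt (𝓡 n) x).symm) :=
    (continuousOn_extChartAt_symm x).domRestrict.measurable
  have h2 := ht.subtype_image (h1 hS)
  convert h2 using 1
  ext y
  refine ⟨fun hy => ⟨⟨y, hy.1⟩, hy.2, rfl⟩, ?_⟩
  rintro ⟨z, hz, rfl⟩
  exact ⟨z.2, hz⟩

theorem aemeasurable_chart_symm (g : SmoothMetric n M) (x : M) :
    AEMeasurable (extChartAt (𝓡 n) x).symm ((volume.restrict (extChartAt (𝓡 n) x).target).withDensity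
      (fun y => ENNReal.ofReal (volDensity g x y))) :=
  ((continuousOn_extChartAt_symm x).aemeasurable
    (isOpen_extChartAt_target x).measurableSet).mono_ac (withDensity_absolutelyContinuous _ _)

theorem chartVolume_apply (g : SmoothMetric n M) (x : M) {S : Set M} (hS : MeasurableSet S) :
    chartVolume g x S = ∫⁻ y in (extChartAt (𝓡 n) x).target ∩ (extChartAt (𝓡 n) x).symm ⁻¹' S,
      ENNReal.ofReal (volDensity g x y) := by
  rw [chartVolume, Measure.map_apply_of_aemeasurable (aemeasurable_chart_symm g x) hS,
    withDensity_apply', Measure.restrict_restrict' (isOpen_extChartAt_target x).measurableSet,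
    Set.inter_comm]

/-- The change of variables formula: the volumes in two charts agree on the overlap. -/
theorem chartVolume_eq_of_subset (g : SmoothMetric n M) (x₁ x₀ : M) {S : Set M}
    (hS : MeasurableSet S) (h₁ : S ⊆ (extChartAt (𝓡 n) x₁).source)
    (h₀ : S ⊆ (extChartAt (𝓡 n) x₀).source) : chartVolume g x₁ S = chartVolume g x₀ S := by
  rw [chartVolume_apply g x₁ hS, chartVolume_apply g x₀ hS]
  set P₁ := (extChartAt (𝓡 n) x₁).target ∩ (extChartAt (𝓡 n) x₁).symm ⁻¹' S with hP₁
  set P₀ := (extChartAt (𝓡 n) x₀).target ∩ (extChartAt (𝓡 n) x₀).symm ⁻¹' S with hP₀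
  have hsub₁ : P₁ ⊆ overlap n x₁ x₀ := fun y hy => ⟨hy.1, h₀ hy.2⟩
  have hsub₀ : P₀ ⊆ overlap n x₀ x₁ := fun y hy => ⟨hy.1, h₁ hy.2⟩
  have himg : transition n x₁ x₀ '' P₁ = P₀ := by
    refine Set.Subset.antisymm ?_ fun z hz => ?_
    · rintro _ ⟨y, hy, rfl⟩
      exact ⟨(mapsTo_transition (hsub₁ hy)).1, by
        rw [Set.mem_preimage, chart_symm_transition (hsub₁ hy)]; exact hy.2⟩
    · refine ⟨transition n x₀ x₁ z, ⟨(mapsTo_transition (hsub₀ hz)).1, ?_⟩,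
        transition_transition (hsub₀ hz)⟩
      rw [Set.mem_preimage, chart_symm_transition (hsub₀ hz)]; exact hz.2
  have hinj : Set.InjOn (transition n x₁ x₀) P₁ := fun a ha b hb hab => by
    rw [← transition_transition (hsub₁ ha), hab, transition_transition (hsub₁ hb)]
  have hP₁m : MeasurableSet P₁ := measurableSet_target_inter_preimage x₁ hS
  rw [← himg, lintegral_image_eq_lintegral_abs_det_fderiv_mul volume hP₁m
    (fun y hy => (differentiableAt_transition (hsub₁ hy)).hasFDerivAt.hasFDerivWithinAt) hinj]
  refine setLIntegral_congr_fun hP₁m fun y hy => ?_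
  rw [volDensity_transition g (hsub₁ hy), ENNReal.ofReal_mul (abs_nonneg _)]

theorem chartVolume_compl_source (g : SmoothMetric n M) (x : M) :
    chartVolume g x (extChartAt (𝓡 n) x).sourceᶜ = 0 := by
  rw [chartVolume_apply g x (isOpen_extChartAt_source x).measurableSet.compl]
  have : (extChartAt (𝓡 n) x).target ∩ (extChartAt (𝓡 n) x).symm ⁻¹' (extChartAt (𝓡 n) x).sourceᶜ
      = ∅ := by
    ext y
    simp only [Set.mem_inter_iff, Set.mem_preimage, Set.mem_compl_iff, Set.mem_empty_iff_false,
      iff_false, not_and, not_not]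
    exact fun hy => (extChartAt (𝓡 n) x).map_target hy
  rw [this]
  simp

/-- The Riemannian volume is given by `√(det g) dy` in every chart. -/
theorem vol_restrict_source (g : SmoothMetric n M) (x : M) :
    (vol g).restrict (extChartAt (𝓡 n) x).source = chartVolume g x := by
  have hsm := (isOpen_extChartAt_source (I := 𝓡 n) x).measurableSet
  have hself : (chartVolume g x).restrict (extChartAt (𝓡 n) x).source = chartVolume g x :=
    Measure.restrict_eq_self_of_ae_mem (chartVolume_compl_source g x)
  refine le_antisymm ?_ ?_
  · have hle : vol g ≤ chartVolume g x +
        (⊤ : Measure M).restrict (extChartAt (𝓡 n) x).sourceᶜ := by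
      refine iSup_le fun x' => ?_
      rw [← Measure.restrict_add_restrict_compl (μ := chartVolume g x') hsm]
      refine add_le_add ?_ (Measure.restrict_mono le_rfl le_top)
      refine Measure.le_iff.2 fun S hS => ?_
      rw [Measure.restrict_apply hS]
      have h1 : S ∩ (extChartAt (𝓡 n) x).source =
          (S ∩ (extChartAt (𝓡 n) x).source ∩ (extChartAt (𝓡 n) x').source) ∪
          (S ∩ (extChartAt (𝓡 n) x).source ∩ (extChartAt (𝓡 n) x').sourceᶜ) := by
        rw [← Set.inter_union_distrib_left, Set.union_compl_self, Set.inter_univ]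
      rw [h1]
      refine (measure_union_le _ _).trans ?_
      rw [measure_mono_null Set.inter_subset_right (chartVolume_compl_source g x'), add_zero,
        chartVolume_eq_of_subset g x' x ((hS.inter hsm).inter
          (isOpen_extChartAt_source x').measurableSet) Set.inter_subset_right
          (Set.inter_subset_left.trans Set.inter_subset_right)]
      exact measure_mono (Set.inter_subset_left.trans Set.inter_subset_left)
    refine (Measure.restrict_mono le_rfl hle).trans ?_
    rw [Measure.restrict_add, Measure.restrict_restrict hsm, Set.inter_compl_self,
      Measure.restrict_empty, add_zero, hself]
  · calc chartVolume g x = (chartVolume g x).restrict (extChartAt (𝓡 n) x).source := hself.symm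
      _ ≤ _ := Measure.restrict_mono le_rfl (le_iSup (fun x => chartVolume g x) x)

theorem vol_apply_of_subset (g : SmoothMetric n M) (x : M) {S : Set M}
    (h : S ⊆ (extChartAt (𝓡 n) x).source) : vol g S = chartVolume g x S := by
  rw [← vol_restrict_source, Measure.restrict_apply' (isOpen_extChartAt_source x).measurableSet,
    Set.inter_eq_left.2 h]

instance isLocallyFiniteMeasure_vol (g : SmoothMetric n M) : IsLocallyFiniteMeasure (vol g) where
  finiteAtNhds x := by
    have ht := (isOpen_extChartAt_target (I := 𝓡 n) x).mem_nhds (mem_extChartAt_target x)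
    obtain ⟨r, hr, hrt⟩ := Metric.nhds_basis_closedBall.mem_iff.1 ht
    have hc := isCompact_closedBall (extChartAt (𝓡 n) x x) r
    set S := (extChartAt (𝓡 n) x).source ∩
      extChartAt (𝓡 n) x ⁻¹' Metric.ball (extChartAt (𝓡 n) x x) r with hS
    have hSo : IsOpen S := (continuousOn_extChartAt x).isOpen_inter_preimage
      (isOpen_extChartAt_source x) Metric.isOpen_ball
    refine ⟨S, hSo.mem_nhds ⟨mem_extChartAt_source x, Metric.mem_ball_self hr⟩, ?_⟩
    rw [vol_apply_of_subset g x Set.inter_subset_left, chartVolume_apply g x hSo.measurableSet]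
    have hsub : (extChartAt (𝓡 n) x).target ∩ (extChartAt (𝓡 n) x).symm ⁻¹' S ⊆
        Metric.closedBall (extChartAt (𝓡 n) x x) r := fun y hy => by
      have := hy.2.2
      rw [Set.mem_preimage, (extChartAt (𝓡 n) x).right_inv hy.1] at this
      exact Metric.ball_subset_closedBall this
    have hi : IntegrableOn (volDensity g x) (Metric.closedBall (extChartAt (𝓡 n) x x) r) :=
      ((contDiffOn_volDensity g x).continuousOn.mono hrt).integrableOn_compact hc
    refine (lintegral_mono_set hsub).trans_lt ?_
    refine lt_of_le_of_lt (lintegral_mono fun y => ?_) hi.2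
    exact Real.ofReal_le_enorm _

/-- The volume integral of a function supported in a chart. -/
theorem integral_vol_eq (g : SmoothMetric n M) (x : M) {f : M → ℝ}
    (hf : AEStronglyMeasurable f (vol g)) (h0 : ∀ y ∉ (extChartAt (𝓡 n) x).source, f y = 0) :
    ∫ y, f y ∂(vol g) = ∫ y in (extChartAt (𝓡 n) x).target,
      volDensity g x y * f ((extChartAt (𝓡 n) x).symm y) := by
  have ht := (isOpen_extChartAt_target (I := 𝓡 n) x).measurableSet
  have hf' : AEStronglyMeasurable f (chartVolume g x) := by
    rw [← vol_restrict_source]; exact hf.restrict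
  rw [← setIntegral_eq_integral_of_forall_compl_eq_zero h0, vol_restrict_source, chartVolume,
    integral_map (aemeasurable_chart_symm g x) hf',
    integral_withDensity_eq_integral_toReal_smul₀]
  · refine setIntegral_congr_fun ht fun y hy => ?_
    simp only [smul_eq_mul]
    rw [ENNReal.toReal_ofReal (volDensity_pos g x hy).le]
  · exact ((contDiffOn_volDensity g x).continuousOn.aemeasurable ht).ennreal_ofReal
  · exact Eventually.of_forall fun y => ENNReal.ofReal_lt_top

theorem ae_chart_of_ae_vol (g : SmoothMetric n M) (x : M) {P : M → Prop}
    (h : ∀ᵐ y ∂(vol g), P y) :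
    ∀ᵐ y, y ∈ (extChartAt (𝓡 n) x).target → P ((extChartAt (𝓡 n) x).symm y) := by
  have ht := (isOpen_extChartAt_target (I := 𝓡 n) x).measurableSet
  have h1 : ∀ᵐ y ∂(chartVolume g x), P y := by
    rw [← vol_restrict_source]; exact ae_restrict_of_ae h
  have h2 := ae_of_ae_map (aemeasurable_chart_symm g x) h1
  rw [ae_withDensity_iff' ((contDiffOn_volDensity g x).continuousOn.aemeasurable
    ht).ennreal_ofReal, ae_restrict_iff' ht] at h2
  filter_upwards [h2] with y hy hyt
  exact hy hyt (ENNReal.ofReal_pos.2 (volDensity_pos g x hyt)).ne'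

theorem locallyIntegrableOn_chart (g : SmoothMetric n M) (x : M) {h : M → ℝ}
    (hh : LocallyIntegrable h (vol g)) :
    LocallyIntegrableOn (fun y => h ((extChartAt (𝓡 n) x).symm y)) (extChartAt (𝓡 n) x).target := by
  have ho := isOpen_extChartAt_target (I := 𝓡 n) x
  have ht := ho.measurableSet
  have hwc := (contDiffOn_volDensity g x).continuousOn
  have key : LocallyIntegrableOn
      (fun y => volDensity g x y * h ((extChartAt (𝓡 n) x).symm y)) (extChartAt (𝓡 n) x).target := by
    rw [locallyIntegrableOn_iff ho.isLocallyClosed]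
    intro K hKt hK
    have hKi : IsCompact ((extChartAt (𝓡 n) x).symm '' K) :=
      hK.image_of_continuousOn ((continuousOn_extChartAt_symm x).mono hKt)
    obtain ⟨S, hSo, hKS, hSi⟩ := hh.integrableOn_nhds_isCompact hKi
    have hi : Integrable h ((chartVolume g x).restrict S) := by
      rw [← vol_restrict_source, Measure.restrict_restrict hSo.measurableSet]
      exact hSi.mono_set Set.inter_subset_left
    have hi2 : Integrable (S.indicator h) (chartVolume g x) :=
      (integrable_indicator_iff hSo.measurableSet).2 hi
    rw [chartVolume, integrable_map_measure hi2.1 (aemeasurable_chart_symm g x),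
      integrable_withDensity_iff_integrable_smul₀' (hwc.aemeasurable ht).ennreal_ofReal
      (Eventually.of_forall fun y => ENNReal.ofReal_lt_top)] at hi2
    have hi3 : IntegrableOn (fun y => (ENNReal.ofReal (volDensity g x y)).toReal •
        (S.indicator h ∘ (extChartAt (𝓡 n) x).symm) y) K :=
      IntegrableOn.mono_set hi2 hKt
    refine hi3.congr_fun (fun y hy => ?_) hK.measurableSet
    simp only [Function.comp_apply, smul_eq_mul]
    rw [ENNReal.toReal_ofReal (volDensity_pos g x (hKt hy)).le,
      Set.indicator_of_mem (hKS ⟨y, hy, rfl⟩)]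
  have h2 := key.continuousOn_mul (hwc.inv₀ fun y hy => (volDensity_pos g x hy).ne')
    ho.isLocallyClosed
  rw [locallyIntegrableOn_iff ho.isLocallyClosed] at h2 ⊢
  intro K hKt hK
  refine (h2 K hKt hK).congr_fun (fun y hy => ?_) hK.measurableSet
  simp only [Pi.inv_apply]
  rw [inv_mul_cancel_left₀ (volDensity_pos g x (hKt hy)).ne']

end RiemannianVolume
end RiemannianSchrodinger

/-! ### The Laplacian on the manifold -/

namespace RiemannianSchrodinger

section LaplacianOnManifold

open Filter Topology Matrix

theorem divForm_add {n : ℕ} {a : EuclideanSpace ℝ (Fin n) → Matrix (Fin n) (Fin n) ℝ}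
    {f g : EuclideanSpace ℝ (Fin n) → ℝ} {x : EuclideanSpace ℝ (Fin n)}
    (ha : ∀ i j, ContDiff ℝ ∞ fun x => a x i j) (hf : ContDiff ℝ ∞ f) (hg : ContDiff ℝ ∞ g) :
    divForm a (fun y => f y + g y) x = divForm a f x + divForm a g x := by
  have h1 : ∀ j, pd j (fun y => f y + g y) = fun y => pd j f y + pd j g y := fun j =>
    funext fun y => pd_add (hf.diffAt y) (hg.diffAt y)
  simp only [divForm, h1, mul_add, Finset.sum_add_distrib]
  rw [← Finset.sum_add_distrib]
  exact Finset.sum_congr rfl fun i _ => pd_add ((contDiff_flux ha hf i).diffAt x)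
    ((contDiff_flux ha hg i).diffAt x)

variable {n : ℕ} {M : Type*} [TopologicalSpace M] [ChartedSpace (EuclideanSpace ℝ (Fin n)) M]
  [IsManifold (𝓡 n) ∞ M]

theorem contDiffOn_comp_chart_symm {ψ : M → ℝ} (hψ : ContMDiff (𝓡 n) 𝓘(ℝ, ℝ) ∞ ψ) (x : M) :
    ContDiffOn ℝ ∞ (fun y => ψ ((extChartAt (𝓡 n) x).symm y)) (extChartAt (𝓡 n) x).target :=
  (hψ.comp_contMDiffOn (contMDiffOn_chart_symm x)).contDiffOn

theorem continuous_laplacian (g : SmoothMetric n M) {ψ : M → ℝ}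
    (hψ : ContMDiff (𝓡 n) 𝓘(ℝ, ℝ) ∞ ψ) : Continuous (laplacian g ψ) := by
  refine continuous_iff_continuousAt.2 fun x => ?_
  have hs := (isOpen_extChartAt_source (I := 𝓡 n) x).mem_nhds (mem_extChartAt_source x)
  have ht := (isOpen_extChartAt_target (I := 𝓡 n) x).mem_nhds (mem_extChartAt_target x)
  have h1 : ContinuousOn (fun y => (volDensity g x y)⁻¹ *
      divForm (chartCoeff g x) (fun z => ψ ((extChartAt (𝓡 n) x).symm z)) y)
      (extChartAt (𝓡 n) x).target :=
    ((contDiffOn_volDensity g x).continuousOn.inv₀ fun y hy => (volDensity_pos g x hy).ne').mul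
      (continuousOn_divForm (isOpen_extChartAt_target x) (contDiffOn_chartCoeff g x)
        (fun y _ => isSymm_chartCoeff g x y) (contDiffOn_comp_chart_symm hψ x))
  have h2 := (h1.continuousAt ht).comp (f := extChartAt (𝓡 n) x) (continuousAt_extChartAt x)
  refine h2.congr ?_
  filter_upwards [hs] with y hy
  exact (laplacian_eq_divForm g hψ hy).symm

theorem laplacian_congr (g : SmoothMetric n M) {φ ψ : M → ℝ} {x : M} (h : φ =ᶠ[𝓝 x] ψ) :
    laplacian g φ x = laplacian g ψ x := by
  rw [laplacian_eq_divForm_self, laplacian_eq_divForm_self]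
  congr 1
  refine divForm_congr EventuallyEq.rfl ?_
  have hc := (continuousAt_extChartAt_symm (I := 𝓡 n) x)
  rw [ContinuousAt, extChartAt_to_inv] at hc
  exact hc.eventually h

theorem laplacian_eq_zero_of_notMem_tsupport (g : SmoothMetric n M) {ψ : M → ℝ} {x : M}
    (hx : x ∉ tsupport ψ) : laplacian g ψ x = 0 := by
  rw [laplacian_congr g (notMem_tsupport_iff_eventuallyEq.1 hx), laplacian_eq_divForm_self]
  have : divForm (chartCoeff g x) (fun z => (0 : M → ℝ) ((extChartAt (𝓡 n) x).symm z))
      (extChartAt (𝓡 n) x x) = 0 := by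
    simp [divForm, pd_const]
  rw [this, mul_zero]

theorem laplacian_const (g : SmoothMetric n M) (c : ℝ) (x : M) :
    laplacian g (fun _ => c) x = 0 := by
  rw [laplacian_eq_divForm_self]
  simp [divForm, pd_const]

theorem hasCompactSupport_laplacian (g : SmoothMetric n M) {ψ : M → ℝ}
    (hψ : HasCompactSupport ψ) : HasCompactSupport (laplacian g ψ) := by
  refine hψ.of_isClosed_subset (isClosed_tsupport _) (closure_minimal (fun x hx => ?_)
    (isClosed_tsupport _))
  by_contra h
  exact hx (laplacian_eq_zero_of_notMem_tsupport g h)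

/-- Global coefficients `a` and global extensions `T f` of functions, which represent the Laplacian
at the base point of a chart. -/
theorem exists_laplacian_eq (g : SmoothMetric n M) (x : M) :
    ∃ (a : EuclideanSpace ℝ (Fin n) → Matrix (Fin n) (Fin n) ℝ)
      (T : (EuclideanSpace ℝ (Fin n) → ℝ) → EuclideanSpace ℝ (Fin n) → ℝ),
      (∀ i j, ContDiff ℝ ∞ fun y => a y i j) ∧
      (a (extChartAt (𝓡 n) x x)).PosDef ∧
      (∀ ψ : M → ℝ, ContMDiff (𝓡 n) 𝓘(ℝ, ℝ) ∞ ψ →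
        ContDiff ℝ ∞ (T fun z => ψ ((extChartAt (𝓡 n) x).symm z))) ∧
      (∀ f, T f =ᶠ[𝓝 (extChartAt (𝓡 n) x x)] f) ∧
      ∀ ψ : M → ℝ, ∀ f, f =ᶠ[𝓝 (extChartAt (𝓡 n) x x)] (fun z => ψ ((extChartAt (𝓡 n) x).symm z)) →
        laplacian g ψ x = (volDensity g x (extChartAt (𝓡 n) x x))⁻¹ *
          divForm a f (extChartAt (𝓡 n) x x) := by
  obtain ⟨a, T, U, ha, has, hU, hKU, hUW, haA, hT, hTf⟩ :=
    exists_global (isOpen_extChartAt_target (I := 𝓡 n) x)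
      (isCompact_singleton (x := extChartAt (𝓡 n) x x))
      (Set.singleton_subset_iff.2 (mem_extChartAt_target x)) (contDiffOn_chartCoeff g x)
      (fun y _ => isSymm_chartCoeff g x y)
  have hxU : extChartAt (𝓡 n) x x ∈ U := hKU rfl
  refine ⟨a, T, ha, ?_, fun ψ hψ => hT _ (contDiffOn_comp_chart_symm hψ x),
    fun f => eventuallyEq_of_isOpen hU (hTf f) hxU, fun ψ f hf => ?_⟩
  · rw [haA _ hxU]
    exact posDef_chartCoeff g x (mem_extChartAt_target x)
  · rw [laplacian_eq_divForm_self, divForm_congr (eventuallyEq_of_isOpen hU haA hxU) hf]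

theorem laplacian_add (g : SmoothMetric n M) {φ ψ : M → ℝ}
    (hφ : ContMDiff (𝓡 n) 𝓘(ℝ, ℝ) ∞ φ) (hψ : ContMDiff (𝓡 n) 𝓘(ℝ, ℝ) ∞ ψ) (x : M) :
    laplacian g (fun y => φ y + ψ y) x = laplacian g φ x + laplacian g ψ x := by
  obtain ⟨a, T, ha, -, hT, hTf, hL⟩ := exists_laplacian_eq g x
  rw [hL φ _ (hTf _), hL ψ _ (hTf _), hL _ _ ((hTf _).add (hTf _))]
  rw [← mul_add]
  congr 1
  exact divForm_add ha (hT φ hφ) (hT ψ hψ)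

theorem laplacian_sum (g : SmoothMetric n M) {ι : Type*} (s : Finset ι) {ψ : ι → M → ℝ}
    (hψ : ∀ i, ContMDiff (𝓡 n) 𝓘(ℝ, ℝ) ∞ (ψ i)) (x : M) :
    laplacian g (fun y => ∑ i ∈ s, ψ i y) x = ∑ i ∈ s, laplacian g (ψ i) x := by
  classical
  induction s using Finset.induction_on with
  | empty => simpa using laplacian_const g 0 x
  | insert i s hi ih =>
    simp only [Finset.sum_insert hi]
    rw [laplacian_add g (hψ i) (contMDiff_finsetSum fun j _ => hψ j), ih]

/-- `β'(φ) Δφ ≤ Δ(β ∘ φ)` for convex `β`, by the chain rule. -/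
theorem le_laplacian_comp (g : SmoothMetric n M) {φ : M → ℝ}
    (hφ : ContMDiff (𝓡 n) 𝓘(ℝ, ℝ) ∞ φ) {β : ℝ → ℝ} (hβ : ContDiff ℝ ∞ β)
    (hβ2 : ∀ s, 0 ≤ deriv (deriv β) s) (x : M) :
    deriv β (φ x) * laplacian g φ x ≤ laplacian g (fun y => β (φ y)) x := by
  obtain ⟨a, T, ha, hpos, hT, hTf, hL⟩ := exists_laplacian_eq g x
  have hfe := hTf fun z => φ ((extChartAt (𝓡 n) x).symm z)
  have hfs := hT φ hφ
  generalize (T fun z => φ ((extChartAt (𝓡 n) x).symm z)) = f at hfe hfs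
  have hfx : f (extChartAt (𝓡 n) x x) = φ x := by
    rw [hfe.eq_of_nhds, extChartAt_to_inv]
  rw [hL φ f hfe, hL (fun y => β (φ y)) (fun y => β (f y)) (hfe.fun_comp β),
    divForm_comp ha hβ hfs, hfx]
  have hw := inv_pos.2 (volDensity_pos g x (mem_extChartAt_target x))
  have hgrad : 0 ≤ gradForm a f f (extChartAt (𝓡 n) x x) := by
    rw [gradForm_eq_dotProduct (fun _ => rfl) (fun _ => rfl)]
    have := hpos.posSemidef.dotProduct_mulVec_nonneg fun i => pd i f (extChartAt (𝓡 n) x x)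
    simpa using this
  have := mul_nonneg hw.le (mul_nonneg (hβ2 (φ x)) hgrad)
  linarith

section Chart

variable [T2Space M]

/-- A test function supported in a chart, in coordinates. -/
theorem contDiff_chart_indicator (x : M) {ψ : M → ℝ} (hψ : IsTestFunction n ψ)
    (hs : tsupport ψ ⊆ (extChartAt (𝓡 n) x).source) :
    ContDiff ℝ ∞ ((extChartAt (𝓡 n) x).target.indicator
        fun y => ψ ((extChartAt (𝓡 n) x).symm y)) ∧
      HasCompactSupport ((extChartAt (𝓡 n) x).target.indicator
        fun y => ψ ((extChartAt (𝓡 n) x).symm y)) ∧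
      tsupport ((extChartAt (𝓡 n) x).target.indicator
        fun y => ψ ((extChartAt (𝓡 n) x).symm y)) ⊆ (extChartAt (𝓡 n) x).target := by
  have hK : IsCompact (extChartAt (𝓡 n) x '' tsupport ψ) :=
    hψ.2.isCompact.image_of_continuousOn ((continuousOn_extChartAt x).mono hs)
  have hKt : extChartAt (𝓡 n) x '' tsupport ψ ⊆ (extChartAt (𝓡 n) x).target := by
    rintro _ ⟨y, hy, rfl⟩
    exact (extChartAt (𝓡 n) x).map_source (hs hy)
  obtain ⟨h1, h2, h3⟩ := contDiff_indicator (isOpen_extChartAt_target (I := 𝓡 n) x)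
    (contDiffOn_comp_chart_symm hψ.1 x) hK hKt fun y hy hyK => by
      by_contra h
      exact hyK ⟨_, subset_tsupport _ h, (extChartAt (𝓡 n) x).right_inv hy⟩
  exact ⟨h1, h2, h3.trans hKt⟩

/-- A function on the model space supported in the target of a chart, as a test function. -/
theorem isTestFunction_source_indicator (x : M) {η : EuclideanSpace ℝ (Fin n) → ℝ}
    (hη : ContDiff ℝ ∞ η) (hc : HasCompactSupport η)
    (hs : tsupport η ⊆ (extChartAt (𝓡 n) x).target) :
    IsTestFunction n ((extChartAt (𝓡 n) x).source.indicator fun p => η (extChartAt (𝓡 n) x p)) ∧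
      tsupport ((extChartAt (𝓡 n) x).source.indicator fun p => η (extChartAt (𝓡 n) x p)) ⊆
        (extChartAt (𝓡 n) x).source := by
  set ψ := (extChartAt (𝓡 n) x).source.indicator fun p => η (extChartAt (𝓡 n) x p) with hψ
  have hK : IsCompact ((extChartAt (𝓡 n) x).symm '' tsupport η) :=
    hc.isCompact.image_of_continuousOn ((continuousOn_extChartAt_symm x).mono hs)
  have hz : ∀ p ∉ (extChartAt (𝓡 n) x).symm '' tsupport η, ψ p = 0 := fun p hp => by
    by_cases hps : p ∈ (extChartAt (𝓡 n) x).source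
    · rw [hψ, Set.indicator_of_mem hps]
      by_contra h
      exact hp ⟨_, subset_tsupport _ h, (extChartAt (𝓡 n) x).left_inv hps⟩
    · exact Set.indicator_of_notMem hps _
  have ht : tsupport ψ ⊆ (extChartAt (𝓡 n) x).symm '' tsupport η :=
    closure_minimal (fun p hp => by_contra fun h => hp (hz p h)) hK.isClosed
  have ht' : tsupport ψ ⊆ (extChartAt (𝓡 n) x).source := ht.trans (by
    rintro _ ⟨y, hy, rfl⟩
    exact (extChartAt (𝓡 n) x).map_target (hs hy))
  refine ⟨⟨contMDiff_of_tsupport fun p hp => ?_, HasCompactSupport.intro hK hz⟩, ht'⟩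
  have h1 : ContMDiffAt (𝓡 n) 𝓘(ℝ, ℝ) ∞ (fun p => η (extChartAt (𝓡 n) x p)) p :=
    hη.contMDiff.contMDiffAt.comp p (contMDiffAt_extChartAt' (by
      simpa using ht' hp))
  refine h1.congr_of_eventuallyEq ?_
  filter_upwards [(isOpen_extChartAt_source (I := 𝓡 n) x).mem_nhds (ht' hp)] with q hq
  exact Set.indicator_of_mem hq _

end Chart

section Integrals

variable [T2Space M] [MeasurableSpace M] [BorelSpace M]

theorem integrable_mul_of_locallyIntegrable (g : SmoothMetric n M) {h ξ : M → ℝ}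
    (hh : LocallyIntegrable h (vol g)) (hξ : Continuous ξ) (hc : HasCompactSupport ξ) :
    Integrable (fun x => h x * ξ x) (vol g) := by
  have := hh.integrable_smul_right_of_hasCompactSupport hξ hc
  simpa using this

/-- The pairing with the Laplacian of a test function supported in a chart, in coordinates. -/
theorem integral_mul_laplacian_eq (g : SmoothMetric n M) (x : M) {h ψ : M → ℝ}
    (hh : LocallyIntegrable h (vol g)) (hψ : IsTestFunction n ψ)
    (hs : tsupport ψ ⊆ (extChartAt (𝓡 n) x).source) :
    ∫ y, h y * laplacian g ψ y ∂(vol g) = ∫ y, h ((extChartAt (𝓡 n) x).symm y) *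
      divForm (chartCoeff g x) ((extChartAt (𝓡 n) x).target.indicator
        fun y => ψ ((extChartAt (𝓡 n) x).symm y)) y := by
  have ho := isOpen_extChartAt_target (I := 𝓡 n) x
  obtain ⟨h1, h2, h3⟩ := contDiff_chart_indicator x hψ hs
  rw [integral_vol_eq g x (integrable_mul_of_locallyIntegrable g hh (continuous_laplacian g hψ.1)
    (hasCompactSupport_laplacian g hψ.2)).1 fun y hy => by
      rw [laplacian_eq_zero_of_notMem_tsupport g fun h => hy (hs h), mul_zero]]
  refine Eq.trans ?_ (setIntegral_eq_integral_of_forall_compl_eq_zero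
    (s := (extChartAt (𝓡 n) x).target) fun y hy => by
      rw [divForm_eq_zero_of_notMem_tsupport _ fun h => hy (h3 h), mul_zero])
  refine setIntegral_congr_fun ho.measurableSet fun y hy => ?_
  beta_reduce
  rw [laplacian_eq_divForm g hψ.1 ((extChartAt (𝓡 n) x).map_target hy),
    (extChartAt (𝓡 n) x).right_inv hy,
    divForm_congr (b := chartCoeff g x) EventuallyEq.rfl (eventuallyEq_of_isOpen ho
      (fun z hz => (Set.indicator_of_mem hz fun y => ψ ((extChartAt (𝓡 n) x).symm y)).symm) hy)]
  have := (volDensity_pos g x hy).ne'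
  field_simp

theorem integral_mul_eq_chart (g : SmoothMetric n M) (x : M) {h ψ : M → ℝ}
    (hh : LocallyIntegrable h (vol g)) (hψ : IsTestFunction n ψ)
    (hs : tsupport ψ ⊆ (extChartAt (𝓡 n) x).source) :
    ∫ y, h y * ψ y ∂(vol g) = ∫ y, volDensity g x y * h ((extChartAt (𝓡 n) x).symm y) *
      (extChartAt (𝓡 n) x).target.indicator (fun y => ψ ((extChartAt (𝓡 n) x).symm y)) y := by
  have ho := isOpen_extChartAt_target (I := 𝓡 n) x
  rw [integral_vol_eq g x (integrable_mul_of_locallyIntegrable g hh hψ.1.continuous hψ.2).1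
    fun y hy => by rw [image_eq_zero_of_notMem_tsupport fun h => hy (hs h), mul_zero]]
  refine Eq.trans ?_ (setIntegral_eq_integral_of_forall_compl_eq_zero
    (s := (extChartAt (𝓡 n) x).target) fun y hy => by rw [Set.indicator_of_notMem hy, mul_zero])
  refine setIntegral_congr_fun ho.measurableSet fun y hy => ?_
  simp only [Set.indicator_of_mem hy]
  ring

end Integrals

section Decomposition

variable [T2Space M] [SecondCountableTopology M]

/-- A test function is a finite sum of test functions supported in charts. -/
theorem exists_finset_sum_eq {ψ : M → ℝ} (hψ : IsTestFunction n ψ) :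
    ∃ (s : Finset M) (ρ : M → M → ℝ), (∀ i, IsTestFunction n (ρ i)) ∧
      (∀ i, tsupport (ρ i) ⊆ (extChartAt (𝓡 n) i).source) ∧
      ((∀ x, 0 ≤ ψ x) → ∀ i x, 0 ≤ ρ i x) ∧ ψ = fun x => ∑ i ∈ s, ρ i x := by
  have : LocallyCompactSpace M := ChartedSpace.locallyCompactSpace (EuclideanSpace ℝ (Fin n)) M
  obtain ⟨χ, hχ⟩ := SmoothPartitionOfUnity.exists_isSubordinate (𝓡 n) (s := (Set.univ : Set M))
    isClosed_univ (fun i => (extChartAt (𝓡 n) i).source) (fun i => isOpen_extChartAt_source i)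
    fun x _ => Set.mem_iUnion.2 ⟨x, mem_extChartAt_source x⟩
  have hfin := χ.locallyFinite.finite_nonempty_inter_compact hψ.2.isCompact
  refine ⟨hfin.toFinset, fun i x => χ i x * ψ x, fun i => ⟨(χ i).contMDiff.mul hψ.1,
    hψ.2.mul_left⟩, fun i => ?_, fun h i x => mul_nonneg (χ.nonneg i x) (h x), ?_⟩
  · exact (tsupport_mul_subset_left (f := χ i)).trans (hχ i)
  · ext x
    by_cases hx : x ∈ tsupport ψ
    · rw [← Finset.sum_mul]
      have h1 : ∑ᶠ i, χ i x = 1 := χ.sum_eq_one (Set.mem_univ x)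
      rw [finsum_eq_sum_of_support_subset (s := hfin.toFinset)] at h1
      · rw [h1, one_mul]
      · intro i hi
        simp only [Set.Finite.coe_toFinset, Set.mem_ofPred_eq]
        exact ⟨x, hi, hx⟩
    · simp [image_eq_zero_of_notMem_tsupport hx]

variable [MeasurableSpace M] [BorelSpace M]

theorem integral_mul_laplacian_comm_of_tsupport_subset (g : SmoothMetric n M) (x : M) {φ ψ : M → ℝ}
    (hψ : IsTestFunction n ψ) (hs : tsupport ψ ⊆ (extChartAt (𝓡 n) x).source)
    (hφ : ContMDiff (𝓡 n) 𝓘(ℝ, ℝ) ∞ φ) :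
    ∫ y, ψ y * laplacian g φ y ∂(vol g) = ∫ y, φ y * laplacian g ψ y ∂(vol g) := by
  have : LocallyCompactSpace M := ChartedSpace.locallyCompactSpace (EuclideanSpace ℝ (Fin n)) M
  have ho := isOpen_extChartAt_target (I := 𝓡 n) x
  obtain ⟨h1, h2, h3⟩ := contDiff_chart_indicator x hψ hs
  have hl : LocallyIntegrable (laplacian g φ) (vol g) :=
    (continuous_laplacian g hφ).locallyIntegrable
  rw [integral_mul_laplacian_eq g x hφ.continuous.locallyIntegrable hψ hs]
  simp_rw [mul_comm (ψ _)]
  rw [integral_mul_eq_chart g x hl hψ hs,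
    ← integral_mul_divForm_comm_of_tsupport_subset ho (contDiffOn_chartCoeff g x)
      (fun y _ => isSymm_chartCoeff g x y) h1 h2 h3 (contDiffOn_comp_chart_symm hφ x)]
  refine integral_congr_ae (Eventually.of_forall fun y => ?_)
  beta_reduce
  by_cases hy : y ∈ (extChartAt (𝓡 n) x).target
  · rw [laplacian_eq_divForm g hφ ((extChartAt (𝓡 n) x).map_target hy),
      (extChartAt (𝓡 n) x).right_inv hy]
    have := (volDensity_pos g x hy).ne'
    field_simp
  · rw [Set.indicator_of_notMem hy]; ring

/-- Green's formula on the manifold. -/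
theorem integral_mul_laplacian_comm (g : SmoothMetric n M) {φ ψ : M → ℝ}
    (hψ : IsTestFunction n ψ) (hφ : ContMDiff (𝓡 n) 𝓘(ℝ, ℝ) ∞ φ) :
    ∫ y, ψ y * laplacian g φ y ∂(vol g) = ∫ y, φ y * laplacian g ψ y ∂(vol g) := by
  have : LocallyCompactSpace M := ChartedSpace.locallyCompactSpace (EuclideanSpace ℝ (Fin n)) M
  obtain ⟨s, ρ, hρ, hρs, -, hsum⟩ := exists_finset_sum_eq hψ
  have hl : LocallyIntegrable (laplacian g φ) (vol g) :=
    (continuous_laplacian g hφ).locallyIntegrable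
  rw [hsum]
  simp only [laplacian_sum g s (fun i => (hρ i).1), Finset.sum_mul, Finset.mul_sum]
  rw [integral_finsetSum, integral_finsetSum]
  · exact Finset.sum_congr rfl fun i _ =>
      integral_mul_laplacian_comm_of_tsupport_subset g i (hρ i) (hρs i) hφ
  · exact fun i _ => integrable_mul_of_locallyIntegrable g hφ.continuous.locallyIntegrable
      (continuous_laplacian g (hρ i).1) (hasCompactSupport_laplacian g (hρ i).2)
  · intro i _
    simp_rw [mul_comm (ρ i _)]
    exact integrable_mul_of_locallyIntegrable g hl (hρ i).1.continuous (hρ i).2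

end Decomposition

end LaplacianOnManifold
end RiemannianSchrodinger

/-! ### Kato's inequality on the manifold -/

namespace RiemannianSchrodinger

section KatoOnManifold

open Filter Topology Matrix

theorem locallyIntegrable_abs {X : Type*} [TopologicalSpace X] [MeasurableSpace X]
    {μ : Measure X} {h : X → ℝ} (hh : LocallyIntegrable h μ) :
    LocallyIntegrable (fun x => |h x|) μ := fun x => by
  obtain ⟨s, hs, hi⟩ := hh x
  exact ⟨s, hs, hi.abs⟩

variable {n : ℕ} {M : Type*} [TopologicalSpace M] [T2Space M]
  [ChartedSpace (EuclideanSpace ℝ (Fin n)) M] [IsManifold (𝓡 n) ∞ M] [MeasurableSpace M]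
  [BorelSpace M]

/-- Kato's inequality, tested against a function supported in a chart. -/
theorem le_integral_abs_mul_laplacian_of_tsupport_subset (g : SmoothMetric n M) (x : M)
    {h f : M → ℝ} (hh : LocallyIntegrable h (vol g)) (hf : LocallyIntegrable f (vol g))
    (hfh : ∀ᵐ y ∂(vol g), ∃ b : ℝ, 0 ≤ b ∧ f y = b * h y)
    (hw : ∀ ψ : M → ℝ, IsTestFunction n ψ →
      ∫ y, h y * laplacian g ψ y ∂(vol g) = ∫ y, f y * ψ y ∂(vol g))
    {ψ : M → ℝ} (hψ : IsTestFunction n ψ) (hψ0 : ∀ y, 0 ≤ ψ y)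
    (hs : tsupport ψ ⊆ (extChartAt (𝓡 n) x).source) :
    ∫ y, |f y| * ψ y ∂(vol g) ≤ ∫ y, |h y| * laplacian g ψ y ∂(vol g) := by
  have ho := isOpen_extChartAt_target (I := 𝓡 n) x
  obtain ⟨h1, h2, h3⟩ := contDiff_chart_indicator x hψ hs
  rw [integral_mul_laplacian_eq g x (locallyIntegrable_abs hh) hψ hs,
    integral_mul_eq_chart g x (locallyIntegrable_abs hf) hψ hs]
  refine le_trans (le_of_eq ?_) (le_integral_abs_mul_divForm ho (contDiffOn_chartCoeff g x)
    (fun y hy => posDef_chartCoeff g x hy) (locallyIntegrableOn_chart g x hh)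
    ((locallyIntegrableOn_chart g x hf).continuousOn_mul (contDiffOn_volDensity g x).continuousOn
      ho.isLocallyClosed) ?_ ?_ h1 h2 ?_ h3)
  · refine integral_congr_ae (Eventually.of_forall fun y => ?_)
    beta_reduce
    by_cases hy : y ∈ (extChartAt (𝓡 n) x).target
    · rw [abs_mul, abs_of_pos (volDensity_pos g x hy)]
      ring
    · rw [Set.indicator_of_notMem hy]; ring
  · intro η hη hηc hηs
    obtain ⟨ht, hts⟩ := isTestFunction_source_indicator x hη hηc hηs
    have hi : ((extChartAt (𝓡 n) x).target.indicator fun y =>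
        ((extChartAt (𝓡 n) x).source.indicator fun p => η (extChartAt (𝓡 n) x p))
          ((extChartAt (𝓡 n) x).symm y)) = η := by
      ext y
      by_cases hy : y ∈ (extChartAt (𝓡 n) x).target
      · rw [Set.indicator_of_mem hy, Set.indicator_of_mem ((extChartAt (𝓡 n) x).map_target hy),
          (extChartAt (𝓡 n) x).right_inv hy]
      · rw [Set.indicator_of_notMem hy, image_eq_zero_of_notMem_tsupport fun h => hy (hηs h)]
    have := hw _ ht
    rwa [integral_mul_laplacian_eq g x hh ht hts, integral_mul_eq_chart g x hf ht hts, hi] at this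
  · filter_upwards [ae_chart_of_ae_vol g x hfh] with y hy hyt
    obtain ⟨b, hb, hbe⟩ := hy hyt
    exact ⟨volDensity g x y * b, mul_nonneg (volDensity_pos g x hyt).le hb, by
      rw [hbe, mul_assoc]⟩
  · exact fun y => Set.indicator_nonneg (fun y _ => hψ0 _) y

variable [SecondCountableTopology M]

/-- Kato's inequality `Δ|h| ≥ |Δh|`, in the weak sense, for a function `h` whose weak Laplacian
is a nonnegative multiple of `h` at almost every point. -/
theorem le_integral_abs_mul_laplacian (g : SmoothMetric n M)
    {h f : M → ℝ} (hh : LocallyIntegrable h (vol g)) (hf : LocallyIntegrable f (vol g))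
    (hfh : ∀ᵐ y ∂(vol g), ∃ b : ℝ, 0 ≤ b ∧ f y = b * h y)
    (hw : ∀ ψ : M → ℝ, IsTestFunction n ψ →
      ∫ y, h y * laplacian g ψ y ∂(vol g) = ∫ y, f y * ψ y ∂(vol g))
    {ψ : M → ℝ} (hψ : IsTestFunction n ψ) (hψ0 : ∀ y, 0 ≤ ψ y) :
    ∫ y, |f y| * ψ y ∂(vol g) ≤ ∫ y, |h y| * laplacian g ψ y ∂(vol g) := by
  obtain ⟨s, ρ, hρ, hρs, hρ0, hsum⟩ := exists_finset_sum_eq hψ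
  rw [hsum]
  simp only [laplacian_sum g s (fun i => (hρ i).1), Finset.mul_sum]
  rw [integral_finsetSum, integral_finsetSum]
  · exact Finset.sum_le_sum fun i _ =>
      le_integral_abs_mul_laplacian_of_tsupport_subset g i hh hf hfh hw (hρ i) (hρ0 hψ0 i) (hρs i)
  · exact fun i _ => integrable_mul_of_locallyIntegrable g (locallyIntegrable_abs hh)
      (continuous_laplacian g (hρ i).1) (hasCompactSupport_laplacian g (hρ i).2)
  · exact fun i _ => integrable_mul_of_locallyIntegrable g (locallyIntegrable_abs hf)
      (hρ i).1.continuous (hρ i).2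

theorem locallyIntegrable_potential_mul {g : SmoothMetric n M} {V : M → ℝ}
    (hV : MemLinftyLoc g V) {h : M → ℝ} (hh : LocallyIntegrable h (vol g)) :
    LocallyIntegrable (fun x => V x * h x) (vol g) := by
  have : LocallyCompactSpace M := ChartedSpace.locallyCompactSpace (EuclideanSpace ℝ (Fin n)) M
  rw [locallyIntegrable_iff] at hh ⊢
  intro K hK
  exact (hh K hK).mul_of_top_right (hV K hK)

theorem integrable_mul_schrodinger {g : SmoothMetric n M} {V h : M → ℝ}
    (hh : LocallyIntegrable h (vol g)) (hVh : LocallyIntegrable (fun x => V x * h x) (vol g))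
    {ψ : M → ℝ} (hψ : IsTestFunction n ψ) :
    Integrable (fun x => h x * schrodinger g V ψ x) (vol g) := by
  have h1 := integrable_mul_of_locallyIntegrable g hh
    (continuous_laplacian g hψ.1) (hasCompactSupport_laplacian g hψ.2)
  have h2 := integrable_mul_of_locallyIntegrable g hVh hψ.1.continuous hψ.2
  refine (h2.sub h1).congr (Eventually.of_forall fun x => ?_)
  simp only [Pi.sub_apply, schrodinger]
  ring

theorem integral_mul_schrodinger {g : SmoothMetric n M} {V h : M → ℝ}
    (hh : LocallyIntegrable h (vol g)) (hVh : LocallyIntegrable (fun x => V x * h x) (vol g))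
    {ψ : M → ℝ} (hψ : IsTestFunction n ψ) :
    ∫ x, h x * schrodinger g V ψ x ∂(vol g) =
      ∫ x, V x * h x * ψ x ∂(vol g) - ∫ x, h x * laplacian g ψ x ∂(vol g) := by
  have h1 := integrable_mul_of_locallyIntegrable g hh
    (continuous_laplacian g hψ.1) (hasCompactSupport_laplacian g hψ.2)
  have h2 := integrable_mul_of_locallyIntegrable g hVh hψ.1.continuous hψ.2
  rw [← integral_sub h2 h1]
  refine integral_congr_ae (Eventually.of_forall fun x => ?_)
  simp only [schrodinger]
  ring

/-- If `(-Δ + V + 1) h = 0`, then `(-Δ + V) (-|h|) ≥ |h| ≥ 0`. -/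
theorem distribNonneg_neg_abs {g : SmoothMetric n M} {V h : M → ℝ}
    (hV0 : ∀ᵐ x ∂(vol g), 0 ≤ V x)
    (hh : LocallyIntegrable h (vol g)) (hVh : LocallyIntegrable (fun x => V x * h x) (vol g))
    (hw : ∀ ψ : M → ℝ, IsTestFunction n ψ →
      ∫ x, h x * schrodinger g V ψ x ∂(vol g) = -∫ x, h x * ψ x ∂(vol g)) :
    DistribNonneg g V fun x => -|h x| := by
  intro ψ hψ hψ0
  have hf : LocallyIntegrable (fun x => (V x + 1) * h x) (vol g) := by
    refine (hVh.add hh).congr (Eventually.of_forall fun x => ?_)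
    simp only [Pi.add_apply]
    ring
  have hVa : LocallyIntegrable (fun x => V x * |h x|) (vol g) := by
    refine (locallyIntegrable_abs hVh).congr ?_
    filter_upwards [hV0] with x hx
    rw [abs_mul, abs_of_nonneg hx]
  have hint := integrable_mul_schrodinger (locallyIntegrable_abs hh) hVa hψ
  have key := le_integral_abs_mul_laplacian g hh hf
    (by filter_upwards [hV0] with x hx using ⟨V x + 1, by linarith, rfl⟩)
    (fun η hη => by
      have h1 := hw η hη
      rw [integral_mul_schrodinger hh hVh hη] at h1
      have h2 : ∫ x, (V x + 1) * h x * η x ∂(vol g) =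
          ∫ x, V x * h x * η x ∂(vol g) + ∫ x, h x * η x ∂(vol g) := by
        rw [← integral_add (integrable_mul_of_locallyIntegrable g hVh hη.1.continuous hη.2)
          (integrable_mul_of_locallyIntegrable g hh hη.1.continuous hη.2)]
        exact integral_congr_ae (Eventually.of_forall fun x => by ring)
      linarith) hψ hψ0
  have h3 : ∫ x, V x * |h x| * ψ x ∂(vol g) ≤ ∫ x, |(V x + 1) * h x| * ψ x ∂(vol g) := by
    refine integral_mono_ae (integrable_mul_of_locallyIntegrable g hVa hψ.1.continuous hψ.2)
      (integrable_mul_of_locallyIntegrable g (locallyIntegrable_abs hf) hψ.1.continuous hψ.2) ?_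
    filter_upwards [hV0] with x hx
    rw [abs_mul, abs_of_nonneg (by linarith : 0 ≤ V x + 1)]
    exact mul_le_mul_of_nonneg_right
      (mul_le_mul_of_nonneg_right (by linarith) (abs_nonneg _)) (hψ0 x)
  have h4 := integral_mul_schrodinger (locallyIntegrable_abs hh) hVa hψ
  simp only [neg_mul, integral_neg]
  exact ⟨hint.neg, by linarith⟩

/-- Under the `L^q` positivity preserving property, `-Δ + V + 1` is injective on `L^q`. -/
theorem LpPositivityPreserving.ae_eq_zero {g : SmoothMetric n M} {V h : M → ℝ} {q : ℝ≥0∞}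
    (hPP : LpPositivityPreserving g V q) (hq : 1 ≤ q) (hV : MemLinftyLoc g V)
    (hV0 : ∀ᵐ x ∂(vol g), 0 ≤ V x) (hh : MemLp h q (vol g))
    (hw : ∀ ψ : M → ℝ, IsTestFunction n ψ →
      ∫ x, h x * schrodinger g V ψ x ∂(vol g) = -∫ x, h x * ψ x ∂(vol g)) :
    h =ᵐ[vol g] 0 := by
  have hl := hh.locallyIntegrable hq
  have hneg := hPP (fun x => -|h x|) hh.abs.neg
    (distribNonneg_neg_abs hV0 hl (locallyIntegrable_potential_mul hV hl) hw)
  filter_upwards [hneg] with x hx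
  exact abs_nonpos_iff.1 (by linarith)

end KatoOnManifold
end RiemannianSchrodinger

/-! ### Accretivity in `L^p` -/

namespace RiemannianSchrodinger

section PowerRegularization

variable (p δ : ℝ)

/-- The function `(s² + δ²)^(p/2)`, a smooth convex regularization of `|s|^p`. Its derivative is `p`
times the regularization `s (s² + δ²)^(p/2 - 1)` of `|s|^(p-2) s`. -/
noncomputable def regPow (s : ℝ) : ℝ := (s ^ 2 + δ ^ 2) ^ (p / 2)

variable {p δ}

theorem sq_add_sq_pos (hδ : 0 < δ) (s : ℝ) : 0 < s ^ 2 + δ ^ 2 := by positivity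

theorem contDiff_regPow (hδ : 0 < δ) : ContDiff ℝ ∞ (regPow p δ) :=
  ContDiff.rpow_const_of_ne (by fun_prop) fun s => (sq_add_sq_pos hδ s).ne'

theorem hasDerivAt_sq_add_sq_rpow (hδ : 0 < δ) (r s : ℝ) :
    HasDerivAt (fun s : ℝ => (s ^ 2 + δ ^ 2) ^ r) (2 * r * s * (s ^ 2 + δ ^ 2) ^ (r - 1)) s := by
  have h1 : HasDerivAt (fun s : ℝ => s ^ 2 + δ ^ 2) (2 * s) s := by
    simpa using (hasDerivAt_pow 2 s).add_const (δ ^ 2)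
  convert! h1.rpow_const (p := r) (Or.inl (sq_add_sq_pos hδ s).ne') using 1
  ring

theorem deriv_regPow (hδ : 0 < δ) :
    deriv (regPow p δ) = fun s => p * (s * (s ^ 2 + δ ^ 2) ^ (p / 2 - 1)) := by
  ext s
  rw [show regPow p δ = fun s => (s ^ 2 + δ ^ 2) ^ (p / 2) from rfl,
    (hasDerivAt_sq_add_sq_rpow hδ (p / 2) s).deriv]
  ring

theorem deriv_deriv_regPow_nonneg (hp : 1 < p) (hδ : 0 < δ) (s : ℝ) :
    0 ≤ deriv (deriv (regPow p δ)) s := by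
  have h := ((hasDerivAt_id s).fun_mul (hasDerivAt_sq_add_sq_rpow hδ (p / 2 - 1) s)).const_mul p
  rw [deriv_regPow hδ]
  have h0 := sq_add_sq_pos hδ s
  have e : (s ^ 2 + δ ^ 2) ^ (p / 2 - 1) =
      (s ^ 2 + δ ^ 2) * (s ^ 2 + δ ^ 2) ^ (p / 2 - 1 - 1) := by
    rw [Real.rpow_sub_one h0.ne' (p / 2 - 1), mul_div_cancel₀ _ h0.ne']
  simp only [id] at h
  rw [h.deriv, e]
  have h1 : 0 ≤ (s ^ 2 + δ ^ 2) ^ (p / 2 - 1 - 1) := Real.rpow_nonneg h0.le _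
  have : 0 ≤ p * ((p - 1) * s ^ 2 + δ ^ 2) * (s ^ 2 + δ ^ 2) ^ (p / 2 - 1 - 1) := by
    have : 0 ≤ (p - 1) * s ^ 2 := mul_nonneg (by linarith) (sq_nonneg s)
    positivity
  linarith

end PowerRegularization

section Accretivity

open Filter Topology

variable {n : ℕ} {M : Type*} [TopologicalSpace M] [T2Space M]
  [ChartedSpace (EuclideanSpace ℝ (Fin n)) M] [IsManifold (𝓡 n) ∞ M] [MeasurableSpace M]
  [BorelSpace M]

theorem memLp_potential_mul {g : SmoothMetric n M} {V : M → ℝ} (hV : MemLinftyLoc g V)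
    {φ : M → ℝ} (hφ : Continuous φ) (hc : HasCompactSupport φ) (q : ℝ≥0∞) :
    MemLp (fun x => V x * φ x) q (vol g) := by
  have h1 : MemLp (fun x => V x * φ x) q ((vol g).restrict (tsupport φ)) :=
    MemLp.mul (p := ⊤) (q := q) ((hφ.memLp_of_hasCompactSupport hc).restrict _)
      (hV _ hc.isCompact)
  have h2 := (memLp_indicator_iff_restrict (isClosed_tsupport φ).measurableSet).2 h1
  refine h2.ae_eq (Eventually.of_forall fun x => ?_)
  by_cases hx : x ∈ tsupport φ
  · exact Set.indicator_of_mem hx _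
  · simp [Set.indicator_of_notMem hx, image_eq_zero_of_notMem_tsupport hx]

theorem memLp_schrodinger {g : SmoothMetric n M} {V : M → ℝ} (hV : MemLinftyLoc g V)
    {φ : M → ℝ} (hφ : IsTestFunction n φ) (q : ℝ≥0∞) :
    MemLp (schrodinger g V φ) q (vol g) :=
  (((continuous_laplacian g hφ.1).memLp_of_hasCompactSupport
    (hasCompactSupport_laplacian g hφ.2)).neg).add (memLp_potential_mul hV hφ.1.continuous hφ.2 q)

variable [SecondCountableTopology M]

theorem integral_laplacian_eq_zero (g : SmoothMetric n M) {ψ : M → ℝ} (hψ : IsTestFunction n ψ) :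
    ∫ x, laplacian g ψ x ∂(vol g) = 0 := by
  have := integral_mul_laplacian_comm g hψ (contMDiff_const (c := (1 : ℝ)))
  simpa [laplacian_const] using this.symm

/-- Multiplying `Δφ` by a nondecreasing function of `φ` gives a nonpositive integral. -/
theorem integral_deriv_comp_mul_laplacian_nonpos (g : SmoothMetric n M) {φ : M → ℝ}
    (hφ : IsTestFunction n φ) {β : ℝ → ℝ} (hβ : ContDiff ℝ ∞ β)
    (hβ2 : ∀ s, 0 ≤ deriv (deriv β) s) :
    ∫ x, deriv β (φ x) * laplacian g φ x ∂(vol g) ≤ 0 := by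
  have hc : ContMDiff (𝓡 n) 𝓘(ℝ, ℝ) ∞ fun x => β (φ x) := hβ.contMDiff.comp hφ.1
  -- `β (φ x)` is constant, but not zero, outside of the support of `φ`.
  have ht : IsTestFunction n fun x => β (φ x) + -β 0 :=
    ⟨hc.add contMDiff_const, HasCompactSupport.intro hφ.2.isCompact fun x hx => by
      rw [image_eq_zero_of_notMem_tsupport hx, add_neg_cancel]⟩
  have h0 := integral_laplacian_eq_zero g ht
  rw [← h0]
  refine integral_mono ?_ ((continuous_laplacian g ht.1).integrable_of_hasCompactSupport
    (hasCompactSupport_laplacian g ht.2)) fun x => ?_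
  · exact (((hβ.continuous_deriv (by simp)).comp hφ.1.continuous).mul
      (continuous_laplacian g hφ.1)).integrable_of_hasCompactSupport
      (hasCompactSupport_laplacian g hφ.2).mul_left
  · beta_reduce
    rw [laplacian_add g hc contMDiff_const, laplacian_const, add_zero]
    exact le_laplacian_comp g hφ.1 hβ hβ2 x

/-- The equation `F = (-Δ + V + 1) φ` multiplied by the regularization of `|φ|^(p-2) φ`: the Laplacian
and the potential contribute nonnegative terms. -/
theorem integral_regPow_le {g : SmoothMetric n M} {V : M → ℝ} (hV : MemLinftyLoc g V)
    (hV0 : ∀ᵐ x ∂(vol g), 0 ≤ V x) {p δ : ℝ} (hp : 1 < p) (hδ : 0 < δ)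
    {φ : M → ℝ} (hφ : IsTestFunction n φ) :
    ∫ x, φ x * (φ x ^ 2 + δ ^ 2) ^ (p / 2 - 1) * φ x ∂(vol g) ≤
      ∫ x, φ x * (φ x ^ 2 + δ ^ 2) ^ (p / 2 - 1) * (schrodinger g V φ x + φ x) ∂(vol g) := by
  have : LocallyCompactSpace M := ChartedSpace.locallyCompactSpace (EuclideanSpace ℝ (Fin n)) M
  have hd := integral_deriv_comp_mul_laplacian_nonpos g hφ (contDiff_regPow (p := p) hδ)
    (deriv_deriv_regPow_nonneg hp hδ)
  rw [deriv_regPow hδ] at hd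
  simp only [mul_assoc p, integral_const_mul] at hd
  have hd' : ∫ x, φ x * (φ x ^ 2 + δ ^ 2) ^ (p / 2 - 1) * laplacian g φ x ∂(vol g) ≤ 0 :=
    nonpos_of_mul_nonpos_right hd (by linarith)
  set m : M → ℝ := fun x => φ x * (φ x ^ 2 + δ ^ 2) ^ (p / 2 - 1) with hm
  have hmc : Continuous m := hφ.1.continuous.mul
    (((hφ.1.continuous.pow 2).add continuous_const).rpow_const fun x =>
      Or.inl (sq_add_sq_pos hδ (φ x)).ne')
  have hms : HasCompactSupport m := hφ.2.mul_right
  have hφl := hφ.1.continuous.locallyIntegrable (μ := vol g)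
  have hVl := locallyIntegrable_potential_mul hV hφl
  have hll := (continuous_laplacian g hφ.1).locallyIntegrable (μ := vol g)
  have i1 := integrable_mul_of_locallyIntegrable g hφl hmc hms
  have i2 := integrable_mul_of_locallyIntegrable g hVl hmc hms
  have i3 := integrable_mul_of_locallyIntegrable g hll hmc hms
  have h2 : 0 ≤ ∫ x, V x * φ x * m x ∂(vol g) := by
    refine integral_nonneg_of_ae ?_
    filter_upwards [hV0] with x hx
    have := Real.rpow_nonneg (sq_add_sq_pos hδ (φ x)).le (p / 2 - 1)
    have : V x * φ x * m x = V x * φ x ^ 2 * (φ x ^ 2 + δ ^ 2) ^ (p / 2 - 1) := by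
      rw [hm]; ring
    rw [this, Pi.zero_apply]
    positivity
  have h3 : ∫ x, m x * (schrodinger g V φ x + φ x) ∂(vol g) =
      (∫ x, V x * φ x * m x ∂(vol g) - ∫ x, laplacian g φ x * m x ∂(vol g)) +
        ∫ x, φ x * m x ∂(vol g) := by
    rw [← integral_sub i2 i3, ← integral_add (f := fun x => V x * φ x * m x -
      laplacian g φ x * m x) (i2.sub i3) i1]
    refine integral_congr_ae (Eventually.of_forall fun x => ?_)
    simp only [schrodinger]
    ring
  have h4 : ∫ x, laplacian g φ x * m x ∂(vol g) ≤ 0 := by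
    simpa only [mul_comm (laplacian g φ _)] using hd'
  change ∫ x, m x * φ x ∂(vol g) ≤ ∫ x, m x * (schrodinger g V φ x + φ x) ∂(vol g)
  simp only [mul_comm (m _) (φ _)]
  linarith

theorem tendsto_mul_sq_add_sq_rpow (r s : ℝ) :
    Tendsto (fun δ : ℝ => s * (s ^ 2 + δ ^ 2) ^ r) (𝓝[>] 0) (𝓝 (s * (s ^ 2) ^ r)) := by
  by_cases hs : s = 0
  · simp [hs]
  · have h1 : Tendsto (fun δ : ℝ => s ^ 2 + δ ^ 2) (𝓝[>] 0) (𝓝 (s ^ 2)) := by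
      have : Continuous fun δ : ℝ => s ^ 2 + δ ^ 2 := by fun_prop
      simpa using (this.tendsto 0).mono_left nhdsWithin_le_nhds
    exact (h1.rpow_const (Or.inl (by positivity))).const_mul s

theorem abs_mul_sq_rpow {p : ℝ} (hp : 1 < p) (s : ℝ) :
    |s * (s ^ 2) ^ (p / 2 - 1)| = |s| ^ (p - 1) := by
  by_cases hs : s = 0
  · simp [hs, Real.zero_rpow (by linarith : p - 1 ≠ 0)]
  · have h := abs_pos.2 hs
    rw [abs_mul, abs_of_nonneg (by positivity : 0 ≤ (s ^ 2) ^ (p / 2 - 1)), ← sq_abs,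
      ← Real.rpow_natCast, ← Real.rpow_mul h.le, ← Real.rpow_one_add' h.le] <;> push_cast
    · congr 1; ring
    · linarith

theorem abs_mul_sq_add_sq_rpow_le {p δ : ℝ} (hp : 1 < p) (hδ : 0 < δ) (hδ1 : δ ≤ 1) (s : ℝ) :
    |s * (s ^ 2 + δ ^ 2) ^ (p / 2 - 1)| ≤ (s ^ 2 + 1) ^ ((p - 1) / 2) := by
  have h0 := sq_add_sq_pos hδ s
  rw [abs_mul, abs_of_nonneg (Real.rpow_nonneg h0.le _)]
  have h1 : |s| ≤ (s ^ 2 + δ ^ 2) ^ (1 / 2 : ℝ) := by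
    rw [← Real.sqrt_eq_rpow]
    exact Real.abs_le_sqrt (by nlinarith)
  calc |s| * (s ^ 2 + δ ^ 2) ^ (p / 2 - 1)
      ≤ (s ^ 2 + δ ^ 2) ^ (1 / 2 : ℝ) * (s ^ 2 + δ ^ 2) ^ (p / 2 - 1) :=
        mul_le_mul_of_nonneg_right h1 (Real.rpow_nonneg h0.le _)
    _ = (s ^ 2 + δ ^ 2) ^ ((p - 1) / 2) := by
        rw [← Real.rpow_add h0]
        congr 1; ring
    _ ≤ (s ^ 2 + 1) ^ ((p - 1) / 2) :=
        Real.rpow_le_rpow h0.le (by nlinarith) (by linarith)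

/-- As `δ → 0`, the regularization tends to `|φ|^(p-2) φ` under the integral. -/
theorem tendsto_integral_regPow (g : SmoothMetric n M) {p : ℝ} (hp : 1 < p) {φ : M → ℝ}
    (hφ : IsTestFunction n φ) {F : M → ℝ} (hF : LocallyIntegrable F (vol g)) :
    Tendsto (fun δ : ℝ => ∫ x, φ x * (φ x ^ 2 + δ ^ 2) ^ (p / 2 - 1) * F x ∂(vol g)) (𝓝[>] 0)
      (𝓝 (∫ x, φ x * (φ x ^ 2) ^ (p / 2 - 1) * F x ∂(vol g))) := by
  have : LocallyCompactSpace M := ChartedSpace.locallyCompactSpace (EuclideanSpace ℝ (Fin n)) M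
  have hK := (isClosed_tsupport φ).measurableSet
  have hφm := hφ.1.continuous.measurable
  have hbound : Integrable ((tsupport φ).indicator fun x =>
      F x * (φ x ^ 2 + 1) ^ ((p - 1) / 2)) (vol g) := by
    refine (integrable_indicator_iff hK).2 ?_
    refine (hF.integrableOn_isCompact hφ.2.isCompact).mul_continuousOn ?_ hφ.2.isCompact
    exact (((hφ.1.continuous.pow 2).add continuous_const).rpow_const fun x =>
      Or.inr (by linarith)).continuousOn
  refine tendsto_integral_filter_of_dominated_convergence _ ?_ ?_ hbound.norm ?_
  · refine Eventually.of_forall fun δ => ?_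
    exact AEStronglyMeasurable.mul
      (hφm.mul (((hφm.pow_const 2).add_const _).pow_const _)).aestronglyMeasurable
      hF.aestronglyMeasurable
  · filter_upwards [Ioc_mem_nhdsGT one_pos] with δ hδ
    refine Eventually.of_forall fun x => ?_
    by_cases hx : x ∈ tsupport φ
    · rw [Set.indicator_of_mem hx, norm_mul _ (F x), norm_mul (F x), mul_comm]
      refine mul_le_mul_of_nonneg_left ?_ (norm_nonneg (F x))
      exact (abs_mul_sq_add_sq_rpow_le hp hδ.1 hδ.2 _).trans (le_abs_self _)
    · simp [Set.indicator_of_notMem hx, image_eq_zero_of_notMem_tsupport hx]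
  · exact Eventually.of_forall fun x => (tendsto_mul_sq_add_sq_rpow _ _).mul_const _

/-- Accretivity of `-Δ + V` in `L^p`: `‖φ‖_p ≤ ‖(-Δ + V + 1) φ‖_p`. -/
theorem eLpNorm_le_eLpNorm_schrodinger_add {g : SmoothMetric n M} {V : M → ℝ}
    (hV : MemLinftyLoc g V) (hV0 : ∀ᵐ x ∂(vol g), 0 ≤ V x) {p : ℝ} (hp : 1 < p)
    {φ : M → ℝ} (hφ : IsTestFunction n φ) :
    eLpNorm φ (ENNReal.ofReal p) (vol g) ≤
      eLpNorm (fun x => schrodinger g V φ x + φ x) (ENNReal.ofReal p) (vol g) := by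
  have : LocallyCompactSpace M := ChartedSpace.locallyCompactSpace (EuclideanSpace ℝ (Fin n)) M
  have hp0 : 0 < p := by linarith
  have hφm := hφ.1.continuous.measurable
  set F : M → ℝ := fun x => schrodinger g V φ x + φ x with hFdef
  have hp1 : (1 : ℝ≥0∞) ≤ ENNReal.ofReal p := ENNReal.one_le_ofReal.2 hp.le
  have hpt : ENNReal.ofReal p ≠ 0 := by simpa using hp0
  have hφL : MemLp φ (ENNReal.ofReal p) (vol g) := hφ.1.continuous.memLp_of_hasCompactSupport hφ.2
  have hFL : MemLp F (ENNReal.ofReal p) (vol g) := (memLp_schrodinger hV hφ _).add hφL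
  have hF := hFL.locallyIntegrable hp1
  have hlim := le_of_tendsto_of_tendsto (tendsto_integral_regPow g hp hφ
    hφ.1.continuous.locallyIntegrable) (tendsto_integral_regPow g hp hφ hF)
    (by filter_upwards [self_mem_nhdsWithin] with δ hδ using integral_regPow_le hV hV0 hp hδ hφ)
  have hφi := hφL.integrable_norm_rpow hpt ENNReal.ofReal_ne_top
  have hFi := hFL.integrable_norm_rpow hpt ENNReal.ofReal_ne_top
  rw [ENNReal.toReal_ofReal hp0.le] at hφi hFi
  have hl : ∫ x, φ x * (φ x ^ 2) ^ (p / 2 - 1) * φ x ∂(vol g) = ∫ x, ‖φ x‖ ^ p ∂(vol g) := by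
    refine integral_congr_ae (Eventually.of_forall fun x => ?_)
    beta_reduce
    have h1 : 0 ≤ φ x * (φ x ^ 2) ^ (p / 2 - 1) * φ x := by
      rw [mul_comm, ← mul_assoc]
      exact mul_nonneg (mul_self_nonneg _) (Real.rpow_nonneg (sq_nonneg _) _)
    rw [← abs_of_nonneg h1, abs_mul, abs_mul_sq_rpow hp, Real.norm_eq_abs]
    rcases (abs_nonneg (φ x)).eq_or_lt with h | h
    · rw [← h, mul_zero, Real.zero_rpow hp0.ne']
    · rw [Real.rpow_sub_one h.ne', div_mul_cancel₀ _ h.ne']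
  -- Young's inequality with the exponents `p / (p - 1)` and `p`.
  have hr : ∫ x, φ x * (φ x ^ 2) ^ (p / 2 - 1) * F x ∂(vol g) ≤
      ∫ x, (‖φ x‖ ^ p * (1 - 1 / p) + ‖F x‖ ^ p / p) ∂(vol g) := by
    have hi := (hφi.mul_const (1 - 1 / p)).add (hFi.div_const p)
    suffices hb : ∀ x, |φ x * (φ x ^ 2) ^ (p / 2 - 1) * F x| ≤
        ‖φ x‖ ^ p * (1 - 1 / p) + ‖F x‖ ^ p / p from
      integral_mono (hi.mono' (AEStronglyMeasurable.mul
        (hφm.mul ((hφm.pow_const 2).pow_const _)).aestronglyMeasurable hF.aestronglyMeasurable)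
        (Eventually.of_forall hb)) hi fun x => (le_abs_self _).trans (hb x)
    intro x
    have hpq := (Real.HolderConjugate.conjExponent hp).symm
    have hy := Real.young_inequality_of_nonneg (Real.rpow_nonneg (abs_nonneg (φ x)) (p - 1))
      (abs_nonneg (F x)) hpq
    have e : (|φ x| ^ (p - 1)) ^ Real.conjExponent p = |φ x| ^ p := by
      rw [← Real.rpow_mul (abs_nonneg _), Real.conjExponent, mul_div_cancel₀ _ (by linarith)]
    have e2 : (1 : ℝ) - 1 / p = 1 / Real.conjExponent p := by
      have := hpq.inv_add_inv_eq_one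
      rw [one_div, one_div]; linarith
    rw [e] at hy
    calc |φ x * (φ x ^ 2) ^ (p / 2 - 1) * F x| = |φ x| ^ (p - 1) * |F x| := by
          rw [abs_mul, abs_mul_sq_rpow hp]
      _ ≤ _ := hy.trans (le_of_eq (by rw [e2, Real.norm_eq_abs, Real.norm_eq_abs]; ring))
  rw [integral_add (hφi.mul_const _) (hFi.div_const _), integral_mul_const,
    integral_div] at hr
  have hle : ∫ x, ‖φ x‖ ^ p ∂(vol g) ≤ ∫ x, ‖F x‖ ^ p ∂(vol g) := by
    have h1 : (∫ x, ‖φ x‖ ^ p ∂(vol g)) / p ≤ (∫ x, ‖F x‖ ^ p ∂(vol g)) / p := by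
      have : (∫ x, ‖φ x‖ ^ p ∂(vol g)) * (1 - 1 / p) =
        ∫ x, ‖φ x‖ ^ p ∂(vol g) - (∫ x, ‖φ x‖ ^ p ∂(vol g)) / p := by ring
      linarith
    exact (div_le_div_iff_of_pos_right hp0).1 h1
  rw [hφL.eLpNorm_eq_integral_rpow_norm hpt ENNReal.ofReal_ne_top,
    hFL.eLpNorm_eq_integral_rpow_norm hpt ENNReal.ofReal_ne_top, ENNReal.toReal_ofReal hp0.le]
  refine ENNReal.ofReal_le_ofReal (Real.rpow_le_rpow ?_ hle (inv_nonneg.2 hp0.le))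
  exact integral_nonneg fun x => Real.rpow_nonneg (norm_nonneg _) _

end Accretivity
end RiemannianSchrodinger

/-! ### The maximal operator -/

namespace RiemannianSchrodinger

section MaximalOperator

open Filter Topology

variable {n : ℕ} {M : Type*} [TopologicalSpace M] [T2Space M]
  [ChartedSpace (EuclideanSpace ℝ (Fin n)) M] [IsManifold (𝓡 n) ∞ M] [MeasurableSpace M]
  [BorelSpace M]

/-- The potential and the test functions are real, so that `ℝ`-linear maps, like the real part, preserve
the equation. -/
theorem DistribEq.clm_comp {𝕜 𝕜' : Type*} [RCLike 𝕜] [RCLike 𝕜'] {g : SmoothMetric n M}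
    {V : M → ℝ} {u f : M → 𝕜} (h : DistribEq g V u f) (L : 𝕜 →L[ℝ] 𝕜') :
    DistribEq g V (fun x => L (u x)) fun x => L (f x) where
  locallyIntegrable_left x :=
    let ⟨s, hs, hi⟩ := h.locallyIntegrable_left x; ⟨s, hs, L.integrable_comp hi⟩
  locallyIntegrable_potential x := by
    obtain ⟨s, hs, hi⟩ := h.locallyIntegrable_potential x
    exact ⟨s, hs, by simpa [IntegrableOn] using! L.integrable_comp hi⟩
  locallyIntegrable_right x :=
    let ⟨s, hs, hi⟩ := h.locallyIntegrable_right x; ⟨s, hs, L.integrable_comp hi⟩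
  integrable ψ hψ := by simpa using L.integrable_comp (h.integrable ψ hψ)
  integral_eq ψ hψ := by
    have hi : Integrable (fun x => ψ x • f x) (vol g) :=
      h.locallyIntegrable_right.integrable_smul_left_of_hasCompactSupport hψ.1.continuous hψ.2
    have h1 := L.integral_comp_comm (h.integrable ψ hψ)
    have h2 := L.integral_comp_comm hi
    simp only [map_smul] at h1 h2
    rw [h1, h2, h.integral_eq ψ hψ]

theorem IsTestFunction.clm_comp {𝕜 𝕜' : Type*} [RCLike 𝕜] [RCLike 𝕜'] {φ : M → 𝕜}
    (hφ : IsTestFunction n φ) (L : 𝕜 →L[ℝ] 𝕜') : IsTestFunction n fun x => L (φ x) :=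
  ⟨L.contMDiff.comp hφ.1, hφ.2.comp_left (map_zero L)⟩

variable [SecondCountableTopology M]

/-- Elements of `L^p` solve the equation as soon as the tested identities hold: all conditions
of integrability are automatic. -/
theorem distribEq_of_integral_eq {𝕜 : Type*} [RCLike 𝕜] {g : SmoothMetric n M} {V : M → ℝ}
    (hV : MemLinftyLoc g V) {q : ℝ≥0∞} (hq : 1 ≤ q) {u f : M → 𝕜} (hu : MemLp u q (vol g))
    (hf : MemLp f q (vol g))
    (h : ∀ ψ : M → ℝ, IsTestFunction n ψ →
      ∫ x, schrodinger g V ψ x • u x ∂(vol g) = ∫ x, ψ x • f x ∂(vol g)) :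
    DistribEq g V u f where
  locallyIntegrable_left := hu.locallyIntegrable hq
  locallyIntegrable_potential := by
    have : LocallyCompactSpace M := ChartedSpace.locallyCompactSpace (EuclideanSpace ℝ (Fin n)) M
    have hl := hu.locallyIntegrable hq
    rw [locallyIntegrable_iff] at hl ⊢
    exact fun K hK => (hl K hK).smul_of_top_right (hV K hK)
  locallyIntegrable_right := hf.locallyIntegrable hq
  integrable ψ hψ := by
    have h1 := ((hu.norm.locallyIntegrable hq))
    have h2 := integrable_mul_schrodinger h1 (locallyIntegrable_potential_mul hV h1) hψ
    refine h2.mono ((memLp_schrodinger hV hψ 1).1.smul hu.1) (Eventually.of_forall fun x => ?_)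
    rw [norm_smul, norm_mul, norm_norm, mul_comm]
  integral_eq := h

theorem distribEq_schrodinger {g : SmoothMetric n M} {V : M → ℝ} (hV : MemLinftyLoc g V)
    {φ : M → ℝ} (hφ : IsTestFunction n φ) : DistribEq g V φ (schrodinger g V φ) := by
  have : LocallyCompactSpace M := ChartedSpace.locallyCompactSpace (EuclideanSpace ℝ (Fin n)) M
  refine distribEq_of_integral_eq hV le_rfl (hφ.1.continuous.memLp_of_hasCompactSupport hφ.2)
    (memLp_schrodinger hV hφ 1) fun ψ hψ => ?_
  have h1 := hφ.1.continuous.locallyIntegrable (μ := vol g)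
  have h2 := hψ.1.continuous.locallyIntegrable (μ := vol g)
  simp only [smul_eq_mul, mul_comm (schrodinger g V ψ _)]
  rw [integral_mul_schrodinger h1 (locallyIntegrable_potential_mul hV h1) hψ,
    integral_mul_schrodinger h2 (locallyIntegrable_potential_mul hV h2) hφ,
    integral_mul_laplacian_comm g hψ hφ.1]
  congr 2
  ext x; ring

theorem IsTestFunction.exists_distribEq {𝕜 : Type*} [RCLike 𝕜] {g : SmoothMetric n M} {V : M → ℝ}
    (hV : MemLinftyLoc g V) {φ : M → 𝕜} (hφ : IsTestFunction n φ) (q : ℝ≥0∞) :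
    ∃ f, MemLp f q (vol g) ∧ DistribEq g V φ f := by
  have hr := hφ.clm_comp (RCLike.reCLM (K := 𝕜))
  have hi := hφ.clm_comp (RCLike.imCLM (K := 𝕜))
  have h1 := (distribEq_schrodinger hV hr).clm_comp (RCLike.ofRealCLM (K := 𝕜))
  have h2 := ((distribEq_schrodinger hV hi).clm_comp (RCLike.ofRealCLM (K := 𝕜))).smul RCLike.I
  refine ⟨_, MemLp.add ?_ (MemLp.const_smul ?_ RCLike.I),
    (h1.add h2).congr (Eventually.of_forall fun x => ?_) (EventuallyEq.refl _ _)⟩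
  · exact (RCLike.ofRealCLM (K := 𝕜)).comp_memLp' (memLp_schrodinger hV hr q)
  · exact (RCLike.ofRealCLM (K := 𝕜)).comp_memLp' (memLp_schrodinger hV hi q)
  · simp [mul_comm RCLike.I]

/-- In `(-Δ + V) u = f`, the function `u` determines `f`. -/
theorem DistribEq.right_unique {𝕜 : Type*} [RCLike 𝕜] {g : SmoothMetric n M} {V : M → ℝ}
    {u f f' : M → 𝕜} (h : DistribEq g V u f) (h' : DistribEq g V u f') : f =ᵐ[vol g] f' := by
  have : LocallyCompactSpace M := ChartedSpace.locallyCompactSpace (EuclideanSpace ℝ (Fin n)) M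
  have h0 := h.add (h'.smul (-1))
  have := ae_eq_zero_of_integral_contMDiff_smul_eq_zero (𝓡 n) h0.locallyIntegrable_right
    fun ψ hψ hψ' => by
      rw [← h0.integral_eq ψ ⟨hψ, hψ'⟩]
      simp
  filter_upwards [this] with x hx
  simpa [← sub_eq_add_neg, sub_eq_zero] using hx

/-- The maximal operator is closed: by Hölder's inequality the two sides of each tested identity are
continuous in `L^p`. -/
theorem isClosed_maxGraph {𝕜 : Type*} [RCLike 𝕜] {g : SmoothMetric n M} {V : M → ℝ}
    (hV : MemLinftyLoc g V) {p q : ℝ} (hpq : p.HolderConjugate q) [Fact (1 ≤ ENNReal.ofReal p)] :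
    IsClosed (maxGraph 𝕜 g V (ENNReal.ofReal p) : Set (Lp 𝕜 (ENNReal.ofReal p) (vol g) ×
      Lp 𝕜 (ENNReal.ofReal p) (vol g))) := by
  have : LocallyCompactSpace M := ChartedSpace.locallyCompactSpace (EuclideanSpace ℝ (Fin n)) M
  have hconj := hpq.ennrealOfReal
  have : Fact (1 ≤ ENNReal.ofReal q) := ⟨ENNReal.one_le_ofReal.2 hpq.symm.lt.le⟩
  have key : ∀ k : M → ℝ, MemLp k (ENNReal.ofReal q) (vol g) →
      Continuous fun w : Lp 𝕜 (ENNReal.ofReal p) (vol g) => ∫ x, k x • w x ∂(vol g) := by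
    intro k hk
    have h1 := (((ContinuousLinearMap.lsmul ℝ ℝ (E := 𝕜)).flip).lpPairing (vol g)
      (ENNReal.ofReal p) (ENNReal.ofReal q)).flip (hk.toLp k) |>.continuous
    refine h1.congr fun w => ?_
    rw [ContinuousLinearMap.flip_apply, ContinuousLinearMap.lpPairing_eq_integral]
    refine integral_congr_ae ?_
    filter_upwards [hk.coeFn_toLp] with x hx
    simp [hx]
  have hset : (maxGraph 𝕜 g V (ENNReal.ofReal p) : Set (Lp 𝕜 (ENNReal.ofReal p) (vol g) ×
      Lp 𝕜 (ENNReal.ofReal p) (vol g))) = ⋂ ψ : {ψ : M → ℝ // IsTestFunction n ψ},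
        {w | ∫ x, schrodinger g V ψ.1 x • w.1 x ∂(vol g) = ∫ x, ψ.1 x • w.2 x ∂(vol g)} := by
    ext w
    simp only [Set.mem_iInter, Set.mem_ofPred_eq, Subtype.forall]
    exact ⟨fun h => (show DistribEq g V w.1 w.2 from h).integral_eq,
      fun h => distribEq_of_integral_eq hV Fact.out (Lp.memLp _) (Lp.memLp _) h⟩
  rw [hset]
  refine isClosed_iInter fun ψ => isClosed_eq ?_ ?_
  · exact (key _ (memLp_schrodinger hV ψ.2 _)).comp continuous_fst
  · exact (key _ (ψ.2.1.continuous.memLp_of_hasCompactSupport ψ.2.2)).comp continuous_snd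

/-- The graph of the restriction of the maximal operator to `C_c^∞(M)`. -/
noncomputable def testGraph (𝕜 : Type*) [RCLike 𝕜] (g : SmoothMetric n M) (V : M → ℝ) (p : ℝ≥0∞) :
    Submodule 𝕜 (Lp 𝕜 p (vol g) × Lp 𝕜 p (vol g)) :=
  maxGraph 𝕜 g V p ⊓ (testSubmodule 𝕜 g p).prod ⊤

theorem exists_mem_testGraph {𝕜 : Type*} [RCLike 𝕜] {g : SmoothMetric n M} {V : M → ℝ}
    (hV : MemLinftyLoc g V) {p : ℝ≥0∞} {u : Lp 𝕜 p (vol g)} (hu : u ∈ testSubmodule 𝕜 g p) :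
    ∃ f, (u, f) ∈ testGraph 𝕜 g V p := by
  obtain ⟨φ, hφ, huφ⟩ := id hu
  obtain ⟨f, hf, hφf⟩ := hφ.exists_distribEq hV p
  exact ⟨hf.toLp f, hφf.congr huφ.symm hf.coeFn_toLp.symm, hu, trivial⟩

/-- Accretivity, for the elements of the graph of `-Δ + V` on test functions. -/
theorem norm_fst_le_of_mem_testGraph {g : SmoothMetric n M} {V : M → ℝ} (hV : MemLinftyLoc g V)
    (hV0 : ∀ᵐ x ∂(vol g), 0 ≤ V x) {p : ℝ} (hp : 1 < p)
    {w : Lp ℝ (ENNReal.ofReal p) (vol g) × Lp ℝ (ENNReal.ofReal p) (vol g)}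
    (hw : w ∈ testGraph ℝ g V (ENNReal.ofReal p)) : ‖w.1‖ ≤ ‖w.1 + w.2‖ := by
  obtain ⟨hw1, ⟨φ, hφ, hwφ⟩, -⟩ := hw
  have hw2 : w.2 =ᵐ[vol g] schrodinger g V φ := DistribEq.right_unique
    ((show DistribEq g V w.1 w.2 from hw1).congr hwφ EventuallyEq.rfl) (distribEq_schrodinger hV hφ)
  rw [Lp.norm_def, Lp.norm_def]
  refine ENNReal.toReal_mono (Lp.eLpNorm_ne_top _) ?_
  rw [eLpNorm_congr_ae hwφ]
  refine (eLpNorm_le_eLpNorm_schrodinger_add hV hV0 hp hφ).trans (le_of_eq (eLpNorm_congr_ae ?_))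
  filter_upwards [Lp.coeFn_add w.1 w.2, hwφ, hw2] with x h1 h2 h3
  rw [h1, Pi.add_apply, h2, h3, add_comm]

end MaximalOperator
end RiemannianSchrodinger

/-! ### The core -/

namespace RiemannianSchrodinger

section Core

open Filter Topology

/-- A proper closed subspace of a real normed space is annihilated by a nonzero functional. -/
theorem exists_dual_forall_eq_zero_of_isClosed {E : Type*} [NormedAddCommGroup E]
    [NormedSpace ℝ E] {R : Submodule ℝ E} (hR : IsClosed (R : Set E)) {x : E} (hx : x ∉ R) :
    ∃ Λ : E →L[ℝ] ℝ, (∀ a ∈ R, Λ a = 0) ∧ Λ x ≠ 0 := by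
  obtain ⟨Λ, u, h1, h2⟩ := geometric_hahn_banach_closed_point R.convex hR hx
  have h0 : 0 < u := by simpa using h1 0 R.zero_mem
  refine ⟨Λ, fun a ha => ?_, (h0.trans h2).ne'⟩
  by_contra h
  have := h1 ((u / Λ a) • a) (R.smul_mem _ ha)
  rw [map_smul, smul_eq_mul, div_mul_cancel₀ _ h] at this
  exact lt_irrefl _ this

/-- A subspace of a Banach space is closed if it is the image of a complete subspace under a
bounded operator that is bounded below there. -/
theorem isClosed_map_of_le_norm {E F : Type*} [NormedAddCommGroup E] [NormedSpace ℝ E]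
    [NormedAddCommGroup F] [NormedSpace ℝ F] [CompleteSpace E] (T : E →L[ℝ] F) {G : Submodule ℝ E}
    (hG : IsClosed (G : Set E)) {C : NNReal} (h : ∀ w ∈ G, ‖w‖ ≤ C * ‖T w‖) :
    IsClosed (G.map (T : E →ₗ[ℝ] F) : Set F) := by
  have : CompleteSpace G := hG.completeSpace_coe
  have h1 : AntilipschitzWith C (T.comp G.subtypeL) :=
    ContinuousLinearMap.antilipschitz_of_bound _ fun w => h w w.2
  have h2 := h1.isClosed_range (T.comp G.subtypeL).uniformContinuous
  convert! h2 using 1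
  ext y
  simp

variable {n : ℕ} {M : Type*} [TopologicalSpace M] [T2Space M]
  [ChartedSpace (EuclideanSpace ℝ (Fin n)) M] [IsManifold (𝓡 n) ∞ M] [MeasurableSpace M]
  [BorelSpace M] [SecondCountableTopology M]

/-- `(-Δ + V + 1) C_c^∞(M)` is dense in `L^p`: by duality, a functional that vanishes on it is given
by a function in `L^q` that is annihilated by `-Δ + V + 1`. -/
theorem LpPositivityPreserving.eq_top_of_isClosed {g : SmoothMetric n M} {V : M → ℝ} {p q : ℝ}
    (hPP : LpPositivityPreserving g V (ENNReal.ofReal q)) (hpq : p.HolderConjugate q)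
    [Fact (1 ≤ ENNReal.ofReal p)] (hV : MemLinftyLoc g V) (hV0 : ∀ᵐ x ∂(vol g), 0 ≤ V x)
    {R : Submodule ℝ (Lp ℝ (ENNReal.ofReal p) (vol g))}
    (hR : IsClosed (R : Set (Lp ℝ (ENNReal.ofReal p) (vol g))))
    (h : ∀ w ∈ testGraph ℝ g V (ENNReal.ofReal p), w.1 + w.2 ∈ R) : R = ⊤ := by
  have : LocallyCompactSpace M := ChartedSpace.locallyCompactSpace (EuclideanSpace ℝ (Fin n)) M
  by_contra hne
  obtain ⟨x, -, hx⟩ := SetLike.exists_of_lt (lt_top_iff_ne_top.2 hne)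
  obtain ⟨Λ, hΛ, hΛx⟩ := exists_dual_forall_eq_zero_of_isClosed hR hx
  obtain ⟨d, hd, hΛd⟩ := exists_memLp_forall_apply_eq_integral hpq Λ
  have hq : 1 ≤ ENNReal.ofReal q := ENNReal.one_le_ofReal.2 hpq.symm.lt.le
  have hdl := hd.locallyIntegrable hq
  have hd0 := hPP.ae_eq_zero hq hV hV0 hd fun ψ hψ => by
    have hψL : MemLp ψ (ENNReal.ofReal p) (vol g) :=
      hψ.1.continuous.memLp_of_hasCompactSupport hψ.2
    have hSL := memLp_schrodinger hV hψ (ENNReal.ofReal p)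
    have h1 := hΛ _ (h (hψL.toLp ψ, hSL.toLp _) ⟨(distribEq_schrodinger hV hψ).congr
      hψL.coeFn_toLp.symm hSL.coeFn_toLp.symm, ⟨ψ, hψ, hψL.coeFn_toLp⟩, trivial⟩)
    rw [hΛd] at h1
    have h2 : ∫ x, (hψL.toLp ψ + hSL.toLp _ : Lp ℝ (ENNReal.ofReal p) (vol g)) x * d x ∂(vol g) =
        ∫ x, (d x * ψ x + d x * schrodinger g V ψ x) ∂(vol g) := by
      refine integral_congr_ae ?_
      filter_upwards [Lp.coeFn_add (hψL.toLp ψ) (hSL.toLp _), hψL.coeFn_toLp, hSL.coeFn_toLp]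
        with x e1 e2 e3
      rw [e1, Pi.add_apply, e2, e3]
      ring
    rw [h2, integral_add (integrable_mul_of_locallyIntegrable g hdl hψ.1.continuous hψ.2)
      (integrable_mul_schrodinger hdl (locallyIntegrable_potential_mul hV hdl) hψ)] at h1
    linarith
  refine hΛx ?_
  rw [hΛd]
  refine integral_eq_zero_of_ae ?_
  filter_upwards [hd0] with x hx
  simp [hx]

/-- Real-valued case: the graph of the maximal operator is the closure of its restriction to the
test functions. -/
theorem maxGraph_le_topologicalClosure_real {g : SmoothMetric n M} {V : M → ℝ} {p q : ℝ}
    (hPP : LpPositivityPreserving g V (ENNReal.ofReal p))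
    (hPP' : LpPositivityPreserving g V (ENNReal.ofReal q)) (hpq : p.HolderConjugate q)
    [Fact (1 ≤ ENNReal.ofReal p)] (hV : MemLinftyLoc g V) (hV0 : ∀ᵐ x ∂(vol g), 0 ≤ V x) :
    maxGraph ℝ g V (ENNReal.ofReal p) ≤
      (testGraph ℝ g V (ENNReal.ofReal p)).topologicalClosure := by
  set E := Lp ℝ (ENNReal.ofReal p) (vol g)
  set G := (testGraph ℝ g V (ENNReal.ofReal p)).topologicalClosure with hG
  have hGc : IsClosed (G : Set (E × E)) := Submodule.isClosed_topologicalClosure _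
  -- `-Δ + V + 1`, as an operator on the graph
  set T : E × E →L[ℝ] E := ContinuousLinearMap.fst ℝ E E + ContinuousLinearMap.snd ℝ E E
  have hb : ∀ w ∈ G, ‖w.1‖ ≤ ‖w.1 + w.2‖ := by
    have hcl : IsClosed {w : E × E | ‖w.1‖ ≤ ‖w.1 + w.2‖} :=
      isClosed_le continuous_fst.norm (continuous_fst.add continuous_snd).norm
    exact fun w hw => closure_minimal
      (fun w hw => norm_fst_le_of_mem_testGraph hV hV0 hpq.lt hw) hcl hw
  -- The range of `-Δ + V + 1` on the closure is closed by accretivity, hence equal to `L^p` by duality.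
  have hRc := isClosed_map_of_le_norm T hGc (C := 2) fun w hw => by
    have h1 := hb w hw
    have h2 : ‖w.2‖ ≤ ‖w.1 + w.2‖ + ‖w.1‖ := by
      simpa using norm_sub_le (w.1 + w.2) w.1
    have h3 : T w = w.1 + w.2 := rfl
    rw [h3, Prod.norm_def]
    refine max_le ?_ ?_ <;> push_cast <;> linarith [norm_nonneg (w.1 + w.2)]
  have htop := hPP'.eq_top_of_isClosed hpq hV hV0 hRc fun w hw =>
    ⟨w, Submodule.le_topologicalClosure _ hw, rfl⟩
  -- A `v` in the closure with `(-Δ + V + 1) v = (-Δ + V + 1) w` equals `w` by uniqueness.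
  intro w hw
  obtain ⟨v, hv, hvw⟩ : T w ∈ G.map (T : E × E →ₗ[ℝ] E) := by rw [htop]; trivial
  have hvm : v ∈ maxGraph ℝ g V (ENNReal.ofReal p) :=
    Submodule.topologicalClosure_minimal _ inf_le_left (isClosed_maxGraph hV hpq) hv
  have hd : DistribEq g V (w - v).1 (w - v).2 := Submodule.sub_mem _ hw hvm
  have hvw' : v.1 + v.2 = w.1 + w.2 := hvw
  have hneg : (w - v).2 = -(w - v).1 := by
    rw [Prod.snd_sub, Prod.fst_sub, eq_neg_iff_add_eq_zero]
    have : w.2 - v.2 + (w.1 - v.1) = (w.1 + w.2) - (v.1 + v.2) := by abel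
    rw [this, hvw', sub_self]
  have h0 := hPP.ae_eq_zero Fact.out hV hV0 (Lp.memLp (w - v).1) fun ψ hψ => by
    have := hd.integral_eq ψ hψ
    simp only [smul_eq_mul] at this
    rw [← integral_neg]
    simp only [mul_comm ((w - v).1 _)]
    rw [this]
    refine integral_congr_ae ?_
    rw [hneg]
    filter_upwards [Lp.coeFn_neg (w - v).1] with x hx
    rw [hx, Pi.neg_apply, mul_neg]
  have h1 : (w - v).1 = 0 := (Lp.eq_zero_iff_ae_eq_zero).2 h0
  have h2 : w = v := sub_eq_zero.1 (Prod.ext h1 (by rw [hneg, h1, neg_zero]; rfl))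
  rw [h2]
  exact hv

/-- Real- and complex-valued case, by splitting into real and imaginary parts. -/
theorem maxGraph_le_topologicalClosure (𝕜 : Type*) [RCLike 𝕜] {g : SmoothMetric n M} {V : M → ℝ}
    {p q : ℝ} (hPP : LpPositivityPreserving g V (ENNReal.ofReal p))
    (hPP' : LpPositivityPreserving g V (ENNReal.ofReal q)) (hpq : p.HolderConjugate q)
    [Fact (1 ≤ ENNReal.ofReal p)] (hV : MemLinftyLoc g V) (hV0 : ∀ᵐ x ∂(vol g), 0 ≤ V x) :
    maxGraph 𝕜 g V (ENNReal.ofReal p) ≤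
      (testGraph 𝕜 g V (ENNReal.ofReal p)).topologicalClosure := by
  set P := ENNReal.ofReal p
  have hreal := maxGraph_le_topologicalClosure_real hPP hPP' hpq hV hV0
  set J := (RCLike.ofRealCLM (K := 𝕜)).compLpL P (vol g)
  -- Complexification maps the closure of the real graph into the closure of the graph.
  have hJ : ∀ w ∈ maxGraph ℝ g V P, (J w.1, J w.2) ∈ (testGraph 𝕜 g V P).topologicalClosure := by
    intro w hw
    refine map_mem_closure (f := fun w => (J w.1, J w.2)) ((J.continuous.comp continuous_fst).prodMk
      (J.continuous.comp continuous_snd)) (hreal hw) ?_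
    rintro v ⟨hv, ⟨φ, hφ, hvφ⟩, -⟩
    refine ⟨((show DistribEq g V v.1 v.2 from hv).clm_comp RCLike.ofRealCLM).congr
      (ContinuousLinearMap.coeFn_compLpL _ _).symm (ContinuousLinearMap.coeFn_compLpL _ _).symm,
      ⟨_, hφ.clm_comp (RCLike.ofRealCLM (K := 𝕜)), ?_⟩, trivial⟩
    filter_upwards [ContinuousLinearMap.coeFn_compLpL (RCLike.ofRealCLM (K := 𝕜)) v.1, hvφ]
      with x h1 h2
    exact h1.trans (congrArg _ h2)
  intro w hw
  have hpart : ∀ L : 𝕜 →L[ℝ] ℝ, (J (L.compLpL P (vol g) w.1), J (L.compLpL P (vol g) w.2)) ∈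
      (testGraph 𝕜 g V P).topologicalClosure := fun L =>
    hJ (L.compLpL P (vol g) w.1, L.compLpL P (vol g) w.2)
      (((show DistribEq g V w.1 w.2 from hw).clm_comp L).congr
        (ContinuousLinearMap.coeFn_compLpL _ _).symm (ContinuousLinearMap.coeFn_compLpL _ _).symm)
  have hsplit : ∀ u : Lp 𝕜 P (vol g), u = J ((RCLike.reCLM (K := 𝕜)).compLpL P (vol g) u) +
      (RCLike.I : 𝕜) • J ((RCLike.imCLM (K := 𝕜)).compLpL P (vol g) u) := by
    intro u
    refine Lp.ext ?_
    filter_upwards [Lp.coeFn_add (J ((RCLike.reCLM (K := 𝕜)).compLpL P (vol g) u))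
      ((RCLike.I : 𝕜) • J ((RCLike.imCLM (K := 𝕜)).compLpL P (vol g) u)),
      Lp.coeFn_smul (RCLike.I : 𝕜) (J ((RCLike.imCLM (K := 𝕜)).compLpL P (vol g) u)),
      ContinuousLinearMap.coeFn_compLpL (RCLike.ofRealCLM (K := 𝕜))
        ((RCLike.reCLM (K := 𝕜)).compLpL P (vol g) u),
      ContinuousLinearMap.coeFn_compLpL (RCLike.ofRealCLM (K := 𝕜))
        ((RCLike.imCLM (K := 𝕜)).compLpL P (vol g) u),
      ContinuousLinearMap.coeFn_compLpL (RCLike.reCLM (K := 𝕜)) u,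
      ContinuousLinearMap.coeFn_compLpL (RCLike.imCLM (K := 𝕜)) u] with x e1 e2 e3 e4 e5 e6
    rw [e1, Pi.add_apply, e2, Pi.smul_apply, e3, e4, e5, e6]
    simp [mul_comm RCLike.I]
  have := Submodule.add_mem _ (hpart RCLike.reCLM)
    (Submodule.smul_mem _ (RCLike.I : 𝕜) (hpart RCLike.imCLM))
  convert! this using 1
  exact Prod.ext (hsplit w.1) (hsplit w.2)

end Core
end RiemannianSchrodinger

theorem mainTheorem4 {𝕜 : Type*} [RCLike 𝕜] {n : ℕ} {M : Type*} [TopologicalSpace M] [T2Space M]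
    [SecondCountableTopology M] [ChartedSpace (EuclideanSpace ℝ (Fin n)) M]
    [IsManifold (𝓡 n) ∞ M] [MeasurableSpace M] [BorelSpace M]
    (g : RiemannianSchrodinger.SmoothMetric n M) (V : M → ℝ) (hV : RiemannianSchrodinger.MemLinftyLoc g V)
    (hVpos : ∀ᵐ x ∂(RiemannianSchrodinger.vol g), 0 < V x)
    (p : ℝ) (hp : 1 < p) [Fact (1 ≤ ENNReal.ofReal p)]
    (hPP : RiemannianSchrodinger.LpPositivityPreserving g V (ENNReal.ofReal p))
    (hPP' : RiemannianSchrodinger.LpPositivityPreserving g V (ENNReal.ofReal (p / (p - 1)))) :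
    (RiemannianSchrodinger.schrodingerMax 𝕜 g V (ENNReal.ofReal p)).HasCore
      (RiemannianSchrodinger.testSubmodule 𝕜 g (ENNReal.ofReal p)) := by
  have hpq : p.HolderConjugate (p / (p - 1)) := Real.HolderConjugate.conjExponent hp
  have hV0 : ∀ᵐ x ∂(RiemannianSchrodinger.vol g), 0 ≤ V x := hVpos.mono fun x hx => hx.le
  set A := RiemannianSchrodinger.schrodingerMax 𝕜 g V (ENNReal.ofReal p)
  set S := RiemannianSchrodinger.testSubmodule 𝕜 g (ENNReal.ofReal p)
  have hA : A.graph = RiemannianSchrodinger.maxGraph 𝕜 g V (ENNReal.ofReal p) :=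
    RiemannianSchrodinger.schrodingerMax_graph 𝕜 g V _
  have hAc : A.IsClosed := by
    rw [LinearPMap.IsClosed, hA]
    exact RiemannianSchrodinger.isClosed_maxGraph hV hpq
  have hle : A.domRestrict S ≤ A := LinearPMap.domRestrict_le
  have hcl := hAc.isClosable.leIsClosable hle
  refine ⟨fun u hu => ?_, LinearPMap.eq_of_eq_graph ?_⟩
  · obtain ⟨f, hf⟩ := RiemannianSchrodinger.exists_mem_testGraph hV hu
    exact LinearPMap.mem_domain_of_mem_graph (y := f) (by rw [hA]; exact hf.1)
  · rw [← hcl.graph_closure_eq_closure_graph]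
    refine le_antisymm (Submodule.topologicalClosure_minimal _ (LinearPMap.le_graph_of_le hle) hAc)
      ?_
    rw [hA]
    refine (RiemannianSchrodinger.maxGraph_le_topologicalClosure 𝕜 hPP hPP' hpq hV hV0).trans
      (Submodule.topologicalClosure_mono ?_)
    rintro w ⟨hw, hwS, -⟩
    obtain ⟨y, hy1, hy2⟩ := (LinearPMap.mem_graph_iff _).1 (hA.ge hw)
    rw [LinearPMap.mem_graph_iff]
    refine ⟨⟨w.1, hwS, hy1 ▸ y.2⟩, rfl, ?_⟩
    rw [← hy2]
    exact LinearPMap.domRestrict_apply hy1.symm
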